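/- All systems are finite-dimensional and logarithms are to base 2. Let $\mathcal N^{A'S\to B}$ be a quantum channel (completely positive and trace preserving) and $|\psi\rangle^{SS'}$ a pure state; the sender has access to $S'$ and to the input $A'$, and the receiver gets $B$. For $n$ uses of the channel, a code with parameters $(|R|,|\tilde A|,|\hat A|)$ and error $\varepsilon$ consists of an encoding channel $\mathcal E^{R'\tilde A S'^n\to A'^n\hat A}$ and a decoding channel $\mathcal D^{B^n\tilde B\to\bar B\hat B}$ with $\|\mathcal D(\mathcal N^{\otimes n}(\mathcal E(\Phi^{RR'}\otimes\Phi^{\tilde A\tilde B}\otimes(\psi^{SS'})^{\otimes n})))-\Phi^{R\bar B}\otimes\Phi^{\hat A\hat B}\|_1\le\varepsilon$, where $\Phi$ denotes maximally entangled states. A real number $Q$ is an achievable unassisted rate if there are codes for all $n$ with $|\tilde A|=|\hat A|=1$, errors $\varepsilon_n\to0$ and $\frac1n\log|R|\to Q$; the unassisted capacity is the supremum of the achievable unassisted rates. Let $\sigma^{AA'S}$ be a mixed state with $\sigma^S=\psi^S$, let $\mathcal N(\sigma)$ be the resulting state on $AB$, let $D$ be a system purifying $\sigma$, and let $E$ be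 the environment of an isometric extension of $\mathcal N$, so that $ABED$ is in a pure state. Let $I(X;Y)=H(X)+H(Y)-H(XY)$ be the mutual information and $I(A\rangle B)=H(B)-H(AB)$ the coherent information. Then: 1. (Entanglement cost.) If $I(A;B)_{\mathcal N(\sigma)}>I(A;S)_\sigma$, there are codes with vanishing error, $\frac1n\log|R|\to\frac12I(A;B)_{\mathcal N(\sigma)}-\frac12I(A;S)_\sigma$, $\frac1n\log|\tilde A|\to\frac12I(A;ED)_{\mathcal N(\sigma)}$ and $\frac1n\log|\hat A|\to\frac12I(A;S)_\sigma$; hence entanglement is consumed at the net rate $\frac12[I(A;ED)_{\mathcal N(\sigma)}-I(A;S)_\sigma]$. 2. (Unassisted rate.) Transmission rate minus net entanglement cost is $$\tfrac12I(A;B)_{\mathcal N(\sigma)}-\tfrac12I(A;S)_\sigma-\tfrac12[I(A;ED)_{\mathcal N(\sigma)}-I(A;S)_\sigma]=I(A\rangle B)_{\mathcal N(\sigma)}.$$ If the net entanglement cost $\frac12[I(A;ED)_{\mathcal N(\sigma)}-I(A;S)_\sigma]$ is nonnegative, then every $Q$ with $0\le Q\le I(A\rangle B)_{\mathcal N(\sigma)}$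 is an achievable unassisted rate (in particular $\frac12I(A\rangle B)_{\mathcal N(\sigma)}$ is, when it is nonnegative), and the unassisted capacity is at least $I(A\rangle B)_{\mathcal N(\sigma)}$. 3. For every such $\sigma$, whatever the sign of the net cost, every $Q$ with $0\le Q\le\min\{I(A\rangle B)_{\mathcal N(\sigma)},\ \frac12I(A;B)_{\mathcal N(\sigma)}-\frac12I(A;S)_\sigma\}$ is an achievable unassisted rate, and the unassisted capacity is at least this minimum. -/

import Mathlib

open Matrix Filter Topology
open scoped ComplexOrder

noncomputable section

namespace QSideInfo

/-! Finite-dimensional systems are finite index types (the standard basis of the system);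
operators are complex matrices and a composite system is a product of index types. -/

section States

variable {a b c : Type*} [Fintype a] [Fintype b] [Fintype c]

/-- A density operator. -/
def IsState (ρ : Matrix a a ℂ) : Prop := ρ.PosSemidef ∧ ρ.trace = 1

/-- A normalized ket. -/
def IsKet (v : a → ℂ) : Prop := ∑ i, ‖v i‖ ^ 2 = 1

/-- The rank-one operator `|v⟩⟨v|`. -/
def proj (v : a → ℂ) : Matrix a a ℂ := Matrix.of fun i j => v i * star (v j)

/-- Partial trace over the second factor. -/
def traceSnd (X : Matrix (a × b) (a × b) ℂ) : Matrix a a ℂ :=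
  Matrix.of fun i j => ∑ k, X (i, k) (j, k)

/-- Partial trace over the first factor. -/
def traceFst (X : Matrix (a × b) (a × b) ℂ) : Matrix b b ℂ :=
  Matrix.of fun i j => ∑ k, X (k, i) (k, j)

/-- Partial trace over the middle factor. -/
def traceMid (X : Matrix (a × b × c) (a × b × c) ℂ) : Matrix (a × c) (a × c) ℂ :=
  Matrix.of fun i j => ∑ k, X (i.1, k, i.2) (j.1, k, j.2)

/-- The maximally entangled ket `d^{-1/2} ∑ᵢ |i i⟩`. -/
def maxEnt (d : ℕ) (i j : Fin d) : ℂ := if i = j then ((1 / Real.sqrt d : ℝ) : ℂ) else 0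

variable [DecidableEq a]

/-- The trace norm `tr |M|`, as the sum of the square roots of the eigenvalues of `Mᴴ M`. -/
def traceNorm (M : Matrix a a ℂ) : ℝ :=
  ∑ i, Real.sqrt ((Matrix.isHermitian_conjTranspose_mul_self M).eigenvalues i)

open Classical in
/-- The von Neumann entropy `-∑ λ log₂ λ` over the eigenvalues `λ` of a Hermitian operator
(only ever used for density operators). -/
def entropy (ρ : Matrix a a ℂ) : ℝ :=
  if h : ρ.IsHermitian then ∑ i, Real.negMulLog (h.eigenvalues i) / Real.log 2 else 0

variable [DecidableEq b]

/-- `I(a;b)_ρ = H(a)_ρ + H(b)_ρ - H(ab)_ρ`. -/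
def mutualInfo (ρ : Matrix (a × b) (a × b) ℂ) : ℝ :=
  entropy (traceSnd ρ) + entropy (traceFst ρ) - entropy ρ

/-- The coherent information `I(a⟩b)_ρ = H(b)_ρ - H(ab)_ρ`. -/
def coherentInfo (ρ : Matrix (a × b) (a × b) ℂ) : ℝ :=
  entropy (traceFst ρ) - entropy ρ

end States

section Channels

variable {a b r e : Type*} [Fintype a] [Fintype b] [Fintype e]

/-- Completely positive trace-preserving maps, in operator-sum form. -/
def IsChannel [DecidableEq a] (Φ : Matrix a a ℂ →ₗ[ℂ] Matrix b b ℂ) : Prop :=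
  ∃ (k : ℕ) (K : Fin k → Matrix b a ℂ),
    ∑ i, (K i)ᴴ * K i = 1 ∧ ∀ X, Φ X = ∑ i, K i * X * (K i)ᴴ

/-- `U : a → b ⊗ e` is an isometry with `Φ(X) = tr_e (U X Uᴴ)`. -/
def IsIsometricExtension [DecidableEq a] (Φ : Matrix a a ℂ →ₗ[ℂ] Matrix b b ℂ)
    (U : Matrix (b × e) a ℂ) : Prop :=
  Uᴴ * U = 1 ∧ ∀ X, Φ X = traceSnd (U * X * Uᴴ)

/-- `(id_r ⊗ Φ)(X)`. -/
def applySnd (Φ : Matrix a a ℂ →ₗ[ℂ] Matrix b b ℂ) (X : Matrix (r × a) (r × a) ℂ) :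
    Matrix (r × b) (r × b) ℂ :=
  Matrix.of fun p q => Φ (Matrix.of fun x y => X (p.1, x) (q.1, y)) p.2 q.2

/-- The tensor power `Φ^{⊗ n}`, given by its matrix elements: the `(f, g)` entry of the image
of the matrix unit `|x⟩⟨y|` is `∏ᵢ ⟨fᵢ| Φ(|xᵢ⟩⟨yᵢ|) |gᵢ⟩`. -/
def tensorPower [DecidableEq a] (Φ : Matrix a a ℂ →ₗ[ℂ] Matrix b b ℂ) (n : ℕ) :
    Matrix (Fin n → a) (Fin n → a) ℂ →ₗ[ℂ] Matrix (Fin n → b) (Fin n → b) ℂ where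
  toFun X := Matrix.of fun f g =>
    ∑ x, ∑ y, (∏ i, Φ (Matrix.single (x i) (y i) 1) (f i) (g i)) * X x y
  map_add' X Y := by
    ext f g
    simp [mul_add, Finset.sum_add_distrib]
  map_smul' c X := by
    ext f g
    simp [Finset.mul_sum, mul_left_comm]

end Channels

section Codes

variable {A' S S' B : Type*}
  [Fintype A'] [DecidableEq A'] [Fintype S] [DecidableEq S]
  [Fintype S'] [DecidableEq S'] [Fintype B] [DecidableEq B]

/-- `Φ^{RR'} ⊗ Φ^{B̃Ã} ⊗ ψ^{⊗ n}`, arranged as `(R B̃ Sⁿ) ⊗ (R' Ã S'ⁿ)`; the second factor is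
what the encoder acts on. -/
def inputState (ψ : S × S' → ℂ) (n r t : ℕ) :
    Matrix ((Fin r × Fin t × (Fin n → S)) × (Fin r × Fin t × (Fin n → S')))
      ((Fin r × Fin t × (Fin n → S)) × (Fin r × Fin t × (Fin n → S'))) ℂ :=
  proj fun p => maxEnt r p.1.1 p.2.1 * maxEnt t p.1.2.1 p.2.2.1 *
    ∏ i, ψ (p.1.2.2 i, p.2.2.2 i)

/-- `Φ^{R B̄} ⊗ Φ^{Â B̂}`, arranged as `(R Â) ⊗ (B̄ B̂)`. -/
def targetState (r h : ℕ) :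
    Matrix ((Fin r × Fin h) × (Fin r × Fin h)) ((Fin r × Fin h) × (Fin r × Fin h)) ℂ :=
  proj fun p => maxEnt r p.1.1 p.2.1 * maxEnt h p.1.2 p.2.2

/-- The state after encoding, arranged as `(R Â B̃) ⊗ (A' S)ⁿ`; the second factor is the input of
the `n` channel instances. -/
def encodedState (ψ : S × S' → ℂ) (n r t h : ℕ)
    (enc : Matrix (Fin r × Fin t × (Fin n → S')) (Fin r × Fin t × (Fin n → S')) ℂ →ₗ[ℂ]
      Matrix ((Fin n → A') × Fin h) ((Fin n → A') × Fin h) ℂ) :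
    Matrix ((Fin r × Fin h × Fin t) × (Fin n → A' × S))
      ((Fin r × Fin h × Fin t) × (Fin n → A' × S)) ℂ :=
  let f : (Fin r × Fin h × Fin t) × (Fin n → A' × S) →
      (Fin r × Fin t × (Fin n → S)) × ((Fin n → A') × Fin h) :=
    fun p => ((p.1.1, p.1.2.2, fun i => (p.2 i).2), (fun i => (p.2 i).1, p.1.2.1))
  (applySnd enc (inputState ψ n r t)).submatrix f f

/-- The state after encoding and transmission, arranged as `(R Â) ⊗ (Bⁿ B̃)`; the second factor
is what the decoder acts on. -/
def receivedState (N : Matrix (A' × S) (A' × S) ℂ →ₗ[ℂ] Matrix B B ℂ)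
    (ψ : S × S' → ℂ) (n r t h : ℕ)
    (enc : Matrix (Fin r × Fin t × (Fin n → S')) (Fin r × Fin t × (Fin n → S')) ℂ →ₗ[ℂ]
      Matrix ((Fin n → A') × Fin h) ((Fin n → A') × Fin h) ℂ) :
    Matrix ((Fin r × Fin h) × ((Fin n → B) × Fin t))
      ((Fin r × Fin h) × ((Fin n → B) × Fin t)) ℂ :=
  let f : (Fin r × Fin h) × ((Fin n → B) × Fin t) → (Fin r × Fin h × Fin t) × (Fin n → B) :=
    fun p => ((p.1.1, p.1.2, p.2.2), p.2.1)
  (applySnd (tensorPower N n) (encodedState ψ n r t h enc)).submatrix f f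

/-- There is a code of block length `n` and error at most `ε` for the channel `N` with side
information `ψ` that transmits an `r`-dimensional system, consumes a maximally entangled pair of
local dimension `t` and returns one of local dimension `h`. -/
def HasCode (N : Matrix (A' × S) (A' × S) ℂ →ₗ[ℂ] Matrix B B ℂ) (ψ : S × S' → ℂ)
    (n r t h : ℕ) (ε : ℝ) : Prop :=
  0 < r ∧ 0 < t ∧ 0 < h ∧
  ∃ (enc : Matrix (Fin r × Fin t × (Fin n → S')) (Fin r × Fin t × (Fin n → S')) ℂ →ₗ[ℂ]
        Matrix ((Fin n → A') × Fin h) ((Fin n → A') × Fin h) ℂ)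
    (dec : Matrix ((Fin n → B) × Fin t) ((Fin n → B) × Fin t) ℂ →ₗ[ℂ]
        Matrix (Fin r × Fin h) (Fin r × Fin h) ℂ),
    IsChannel enc ∧ IsChannel dec ∧
    traceNorm (applySnd dec (receivedState N ψ n r t h enc) - targetState r h) ≤ ε

/-- `Q` is an achievable rate without preshared entanglement: there are codes of every block
length that neither consume nor return entanglement, with vanishing error and with
`(1/n) log₂ |R|` converging to `Q`. -/
def UnassistedAchievable (N : Matrix (A' × S) (A' × S) ℂ →ₗ[ℂ] Matrix B B ℂ)
    (ψ : S × S' → ℂ) (Q : ℝ) : Prop :=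
  ∃ (r : ℕ → ℕ) (ε : ℕ → ℝ),
    (∀ n, HasCode N ψ n (r n) 1 1 (ε n)) ∧
    Tendsto ε atTop (𝓝 0) ∧
    Tendsto (fun n => Real.logb 2 (r n) / n) atTop (𝓝 Q)

/-- The unassisted quantum capacity: the supremum of the achievable rates. -/
def unassistedCapacity (N : Matrix (A' × S) (A' × S) ℂ →ₗ[ℂ] Matrix B B ℂ)
    (ψ : S × S' → ℂ) : EReal :=
  ⨆ Q ∈ {Q : ℝ | UnassistedAchievable N ψ Q}, (Q : EReal)

/-- The protocol consumes entanglement at rate `cin`, transmits qubits at rate `Q` and returns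
entanglement at rate `cout`, with vanishing error. -/
def AchievableWithEntanglement (N : Matrix (A' × S) (A' × S) ℂ →ₗ[ℂ] Matrix B B ℂ)
    (ψ : S × S' → ℂ) (Q cin cout : ℝ) : Prop :=
  ∃ (r t h : ℕ → ℕ) (ε : ℕ → ℝ),
    (∀ n, HasCode N ψ n (r n) (t n) (h n) (ε n)) ∧
    Tendsto ε atTop (𝓝 0) ∧
    Tendsto (fun n => Real.logb 2 (r n) / n) atTop (𝓝 Q) ∧
    Tendsto (fun n => Real.logb 2 (t n) / n) atTop (𝓝 cin) ∧
    Tendsto (fun n => Real.logb 2 (h n) / n) atTop (𝓝 cout)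

/-- For a ket `v` on `A (A' S) D` and `U : A' S → B E`, the ket `(1 ⊗ U ⊗ 1) v` on
`A B E D`, as a ket on `B (A (E D))`. -/
def outputKet {A E D : Type*} (U : Matrix (B × E) (A' × S) ℂ)
    (v : (A × A' × S) × D → ℂ) : B × (A × (E × D)) → ℂ :=
  fun p => ∑ x : A' × S, U (p.1, p.2.2.1) x * v ((p.2.1, x), p.2.2.2)

end Codes

end QSideInfo

end

/-! The code comes from a single random linear map V from Aⁿ to R B̃ Â, applied to the n-fold power
of a purification of σ on A S A' D. Two decoupling conditions on the same V suffice
(`hasCode_of_decoupling`). If V leaves R B̃ nearly maximally mixed and independent of Sⁿ, the coded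
ket and the initial ket Φ^{RR'} ⊗ Φ^{ÃB̃} ⊗ ψ^{⊗n} purify nearly the same state of R B̃ Sⁿ, so
Uhlmann's theorem (`exists_isometry_of_traceNormLE`) supplies an encoder from R' Ã S'ⁿ to A'ⁿ Â,
with Dⁿ discarded. If V also leaves R Â nearly maximally mixed and independent of Eⁿ Dⁿ after the
channel, Uhlmann's theorem applied to Bⁿ B̃ supplies a decoder that restores maximal entanglement
with R Â.

Decoupling is a second-moment computation. The entries of V are independent uniform third roots of
unity, suitably scaled, and the expected squared Hilbert–Schmidt deviation from the product state is
at most the purity of the input divided by the dimension of the traced-out factor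
(`avg_nsq_deviation_le`). Cutting the i.i.d. ket down by typical projections (`exists_smoothed_ket`)
turns ranks and purities into entropies. With q, τ, η the rates of R, Ã, Â, the conditions become q
+ τ - η ≤ H(A|S) and q + η - τ ≤ H(A|ED), the closed region being reached by an arbitrarily small
decrease of q (`achievable_of_region`).

Here H(A|S) = H(A) - I(A;S), and purity of ABED gives H(A|ED) = H(B) - H(AB) = I(A⟩B) and I(A;B) +
I(A;ED) = 2H(A). The rates of claim 1 therefore satisfy both conditions with equality. For
unassisted transmission take τ = 0 and η = I(A⟩B) - q and throw the returned entanglement away: what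
remains is q ≤ I(A⟩B), so that η ≥ 0, and 2q ≤ I(A;B) - I(A;S). This is claim 3. Claim 2 follows
because a nonnegative net cost says precisely that I(A⟩B) is the smaller of the two bounds. -/

set_option linter.unusedSectionVars false

noncomputable section

namespace QSideInfo

/-! ### Hilbert–Schmidt norms, contractions and a variational trace norm. -/

section HilbertSchmidt

variable {X Y Z : Type*} [Fintype X] [Fintype Y] [Fintype Z]

/-- The squared Hilbert–Schmidt norm. A bipartite ket is encoded as a matrix `M`, with reduced
state `M * Mᴴ` and squared norm `nsq M`. -/
def nsq (M : Matrix X Y ℂ) : ℝ := ∑ x, ∑ y, ‖M x y‖ ^ 2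

theorem trace_mul_conjTranspose_self (M : Matrix X Y ℂ) : (M * Mᴴ).trace = (nsq M : ℂ) := by
  simp only [nsq, trace, diag_apply, mul_apply, conjTranspose_apply, Complex.ofReal_sum]
  refine Finset.sum_congr rfl fun x _ => Finset.sum_congr rfl fun y _ => ?_
  rw [← starRingEnd_apply, Complex.mul_conj']
  push_cast; rfl

theorem nsq_eq_re_trace (M : Matrix X Y ℂ) : nsq M = (M * Mᴴ).trace.re := by
  rw [trace_mul_conjTranspose_self]; simp

theorem nsq_conjTranspose (M : Matrix X Y ℂ) : nsq Mᴴ = nsq M := by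
  unfold nsq
  rw [Finset.sum_comm]
  simp

theorem nsq_add_le (M N : Matrix X Y ℂ) : nsq (M + N) ≤ 2 * nsq M + 2 * nsq N := by
  simp only [nsq, Finset.mul_sum, ← Finset.sum_add_distrib]
  refine Finset.sum_le_sum fun x _ => Finset.sum_le_sum fun y _ => ?_
  have h := norm_add_le (M x y) (N x y)
  have h0 := norm_nonneg (M x y + N x y)
  rw [Matrix.add_apply]
  nlinarith [sq_nonneg (‖M x y‖ - ‖N x y‖)]

theorem nsq_sub (M N : Matrix X Y ℂ) :
    nsq (M - N) = nsq M + nsq N - 2 * (M * Nᴴ).trace.re := by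
  simp only [nsq, trace, diag_apply, mul_apply, conjTranspose_apply, Complex.re_sum,
    Finset.mul_sum, ← Finset.sum_add_distrib, ← Finset.sum_sub_distrib]
  refine Finset.sum_congr rfl fun x _ => Finset.sum_congr rfl fun y _ => ?_
  simp only [← Complex.normSq_eq_norm_sq, Complex.normSq_apply, Matrix.sub_apply, Complex.sub_re,
    Complex.sub_im, Complex.mul_re, Complex.star_def, Complex.conj_re, Complex.conj_im]
  ring

/-- The operator norm of `U` is at most one. -/
def Contr [DecidableEq Y] (U : Matrix X Y ℂ) : Prop := (1 - Uᴴ * U).PosSemidef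

theorem Contr.nsq_mul_le [DecidableEq Y] {U : Matrix X Y ℂ} (hU : Contr U) (P : Matrix Y Z ℂ) :
    nsq (U * P) ≤ nsq P := by
  have h := (hU.conjTranspose_mul_mul_same P).trace_nonneg
  rw [← nsq_conjTranspose (U * P), ← nsq_conjTranspose P, nsq_eq_re_trace, nsq_eq_re_trace]
  have h2 : Pᴴ * (1 - Uᴴ * U) * P = Pᴴ * Pᴴᴴ - (U * P)ᴴ * (U * P)ᴴᴴ := by
    simp [Matrix.mul_sub, Matrix.sub_mul, Matrix.mul_assoc, conjTranspose_mul]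
  rw [h2, trace_sub, Complex.le_def] at h
  have := h.1
  simp only [Complex.zero_re, Complex.sub_re] at this
  linarith

theorem Contr.mul [DecidableEq Y] [DecidableEq Z] {U : Matrix X Y ℂ} {V : Matrix Y Z ℂ}
    (hU : Contr U) (hV : Contr V) : Contr (U * V) := by
  have h := (hU.conjTranspose_mul_mul_same V).add hV
  unfold Contr
  convert h using 1
  simp [Matrix.mul_sub, Matrix.sub_mul, Matrix.mul_assoc, conjTranspose_mul]

theorem contr_of_isometry [DecidableEq Y] {U : Matrix X Y ℂ} (hU : Uᴴ * U = 1) : Contr U := by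
  unfold Contr; rw [hU, sub_self]; exact PosSemidef.zero

/-- A Hermitian idempotent is a contraction. -/
theorem contr_of_projection [DecidableEq X] {P : Matrix X X ℂ} (hH : Pᴴ = P) (hP : P * P = P) :
    Contr P := by
  unfold Contr
  have h := posSemidef_conjTranspose_mul_self (1 - P)
  convert h using 1
  simp [hH, hP, Matrix.mul_sub, Matrix.sub_mul]

/-- A partial isometry is a contraction. -/
theorem contr_of_partialIsometry [DecidableEq Y] {W : Matrix X Y ℂ} (hW : W * Wᴴ * W = W) :
    Contr W := by
  have h : Contr (Wᴴ * W) := contr_of_projection (by simp [conjTranspose_mul])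
    (by rw [Matrix.mul_assoc, ← Matrix.mul_assoc W, hW])
  unfold Contr at h ⊢
  convert h using 2
  rw [conjTranspose_mul, conjTranspose_conjTranspose, Matrix.mul_assoc, ← Matrix.mul_assoc W, hW]

/-- Cauchy–Schwarz with the product replaced by a weighted arithmetic mean. The bound is then linear
in the squared norms, so it can be averaged over the random code without square roots; `s` is tuned
later. -/
theorem norm_trace_mul_conjTranspose_le (P Q : Matrix X Y ℂ) {s : ℝ} (hs : 0 < s) :
    ‖(P * Qᴴ).trace‖ ≤ (s * nsq P + nsq Q / s) / 2 := by
  simp only [trace, diag_apply, mul_apply, conjTranspose_apply]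
  refine (norm_sum_le _ _).trans ?_
  refine (Finset.sum_le_sum fun x _ => norm_sum_le _ _).trans ?_
  simp only [nsq, Finset.mul_sum, Finset.sum_div, ← Finset.sum_add_distrib]
  refine Finset.sum_le_sum fun x _ => Finset.sum_le_sum fun y _ => ?_
  rw [norm_mul, norm_star]
  have h : s * ‖P x y‖ ^ 2 + ‖Q x y‖ ^ 2 / s - 2 * (‖P x y‖ * ‖Q x y‖)
      = (s * ‖P x y‖ - ‖Q x y‖) ^ 2 / s := by
    field_simp
    ring
  have h2 : 0 ≤ (s * ‖P x y‖ - ‖Q x y‖) ^ 2 / s := by positivity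
  linarith

/-- The trace norm of `M` is at most `δ`, in variational form. -/
def TraceNormLE [DecidableEq X] (M : Matrix X X ℂ) (δ : ℝ) : Prop :=
  ∀ U : Matrix X X ℂ, Contr U → ‖(U * M).trace‖ ≤ δ

theorem TraceNormLE.add [DecidableEq X] {M N : Matrix X X ℂ} {δ ε : ℝ} (hM : TraceNormLE M δ)
    (hN : TraceNormLE N ε) : TraceNormLE (M + N) (δ + ε) := fun U hU => by
  rw [Matrix.mul_add, trace_add]
  exact (norm_add_le _ _).trans (add_le_add (hM U hU) (hN U hU))

theorem TraceNormLE.mono [DecidableEq X] {M : Matrix X X ℂ} {δ ε : ℝ} (hM : TraceNormLE M δ)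
    (h : δ ≤ ε) : TraceNormLE M ε := fun U hU => (hM U hU).trans h

theorem TraceNormLE.neg [DecidableEq X] {M : Matrix X X ℂ} {δ : ℝ} (hM : TraceNormLE M δ) :
    TraceNormLE (-M) δ := fun U hU => by
  rw [Matrix.mul_neg, trace_neg, norm_neg]; exact hM U hU

theorem traceNormLE_mul_conjTranspose [DecidableEq X] (P Q : Matrix X Y ℂ) {s : ℝ} (hs : 0 < s) :
    TraceNormLE (P * Qᴴ) ((s * nsq P + nsq Q / s) / 2) := fun U hU => by
  rw [← Matrix.mul_assoc]
  refine (norm_trace_mul_conjTranspose_le (U * P) Q hs).trans ?_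
  have := hU.nsq_mul_le P
  gcongr

/-- Reduced states of nearby kets are close in trace norm. -/
theorem traceNormLE_reduced_sub [DecidableEq X] (M N : Matrix X Y ℂ) {s : ℝ} (hs : 0 < s) :
    TraceNormLE (M * Mᴴ - N * Nᴴ) (nsq (M - N) / s + s * (nsq M + nsq N) / 2) := by
  have h1 := traceNormLE_mul_conjTranspose (M - N) M (inv_pos.mpr hs)
  have h2 := traceNormLE_mul_conjTranspose N (M - N) hs
  have h := h1.add h2
  have e : (M - N) * Mᴴ + N * (M - N)ᴴ = M * Mᴴ - N * Nᴴ := by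
    simp [Matrix.sub_mul, Matrix.mul_sub]
  rw [e] at h
  refine h.mono (le_of_eq ?_)
  field_simp
  ring

end HilbertSchmidt

/-! ### Polar decomposition, the Powers–Størmer inequality and Uhlmann's theorem. -/

section Spectral

variable {X Y Z : Type*} [Fintype X] [Fintype Y] [Fintype Z]
  [DecidableEq X] [DecidableEq Y] [DecidableEq Z]

theorem exists_diagonalization {ρ : Matrix X X ℂ} (hρ : ρ.IsHermitian) :
    ∃ F : Matrix X X ℂ, F * Fᴴ = 1 ∧ Fᴴ * F = 1 ∧
      ρ = F * diagonal (fun i => (hρ.eigenvalues i : ℂ)) * Fᴴ := by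
  refine ⟨hρ.eigenvectorUnitary, ?_, ?_, ?_⟩
  · exact Unitary.coe_mul_star_self _
  · exact Unitary.coe_star_mul_self _
  · conv_lhs => rw [hρ.spectral_theorem, Unitary.conjStarAlgAut_apply]
    rfl

theorem conj_diagonal_mul {F : Matrix X X ℂ} (hF : Fᴴ * F = 1) (d e : X → ℂ) :
    (F * diagonal d * Fᴴ) * (F * diagonal e * Fᴴ) = F * diagonal (fun i => d i * e i) * Fᴴ := by
  calc _ = F * diagonal d * (Fᴴ * F) * diagonal e * Fᴴ := by simp only [Matrix.mul_assoc]
    _ = _ := by rw [hF, Matrix.mul_one, Matrix.mul_assoc F, diagonal_mul_diagonal]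

theorem conj_diagonal_conjTranspose (F : Matrix X X ℂ) (d : X → ℝ) :
    (F * diagonal (fun i => (d i : ℂ)) * Fᴴ)ᴴ = F * diagonal (fun i => (d i : ℂ)) * Fᴴ := by
  simp only [conjTranspose_mul, conjTranspose_conjTranspose, diagonal_conjTranspose,
    Matrix.mul_assoc]
  congr 3
  ext i
  simp

theorem trace_conj_diagonal {F : Matrix X X ℂ} (hF : Fᴴ * F = 1) (d : X → ℂ) :
    (F * diagonal d * Fᴴ).trace = ∑ i, d i := by
  rw [trace_mul_comm, ← Matrix.mul_assoc, hF, Matrix.one_mul, trace_diagonal]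

theorem exists_hermitian_sqrt {ρ : Matrix X X ℂ} (hρ : ρ.PosSemidef) :
    ∃ G : Matrix X X ℂ, Gᴴ = G ∧ G * G = ρ := by
  obtain ⟨F, hF1, hF2, hF⟩ := exists_diagonalization hρ.1
  refine ⟨F * diagonal (fun i => (Real.sqrt (hρ.1.eigenvalues i) : ℂ)) * Fᴴ,
    conj_diagonal_conjTranspose F _, ?_⟩
  rw [conj_diagonal_mul hF2]
  conv_rhs => rw [hF]
  congr 3
  ext i
  norm_cast
  exact Real.mul_self_sqrt (hρ.eigenvalues_nonneg i)

/-- Polar decomposition: `M * Wᴴ` is the square root of `M * Mᴴ`. -/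
theorem exists_polar (M : Matrix X Y ℂ) {ρ : Matrix X X ℂ} (hρ : ρ.IsHermitian)
    (e : ρ = M * Mᴴ) :
    ∃ W : Matrix X Y ℂ, W * Wᴴ * W = W ∧ (M * Wᴴ).PosSemidef ∧ (M * Wᴴ) * (M * Wᴴ) = ρ ∧
      (M * Wᴴ).trace = ∑ i, (Real.sqrt (hρ.eigenvalues i) : ℂ) := by
  obtain ⟨F, hF1, hF2, hF⟩ := exists_diagonalization hρ
  have hpos : ∀ i, 0 ≤ hρ.eigenvalues i :=
    (PosSemidef.eigenvalues_nonneg (A := ρ) (by rw [e]; exact posSemidef_self_mul_conjTranspose M))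
  set l := hρ.eigenvalues with hl
  -- `G` is the generalized inverse square root of `ρ`: the convention `0⁻¹ = 0` takes care of the
  -- kernel. The partial isometry is `W = G * M`.
  set G : Matrix X X ℂ := F * diagonal (fun i => (((Real.sqrt (l i))⁻¹ : ℝ) : ℂ)) * Fᴴ with hG
  have hGH : Gᴴ = G := conj_diagonal_conjTranspose F _
  have hMW : M * (G * M)ᴴ = F * diagonal (fun i => (Real.sqrt (l i) : ℂ)) * Fᴴ := by
    rw [conjTranspose_mul, hGH, ← Matrix.mul_assoc, ← e, hF, hG, conj_diagonal_mul hF2]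
    congr 3
    ext i
    norm_cast
    by_cases h0 : l i = 0
    · simp [h0]
    · have : Real.sqrt (l i) ≠ 0 := by
        rw [Real.sqrt_ne_zero']; exact lt_of_le_of_ne (hpos i) (Ne.symm h0)
      field_simp
      exact (Real.sq_sqrt (hpos i)).symm
  refine ⟨G * M, ?_, ?_, ?_, ?_⟩
  · rw [Matrix.mul_assoc G M, hMW, ← Matrix.mul_assoc]
    congr 1
    rw [hG, conj_diagonal_mul hF2, conj_diagonal_mul hF2]
    congr 3
    ext i
    norm_cast
    by_cases h0 : Real.sqrt (l i) = 0
    · simp [h0]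
    · field_simp
  · rw [hMW]
    refine PosSemidef.mul_mul_conjTranspose_same ?_ F
    rw [posSemidef_diagonal_iff]
    intro i
    exact_mod_cast Real.sqrt_nonneg _
  · rw [hMW, conj_diagonal_mul hF2]
    conv_rhs => rw [hF]
    congr 3
    ext i
    norm_cast
    exact Real.mul_self_sqrt (hpos i)
  · rw [hMW, trace_conj_diagonal hF2]

theorem conjTranspose_partialIsometry {W : Matrix X Y ℂ} (hW : W * Wᴴ * W = W) :
    Wᴴ * Wᴴᴴ * Wᴴ = Wᴴ := by
  conv_rhs => rw [← hW]
  simp [conjTranspose_mul, Matrix.mul_assoc]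

/-- The supremum over contractions is attained at the polar part of `Mᴴ`, where the trace is the sum
of the singular values. This is the passage from the variational bounds to the trace norm in the
definition of a code. -/
theorem traceNorm_le_of_traceNormLE {M : Matrix X X ℂ} {δ : ℝ} (h : TraceNormLE M δ) :
    traceNorm M ≤ δ := by
  obtain ⟨W, hW, -, -, ht⟩ := exists_polar Mᴴ (isHermitian_conjTranspose_mul_self M) (by simp)
  have h1 := h W (contr_of_partialIsometry hW)
  have h2 : (W * M).trace = star ((Mᴴ * Wᴴ).trace) := by
    rw [← trace_conjTranspose, ← conjTranspose_mul, conjTranspose_conjTranspose]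
  rw [h2, ht, norm_star] at h1
  unfold traceNorm
  have h3 : ‖∑ i, (Real.sqrt ((isHermitian_conjTranspose_mul_self M).eigenvalues i) : ℂ)‖
      = ∑ i, Real.sqrt ((isHermitian_conjTranspose_mul_self M).eigenvalues i) := by
    rw [← Complex.ofReal_sum, Complex.norm_real, Real.norm_of_nonneg]
    exact Finset.sum_nonneg fun _ _ => Real.sqrt_nonneg _
  rwa [h3] at h1

/-- The Powers–Størmer inequality. -/
theorem nsq_sub_le_of_traceNormLE {p s : Matrix X X ℂ} (hp : p.PosSemidef) (hs : s.PosSemidef)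
    {δ : ℝ} (h : TraceNormLE (p * p - s * s) δ) : nsq (p - s) ≤ δ := by
  have hT : (p - s).IsHermitian := hp.1.sub hs.1
  obtain ⟨F, hF1, hF2, hF⟩ := exists_diagonalization hT
  set l := hT.eigenvalues
  set p' := Fᴴ * p * F with hp'
  set s' := Fᴴ * s * F with hs'
  have hpp : p'.PosSemidef := hp.conjTranspose_mul_mul_same F
  have hss : s'.PosSemidef := hs.conjTranspose_mul_mul_same F
  have hd : p' - s' = diagonal (fun i => (l i : ℂ)) := by
    have : p' - s' = Fᴴ * (p - s) * F := by simp [hp', hs', Matrix.mul_sub, Matrix.sub_mul]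
    rw [this, hF]
    calc _ = (Fᴴ * F) * diagonal (fun i => (l i : ℂ)) * (Fᴴ * F) := by
          simp only [Matrix.mul_assoc]
      _ = _ := by rw [hF2]; simp
  -- The test operator is the sign of `p - s`. In the eigenbasis of `p - s` its trace against `p² -
  -- s²` is `∑ |lᵢ| (p'ᵢᵢ + s'ᵢᵢ)`, and `|lᵢ| = |p'ᵢᵢ - s'ᵢᵢ| ≤ p'ᵢᵢ + s'ᵢᵢ`.
  set g : X → ℝ := fun i => if 0 ≤ l i then 1 else -1 with hg
  set U : Matrix X X ℂ := F * diagonal (fun i => (g i : ℂ)) * Fᴴ with hU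
  have hgg : ∀ i, g i * g i = 1 := fun i => by simp only [hg]; split_ifs <;> norm_num
  have hUc : Contr U := by
    apply contr_of_isometry
    rw [hU, conj_diagonal_conjTranspose, conj_diagonal_mul hF2]
    have : (fun i => (g i : ℂ) * (g i : ℂ)) = fun _ => 1 := by
      ext i; rw [← Complex.ofReal_mul, hgg]; simp
    rw [this, diagonal_one, Matrix.mul_one, hF1]
  have key : (U * (p * p - s * s)).trace = ∑ i, (g i : ℂ) * (l i * (p' i i + s' i i)) := by
    have h1 : (U * (p * p - s * s)).trace
        = (diagonal (fun i => (g i : ℂ)) * (p' * p' - s' * s')).trace := by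
      have : p' * p' - s' * s' = Fᴴ * (p * p - s * s) * F := by
        calc p' * p' - s' * s' = Fᴴ * p * (F * Fᴴ) * p * F - Fᴴ * s * (F * Fᴴ) * s * F := by
              simp only [hp', hs', Matrix.mul_assoc]
          _ = _ := by rw [hF1]; simp [Matrix.mul_sub, Matrix.sub_mul, Matrix.mul_assoc]
      rw [this, hU, Matrix.mul_assoc, Matrix.mul_assoc, trace_mul_comm]
      simp only [Matrix.mul_assoc]
    rw [h1]
    simp only [trace, diag_apply, diagonal_mul]
    refine Finset.sum_congr rfl fun i _ => ?_
    congr 1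
    -- Symmetrizing makes up for `p'` and `s'` not commuting; the diagonal entries can be read off
    -- because `p' - s'` is diagonal.
    have h2 : (2 : ℂ) • (p' * p' - s' * s') = (p' - s') * (p' + s') + (p' + s') * (p' - s') := by
      simp only [Matrix.mul_add, Matrix.sub_mul, Matrix.add_mul, Matrix.mul_sub, two_smul]
      abel
    have h3 := congrFun (congrFun h2 i) i
    rw [hd] at h3
    simp only [Matrix.smul_apply, smul_eq_mul, Matrix.add_apply, diagonal_mul, mul_diagonal] at h3
    linear_combination h3 / 2
  have hpi : ∀ i, 0 ≤ (p' i i).re ∧ (p' i i).im = 0 := fun i => by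
    have := Complex.le_def.1 (hpp.diag_nonneg (i := i)); exact ⟨this.1, this.2.symm⟩
  have hsi : ∀ i, 0 ≤ (s' i i).re ∧ (s' i i).im = 0 := fun i => by
    have := Complex.le_def.1 (hss.diag_nonneg (i := i)); exact ⟨this.1, this.2.symm⟩
  have hli : ∀ i, l i = (p' i i).re - (s' i i).re := fun i => by
    have := congrArg Complex.re (congrFun (congrFun hd i) i)
    simpa using this.symm
  have hn : nsq (p - s) = ∑ i, l i * l i := by
    rw [nsq_eq_re_trace, hT.eq]
    conv_lhs => rw [hF]
    rw [conj_diagonal_mul hF2, trace_conj_diagonal hF2]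
    simp
  calc nsq (p - s) = ∑ i, l i * l i := hn
    _ ≤ ∑ i, g i * (l i * ((p' i i).re + (s' i i).re)) := by
        refine Finset.sum_le_sum fun i _ => ?_
        have h1 := (hpi i).1
        have h2 := (hsi i).1
        have h3 := hli i
        simp only [hg]
        split_ifs with h0
        · nlinarith
        · push Not at h0; nlinarith
    _ = ((U * (p * p - s * s)).trace).re := by
        rw [key, Complex.re_sum]
        refine Finset.sum_congr rfl fun i _ => ?_
        simp
    _ ≤ ‖(U * (p * p - s * s)).trace‖ := Complex.re_le_norm _
    _ ≤ δ := h U hUc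

/-- The ket `M ⊗ |none⟩`. -/
def padNone {P : Type*} (M : Matrix X Z ℂ) : Matrix X (Z × Option P) ℂ :=
  Matrix.of fun x q => if q.2 = none then M x q.1 else 0

/-- Uhlmann's theorem: purifications of nearby states are related by an isometry up to a small
error. The isometry acts on the right. -/
theorem exists_isometry_of_traceNormLE [Nonempty Z] (M : Matrix X Y ℂ) (M' : Matrix X Z ℂ)
    {δ : ℝ} (h : TraceNormLE (M * Mᴴ - M' * M'ᴴ) δ) :
    ∃ T : Matrix Y (Z × Option Y) ℂ, T * Tᴴ = 1 ∧ nsq (M * T - padNone M') ≤ δ := by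
  obtain ⟨W, hW, hp, hpp, -⟩ := exists_polar M (isHermitian_mul_conjTranspose_self M) rfl
  obtain ⟨W', hW', hs, hss, -⟩ := exists_polar M' (isHermitian_mul_conjTranspose_self M') rfl
  -- Multiplying by `C` aligns the polar parts, so the overlap of `M * C` with `M'` equals that of
  -- the two positive square roots. `C` is only a contraction; the flag register `Option Y` leaves
  -- room to complete it to `T` with `T * Tᴴ = 1`, the defect `1 - C * Cᴴ` going to the `some`
  -- sectors.
  set C : Matrix Y Z ℂ := Wᴴ * W' with hC
  have hCc : Contr Cᴴ := by
    rw [hC, conjTranspose_mul, conjTranspose_conjTranspose]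
    exact (contr_of_partialIsometry (conjTranspose_partialIsometry hW')).mul
      (contr_of_partialIsometry hW)
  obtain ⟨G, hG⟩ : ∃ G : Matrix Y Y ℂ, 1 - C * Cᴴ = Gᴴ * G := by
    have := hCc
    unfold Contr at this
    rw [conjTranspose_conjTranspose] at this
    obtain ⟨G, hG, hGG⟩ := exists_hermitian_sqrt this
    exact ⟨G, by rw [hG, hGG]⟩
  obtain ⟨z0⟩ := ‹Nonempty Z›
  set T : Matrix Y (Z × Option Y) ℂ := Matrix.of fun y q =>
    Option.elim q.2 (C y q.1) (fun y' => if q.1 = z0 then star (G y' y) else 0) with hT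
  have hTT : T * Tᴴ = 1 := by
    have : T * Tᴴ = C * Cᴴ + Gᴴ * G := by
      ext y y'
      simp only [mul_apply, Matrix.add_apply, conjTranspose_apply, hT, of_apply,
        Fintype.sum_prod_type, Fintype.sum_option, Option.elim, Finset.sum_add_distrib]
      congr 1
      rw [Finset.sum_comm]
      refine Finset.sum_congr rfl fun k _ => ?_
      rw [Finset.sum_eq_single z0] <;> simp +contextual
    rw [this, ← hG]; abel
  refine ⟨T, hTT, ?_⟩
  have hcross : (M * T * (padNone M' : Matrix X (Z × Option Y) ℂ)ᴴ).trace
      = ((M * Wᴴ) * (M' * W'ᴴ)ᴴ).trace := by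
    have h1 : T * (padNone M' : Matrix X (Z × Option Y) ℂ)ᴴ = C * M'ᴴ := by
      ext y x
      simp [mul_apply, hT, padNone, Fintype.sum_prod_type, Fintype.sum_option]
    rw [Matrix.mul_assoc, h1, hC, conjTranspose_mul, conjTranspose_conjTranspose]
    simp only [Matrix.mul_assoc]
  have hpn : nsq (M * T) = nsq (M * Wᴴ) := by
    rw [nsq_eq_re_trace, nsq_eq_re_trace, hp.1.eq, hpp, conjTranspose_mul, Matrix.mul_assoc,
      ← Matrix.mul_assoc T, hTT, Matrix.one_mul]
  have hsn : nsq (padNone M' : Matrix X (Z × Option Y) ℂ) = nsq (M' * W'ᴴ) := by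
    rw [nsq_eq_re_trace (M' * W'ᴴ), hs.1.eq, hss, ← nsq_eq_re_trace]
    simp [nsq, padNone, Fintype.sum_prod_type, Fintype.sum_option]
  -- Norms and overlap coincide with those of the square roots, so the distance does too, and
  -- Powers–Størmer bounds it.
  rw [nsq_sub, hcross, hpn, hsn, ← nsq_sub]
  refine nsq_sub_le_of_traceNormLE hp hs ?_
  rwa [hpp, hss]

end Spectral

/-! ### Finite averages and Parseval's identity. -/

section Average

variable {Ω : Type*} [Fintype Ω]

/-- The average over a finite type. -/
def avg (f : Ω → ℝ) : ℝ := (∑ v, f v) / Fintype.card Ω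

theorem avg_add (f g : Ω → ℝ) : avg (fun v => f v + g v) = avg f + avg g := by
  simp [avg, Finset.sum_add_distrib, add_div]

theorem avg_const_mul (c : ℝ) (f : Ω → ℝ) : avg (fun v => c * f v) = c * avg f := by
  rw [avg, avg, ← Finset.mul_sum, mul_div_assoc]

theorem avg_const [Nonempty Ω] (c : ℝ) : avg (fun _ : Ω => c) = c := by
  have : (Fintype.card Ω : ℝ) ≠ 0 := by exact_mod_cast Fintype.card_ne_zero
  simp [avg, this]

theorem avg_sum {ι : Type*} (s : Finset ι) (f : ι → Ω → ℝ) :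
    avg (fun v => ∑ i ∈ s, f i v) = ∑ i ∈ s, avg (f i) := by
  simp only [avg]
  rw [Finset.sum_comm, Finset.sum_div]

theorem exists_le_avg [Nonempty Ω] (f : Ω → ℝ) : ∃ v, f v ≤ avg f := by
  by_contra! h
  have h1 : ∑ _v : Ω, avg f < ∑ v, f v :=
    Finset.sum_lt_sum_of_nonempty Finset.univ_nonempty fun v _ => h v
  have h0 : (Fintype.card Ω : ℝ) ≠ 0 := by exact_mod_cast Fintype.card_ne_zero
  rw [Finset.sum_const, Finset.card_univ, nsmul_eq_mul, avg, mul_div_cancel₀ _ h0] at h1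
  exact lt_irrefl _ h1

/-- Parseval's identity for an orthogonal family of unimodular functions. -/
theorem avg_norm_sq_sum [Nonempty Ω] {ι : Type*} [DecidableEq ι] (s : Finset ι) (χ : ι → Ω → ℂ)
    (h1 : ∀ p v, ‖χ p v‖ = 1)
    (h0 : ∀ p ∈ s, ∀ q ∈ s, p ≠ q → ∑ v, χ p v * star (χ q v) = 0) (c : ι → ℂ) :
    avg (fun v => ‖∑ p ∈ s, c p * χ p v‖ ^ 2) = ∑ p ∈ s, ‖c p‖ ^ 2 := by
  have hc : (Fintype.card Ω : ℂ) ≠ 0 := by exact_mod_cast Fintype.card_ne_zero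
  have hcr : (Fintype.card Ω : ℝ) ≠ 0 := by exact_mod_cast Fintype.card_ne_zero
  have key : ∑ v, ((‖∑ p ∈ s, c p * χ p v‖ ^ 2 : ℝ) : ℂ)
      = Fintype.card Ω * ∑ p ∈ s, ((‖c p‖ ^ 2 : ℝ) : ℂ) := by
    have e : ∀ v, ((‖∑ p ∈ s, c p * χ p v‖ ^ 2 : ℝ) : ℂ)
        = ∑ p ∈ s, ∑ q ∈ s, c p * star (c q) * (χ p v * star (χ q v)) := fun v => by
      rw [Complex.ofReal_pow, ← Complex.mul_conj', map_sum, Finset.sum_mul_sum]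
      refine Finset.sum_congr rfl fun p _ => Finset.sum_congr rfl fun q _ => ?_
      rw [map_mul, starRingEnd_apply, starRingEnd_apply]
      ring
    simp only [e]
    rw [Finset.sum_comm, Finset.mul_sum]
    refine Finset.sum_congr rfl fun p hp => ?_
    rw [Finset.sum_comm, Finset.sum_eq_single_of_mem p hp]
    · have : ∀ v, χ p v * star (χ p v) = 1 := fun v => by
        rw [← starRingEnd_apply, Complex.mul_conj', h1]; simp
      simp only [this, mul_one, Finset.sum_const, Finset.card_univ, nsmul_eq_mul]
      rw [← starRingEnd_apply, Complex.mul_conj']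
      push_cast; rfl
    · intro q hq hqp
      rw [← Finset.mul_sum, h0 p hp q hq (Ne.symm hqp), mul_zero]
  rw [avg, div_eq_iff hcr, mul_comm]
  exact_mod_cast key

end Average

/-! ### Random third roots of unity. -/

section Phases

variable {I : Type*} [Fintype I] [DecidableEq I]

/-- The third root of unity attached to an element of `ZMod 3`. -/
def phase (a : ZMod 3) : ℂ := ZMod.stdAddChar a

theorem norm_phase (a : ZMod 3) : ‖phase a‖ = 1 := by
  rw [phase, ZMod.stdAddChar_apply]
  exact Circle.norm_coe _

theorem phase_mul_star (a : ZMod 3) : phase a * star (phase a) = 1 := by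
  rw [← starRingEnd_apply, Complex.mul_conj', norm_phase]; simp

theorem star_phase (a : ZMod 3) : star (phase a) = phase (-a) := by
  rw [phase, phase, AddChar.map_neg_eq_conj, starRingEnd_apply]

theorem phase_add (a b : ZMod 3) : phase (a + b) = phase a * phase b := by
  rw [phase, AddChar.map_add_eq_mul]; rfl

theorem sum_phase_eq_zero (f : (I → ZMod 3) →+ ZMod 3) {g : I → ZMod 3} (hg : f g ≠ 0) :
    ∑ v, phase (f v) = 0 := by
  have : ((ZMod.stdAddChar (N := 3)).compAddMonoidHom f) ≠ 0 := by
    intro h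
    have h2 := DFunLike.congr_fun h g
    rw [AddChar.compAddMonoidHom_apply, AddChar.zero_apply] at h2
    apply hg
    apply ZMod.injective_stdAddChar (N := 3)
    rw [h2, AddChar.map_zero_eq_one]
  have h3 := AddChar.sum_eq_zero_iff_ne_zero.2 this
  exact h3

theorem sum_phase_orthogonal {x y : I} (h : x ≠ y) :
    ∑ v : I → ZMod 3, phase (v x) * star (phase (v y)) = 0 := by
  have h3 := sum_phase_eq_zero (Pi.evalAddMonoidHom (fun _ : I => ZMod 3) x
    - Pi.evalAddMonoidHom (fun _ : I => ZMod 3) y) (g := Pi.single x 1)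
    (by simp [Pi.single_eq_of_ne (Ne.symm h)])
  rw [← h3]
  refine Finset.sum_congr rfl fun v _ => ?_
  rw [star_phase, ← phase_add, AddMonoidHom.sub_apply]
  simp [sub_eq_add_neg]

/-- Cube roots are needed rather than signs because of the swapped pair `z = y`, `w = x`: the
exponent is then `2 (v x - v y)`, which is nonzero modulo 3 but would vanish modulo 2. -/
theorem sum_phase_pair_orthogonal {x y z w : I} (hxy : x ≠ y)
    (h : ¬(x = z ∧ y = w)) :
    ∑ v : I → ZMod 3, (phase (v x) * star (phase (v y))) *
      star (phase (v z) * star (phase (v w))) = 0 := by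
  set f : (I → ZMod 3) →+ ZMod 3 := (Pi.evalAddMonoidHom (fun _ : I => ZMod 3) x
    - Pi.evalAddMonoidHom (fun _ : I => ZMod 3) y) - (Pi.evalAddMonoidHom (fun _ : I => ZMod 3) z
    - Pi.evalAddMonoidHom (fun _ : I => ZMod 3) w) with hf
  have hfa : ∀ v, f v = (v x - v y) - (v z - v w) := fun v => rfl
  have : ∃ g, f g ≠ 0 := by
    by_cases hxz : x = z
    · have hyw : y ≠ w := fun h' => h ⟨hxz, h'⟩
      refine ⟨Pi.single y 1, ?_⟩
      rw [hfa, Pi.single_eq_of_ne hxy, Pi.single_eq_same, Pi.single_eq_of_ne (hxz ▸ hxy),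
        Pi.single_eq_of_ne (Ne.symm hyw)]
      decide
    · refine ⟨Pi.single x 1, ?_⟩
      rw [hfa, Pi.single_eq_same, Pi.single_eq_of_ne (Ne.symm hxy),
        Pi.single_eq_of_ne (Ne.symm hxz)]
      by_cases hwx : w = x
      · rw [hwx, Pi.single_eq_same]; decide
      · rw [Pi.single_eq_of_ne hwx]; decide
  obtain ⟨g, hg⟩ := this
  rw [← sum_phase_eq_zero f hg]
  refine Finset.sum_congr rfl fun v _ => ?_
  rw [star_mul', star_star, star_phase, star_phase, ← phase_add, ← phase_add, ← phase_add, hfa]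
  congr 1
  ring

end Phases

/-! ### Decoupling by a random phase matrix. -/

section Decoupling

variable {K M J A X Z : Type*} [Fintype K] [Fintype M] [Fintype J] [Fintype A] [Fintype X]
  [Fintype Z] [DecidableEq K] [DecidableEq M] [DecidableEq J] [DecidableEq A] [DecidableEq X]
  [DecidableEq Z]

/-- The random matrix with entries of modulus `|K|^{-1/2}` and phases given by `v`. -/
def phaseMatrix (v : K × A → ZMod 3) : Matrix K A ℂ :=
  Matrix.of fun k a => phase (v (k, a)) * ((1 / Real.sqrt (Fintype.card K) : ℝ) : ℂ)

/-- The ket obtained from `φ` on `A X Z` by applying `V : A → K ≃ M J`, on `(M X) ⊗ (J Z)`. -/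
def codedKet (e : K ≃ M × J) (V : Matrix K A ℂ) (φ : A → X → Z → ℂ) :
    Matrix (M × X) (J × Z) ℂ :=
  Matrix.of fun p q => ∑ a, V (e.symm (p.1, q.1)) a * φ a p.2 q.2

/-- The tripartite ket `φ` split as `(A X) ⊗ Z`. -/
def splitKet (φ : A → X → Z → ℂ) : Matrix (A × X) Z ℂ := Matrix.of fun p z => φ p.1 p.2 z

/-- The state `1/|M| ⊗ φ^X`. -/
def refState (M : Type*) [Fintype M] [DecidableEq M] (φ : A → X → Z → ℂ) :
    Matrix (M × X) (M × X) ℂ :=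
  Matrix.of fun p q => if p.1 = q.1 then
    ((1 / Fintype.card M : ℝ) : ℂ) * ∑ a, ∑ z, φ a p.2 z * star (φ a q.2 z) else 0

/-- A purification of `refState M φ`. -/
def refKet (M : Type*) [Fintype M] [DecidableEq M] (φ : A → X → Z → ℂ) :
    Matrix (M × X) (M × (A × Z)) ℂ :=
  Matrix.of fun p q => if p.1 = q.1 then
    ((1 / Real.sqrt (Fintype.card M) : ℝ) : ℂ) * φ q.2.1 p.2 q.2.2 else 0

theorem inv_sqrt_mul_self (n : ℕ) :
    ((1 / Real.sqrt n : ℝ) : ℂ) * ((1 / Real.sqrt n : ℝ) : ℂ) = ((1 / n : ℝ) : ℂ) := by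
  norm_cast
  rw [div_mul_div_comm, one_mul, Real.mul_self_sqrt (Nat.cast_nonneg n)]

theorem refKet_mul_conjTranspose (φ : A → X → Z → ℂ) :
    refKet M φ * (refKet M φ)ᴴ = refState M φ := by
  ext p q
  simp only [mul_apply, conjTranspose_apply, refKet, refState, of_apply, Fintype.sum_prod_type]
  split_ifs with h
  · rw [Finset.sum_eq_single p.1]
    · simp only [h, if_true, Finset.mul_sum]
      refine Finset.sum_congr rfl fun a _ => Finset.sum_congr rfl fun z _ => ?_
      rw [← inv_sqrt_mul_self, star_mul', Complex.star_def, Complex.conj_ofReal]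
      ring
    · intro m _ hm
      simp [Ne.symm hm]
    · simp
  · refine Finset.sum_eq_zero fun m _ => Finset.sum_eq_zero fun a _ =>
      Finset.sum_eq_zero fun z _ => ?_
    by_cases h1 : p.1 = m
    · rw [if_neg (fun h2 : q.1 = m => h (h1.trans h2.symm))]; simp
    · simp [h1]

theorem nsq_refKet [Nonempty M] (φ : A → X → Z → ℂ) : nsq (refKet M φ) = nsq (splitKet φ) := by
  have hM : (Fintype.card M : ℝ) ≠ 0 := by exact_mod_cast Fintype.card_ne_zero
  simp only [nsq, refKet, splitKet, of_apply, Fintype.sum_prod_type]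
  have : ∀ m x, ∑ m' : M, ∑ a, ∑ z, ‖(if m = m' then
      ((1 / Real.sqrt (Fintype.card M) : ℝ) : ℂ) * φ a x z else 0 : ℂ)‖ ^ 2
      = (1 / Fintype.card M : ℝ) * ∑ a, ∑ z, ‖φ a x z‖ ^ 2 := fun m x => by
    rw [Finset.sum_eq_single m]
    · simp only [if_true, Finset.mul_sum]
      refine Finset.sum_congr rfl fun a _ => Finset.sum_congr rfl fun z _ => ?_
      rw [norm_mul, mul_pow, Complex.norm_real, Real.norm_of_nonneg (by positivity), div_pow,
        one_pow, Real.sq_sqrt (Nat.cast_nonneg _)]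
    · intro m' _ hm
      simp [Ne.symm hm]
    · simp
  simp only [this]
  rw [Finset.sum_const, Finset.card_univ, nsmul_eq_mul, ← Finset.mul_sum, ← mul_assoc,
    mul_one_div_cancel hM, one_mul, Finset.sum_comm]

theorem codedKet_sub (e : K ≃ M × J) (V : Matrix K A ℂ) (φ φ' : A → X → Z → ℂ) :
    codedKet e V φ - codedKet e V φ' = codedKet e V (φ - φ') := by
  ext p q
  simp [codedKet, mul_sub]

theorem refKet_sub (φ φ' : A → X → Z → ℂ) :
    refKet M φ - refKet M φ' = refKet M (φ - φ') := by
  ext p q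
  simp only [refKet, of_apply, Matrix.sub_apply, Pi.sub_apply]
  split_ifs <;> ring

theorem splitKet_sub (φ φ' : A → X → Z → ℂ) :
    splitKet φ - splitKet φ' = splitKet (φ - φ') := rfl

/-- `phaseMatrix v` need not be an isometry. Orthogonality of the phases within each row preserves
squared norms on average, and this is enough to control the smoothing error. -/
theorem avg_nsq_codedKet [Nonempty K] (e : K ≃ M × J) (φ : A → X → Z → ℂ) :
    avg (fun v : K × A → ZMod 3 => nsq (codedKet e (phaseMatrix v) φ)) = nsq (splitKet φ) := by
  have hK : (Fintype.card K : ℝ) ≠ 0 := by exact_mod_cast Fintype.card_ne_zero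
  simp only [nsq]
  rw [avg_sum]
  simp only [avg_sum]
  have h : ∀ (p : M × X) (q : J × Z),
      avg (fun v : K × A → ZMod 3 => ‖codedKet e (phaseMatrix v) φ p q‖ ^ 2)
      = (1 / Fintype.card K : ℝ) * ∑ a, ‖φ a p.2 q.2‖ ^ 2 := fun p q => by
    have := avg_norm_sq_sum (Ω := K × A → ZMod 3) Finset.univ
      (fun a v => phase (v (e.symm (p.1, q.1), a))) (fun _ _ => norm_phase _)
      (fun a _ b _ hab => sum_phase_orthogonal (fun h => hab (Prod.ext_iff.1 h).2))
      (fun a => ((1 / Real.sqrt (Fintype.card K) : ℝ) : ℂ) * φ a p.2 q.2)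
    simp only [norm_mul, mul_pow, Complex.norm_real] at this
    rw [← Finset.mul_sum, Real.norm_of_nonneg (by positivity), div_pow,
        one_pow, Real.sq_sqrt (Nat.cast_nonneg _)] at this
    rw [← this]
    congr 1
    ext v
    rw [codedKet, of_apply]
    congr 2
    refine Finset.sum_congr rfl fun a _ => ?_
    rw [phaseMatrix, of_apply]
    ring
  simp only [h, Fintype.sum_prod_type, Finset.sum_const, Finset.card_univ, nsmul_eq_mul,
    splitKet, of_apply, ← Finset.mul_sum]
  have hKe : (Fintype.card K : ℝ) = Fintype.card M * Fintype.card J := by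
    rw [Fintype.card_congr e, Fintype.card_prod]; push_cast; rfl
  rw [hKe] at hK ⊢
  have e1 : ∑ x : X, ∑ z : Z, ∑ a : A, ‖φ a x z‖ ^ 2 = ∑ a, ∑ x, ∑ z, ‖φ a x z‖ ^ 2 := by
    rw [Finset.sum_congr rfl fun x _ => Finset.sum_comm, Finset.sum_comm]
  rw [e1]
  have hM : (Fintype.card M : ℝ) ≠ 0 := left_ne_zero_of_mul hK
  have hJ : (Fintype.card J : ℝ) ≠ 0 := right_ne_zero_of_mul hK
  field_simp

/-- The deviation of the coded state from its mean is a sum over off-diagonal phase pairs. -/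
theorem codedKet_deviation_apply [Nonempty K] (e : K ≃ M × J) (φ : A → X → Z → ℂ)
    (v : K × A → ZMod 3) (p q : M × X) :
    (codedKet e (phaseMatrix v) φ * (codedKet e (phaseMatrix v) φ)ᴴ - refState M φ) p q
    = ∑ i ∈ (Finset.univ : Finset (J × A × A)).filter (fun i => ¬(p.1 = q.1 ∧ i.2.1 = i.2.2)),
      (((1 / Fintype.card K : ℝ) : ℂ) *
        (splitKet φ * (splitKet φ)ᴴ) (i.2.1, p.2) (i.2.2, q.2)) *
      (phase (v (e.symm (p.1, i.1), i.2.1)) * star (phase (v (e.symm (q.1, i.1), i.2.2)))) := by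
  have hK : (Fintype.card K : ℝ) ≠ 0 := by exact_mod_cast Fintype.card_ne_zero
  have hKe : (Fintype.card K : ℝ) = Fintype.card M * Fintype.card J := by
    rw [Fintype.card_congr e, Fintype.card_prod]; push_cast; rfl
  have hJ : (Fintype.card J : ℝ) ≠ 0 := by rw [hKe] at hK; exact right_ne_zero_of_mul hK
  have hM : (Fintype.card M : ℝ) ≠ 0 := by rw [hKe] at hK; exact left_ne_zero_of_mul hK
  set t : J × A × A → ℂ := fun i => (((1 / Fintype.card K : ℝ) : ℂ) *
        (splitKet φ * (splitKet φ)ᴴ) (i.2.1, p.2) (i.2.2, q.2)) *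
      (phase (v (e.symm (p.1, i.1), i.2.1)) * star (phase (v (e.symm (q.1, i.1), i.2.2)))) with ht
  have hfull : (codedKet e (phaseMatrix v) φ * (codedKet e (phaseMatrix v) φ)ᴴ) p q
      = ∑ i, t i := by
    simp only [mul_apply, conjTranspose_apply, codedKet, of_apply, Fintype.sum_prod_type, ht,
      star_sum, splitKet, phaseMatrix, Finset.mul_sum, Finset.sum_mul]
    refine Finset.sum_congr rfl fun j _ => ?_
    rw [Finset.sum_congr rfl fun z _ => Finset.sum_comm, Finset.sum_comm]
    refine Finset.sum_congr rfl fun a _ => ?_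
    rw [Finset.sum_comm]
    refine Finset.sum_congr rfl fun b _ => Finset.sum_congr rfl fun z _ => ?_
    rw [← inv_sqrt_mul_self, star_mul', star_mul', Complex.star_def, Complex.conj_ofReal]
    ring
  have hdiag : refState M φ p q
      = ∑ i ∈ (Finset.univ : Finset (J × A × A)).filter (fun i => p.1 = q.1 ∧ i.2.1 = i.2.2),
        t i := by
    rw [refState, of_apply]
    split_ifs with h
    · simp only [h, true_and, Finset.sum_filter, Fintype.sum_prod_type, ht]
      simp only [Finset.sum_ite_eq, Finset.mem_univ, if_true, phase_mul_star, mul_one,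
        Finset.sum_const, Finset.card_univ, nsmul_eq_mul, ← Finset.mul_sum]
      rw [← mul_assoc]
      congr 1
      rw [hKe]
      push_cast
      have hJ' : (Fintype.card J : ℂ) ≠ 0 := by exact_mod_cast hJ
      have hM' : (Fintype.card M : ℂ) ≠ 0 := by exact_mod_cast hM
      field_simp
    · simp [h]
  rw [Matrix.sub_apply, hfull, hdiag, sub_eq_iff_eq_add, add_comm,
    Finset.sum_filter_add_sum_filter_not]

/-- The phase pairs surviving in the deviation are orthogonal, so Parseval leaves a sum of squared
entries of the state on `A X`, each with weight `1/|K|²`. Counting the indices of `M` twice and of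
`J` once gives the factor `|M|² |J| / |K|² = 1/|J|`. -/
theorem avg_nsq_deviation_le [Nonempty K] (e : K ≃ M × J) (φ : A → X → Z → ℂ) :
    avg (fun v : K × A → ZMod 3 => nsq (codedKet e (phaseMatrix v) φ *
      (codedKet e (phaseMatrix v) φ)ᴴ - refState M φ))
    ≤ nsq (splitKet φ * (splitKet φ)ᴴ) / Fintype.card J := by
  have hK : (Fintype.card K : ℝ) ≠ 0 := by exact_mod_cast Fintype.card_ne_zero
  have hKe : (Fintype.card K : ℝ) = Fintype.card M * Fintype.card J := by
    rw [Fintype.card_congr e, Fintype.card_prod]; push_cast; rfl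
  have hJ : (Fintype.card J : ℝ) ≠ 0 := by rw [hKe] at hK; exact right_ne_zero_of_mul hK
  have hM : (Fintype.card M : ℝ) ≠ 0 := by rw [hKe] at hK; exact left_ne_zero_of_mul hK
  set G := splitKet φ * (splitKet φ)ᴴ with hG
  have h : ∀ p q : M × X, avg (fun v : K × A → ZMod 3 => ‖(codedKet e (phaseMatrix v) φ *
      (codedKet e (phaseMatrix v) φ)ᴴ - refState M φ) p q‖ ^ 2)
      ≤ (1 / Fintype.card K : ℝ) ^ 2 * Fintype.card J *
        ∑ a, ∑ b, ‖G (a, p.2) (b, q.2)‖ ^ 2 := fun p q => by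
    simp only [codedKet_deviation_apply]
    rw [avg_norm_sq_sum]
    · refine (Finset.sum_le_univ_sum_of_nonneg fun i => by positivity).trans (le_of_eq ?_)
      simp only [norm_mul, mul_pow, Complex.norm_real, ← Finset.mul_sum, Fintype.sum_prod_type,
        Finset.sum_const, Finset.card_univ, nsmul_eq_mul]
      rw [Real.norm_of_nonneg (by positivity), mul_assoc]
    · intro i v
      rw [norm_mul, norm_star, norm_phase, norm_phase, one_mul]
    · rintro ⟨j, a, b⟩ hi ⟨j', a', b'⟩ hi' hne
      rw [Finset.mem_filter] at hi hi'
      refine sum_phase_pair_orthogonal ?_ ?_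
      · intro h
        apply hi.2
        simpa using h
      · rintro ⟨h1, h2⟩
        apply hne
        simp at h1 h2
        simp [h1, h2]
  have hn : ∀ v : K × A → ZMod 3, nsq (codedKet e (phaseMatrix v) φ *
      (codedKet e (phaseMatrix v) φ)ᴴ - refState M φ) = ∑ p, ∑ q, ‖(codedKet e (phaseMatrix v) φ *
      (codedKet e (phaseMatrix v) φ)ᴴ - refState M φ) p q‖ ^ 2 := fun v => rfl
  simp only [hn]
  rw [avg_sum]
  simp only [avg_sum]
  refine (Finset.sum_le_sum fun p _ => Finset.sum_le_sum fun q _ => h p q).trans (le_of_eq ?_)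
  simp only [Fintype.sum_prod_type, Finset.sum_const, Finset.card_univ, nsmul_eq_mul,
    ← Finset.mul_sum, nsq]
  have e1 : ∑ x : X, ∑ y : X, ∑ a : A, ∑ b : A, ‖G (a, x) (b, y)‖ ^ 2
      = ∑ a, ∑ x, ∑ b, ∑ y, ‖G (a, x) (b, y)‖ ^ 2 := by
    rw [Finset.sum_congr rfl fun x _ => Finset.sum_comm, Finset.sum_comm]
    exact Finset.sum_congr rfl fun a _ => Finset.sum_congr rfl fun x _ => Finset.sum_comm
  rw [e1, hKe]
  field_simp

/-- Decoupling by a random matrix, with smoothing: `φ'` is a ket near `φ` supported on the range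
of `P` in `X`. -/
theorem exists_decoupling_bound [Nonempty K] [Nonempty M] (e : K ≃ M × J) (φ φ' : A → X → Z → ℂ)
    (P : Matrix X X ℂ) (hP : ∀ a x z, ∑ x', P x x' * φ' a x' z = φ' a x z)
    {D s : ℝ} (hD : 0 < D) (hPD : Fintype.card M * nsq P ≤ D) (hs : 0 < s) :
    ∃ F : (K × A → ZMod 3) → ℝ,
      avg F ≤ (s + D * (nsq (splitKet φ' * (splitKet φ')ᴴ) / Fintype.card J) / s) / 2 +
        2 * (nsq (splitKet φ - splitKet φ') / s + s * (nsq (splitKet φ) + nsq (splitKet φ')) / 2) ∧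
      ∀ v, TraceNormLE (codedKet e (phaseMatrix v) φ * (codedKet e (phaseMatrix v) φ)ᴴ
        - refState M φ) (F v) := by
  set ω := fun v : K × A → ZMod 3 => codedKet e (phaseMatrix v) φ with hω
  set ω' := fun v : K × A → ZMod 3 => codedKet e (phaseMatrix v) φ' with hω'
  set Y := fun v => ω' v * (ω' v)ᴴ - refState M φ' with hY
  set c := nsq (refKet M φ - refKet M φ') / s +
    s * (nsq (refKet M φ) + nsq (refKet M φ')) / 2 with hc
  -- Three triangle-inequality terms: replacing `φ` by `φ'` in the coded state, the deviation of the
  -- coded `φ'` from its mean, and returning from `φ'` to `φ` in the reference state.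
  refine ⟨fun v => (1 / s * nsq (codedKet e (phaseMatrix v) (φ - φ')) + s / 2 * nsq (ω v) +
    s / 2 * nsq (ω' v)) + (s / 2 + D / s / 2 * nsq (Y v)) + c, ?_, fun v => ?_⟩
  · rw [avg_add, avg_add, avg_add, avg_add, avg_add, avg_const, avg_const, avg_const_mul,
      avg_const_mul, avg_const_mul, avg_const_mul, avg_nsq_codedKet, avg_nsq_codedKet,
      avg_nsq_codedKet, hc, refKet_sub, nsq_refKet, nsq_refKet, nsq_refKet, splitKet_sub]
    have h1 := avg_nsq_deviation_le e φ'
    have h2 : D / s / 2 * avg (fun v => nsq (Y v))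
        ≤ D / s / 2 * (nsq (splitKet φ' * (splitKet φ')ᴴ) / Fintype.card J) := by
      gcongr
    have h3 : D / s / 2 * (nsq (splitKet φ' * (splitKet φ')ᴴ) / Fintype.card J)
      = D * (nsq (splitKet φ' * (splitKet φ')ᴴ) / Fintype.card J) / s / 2 := by ring
    rw [h3] at h2
    refine (add_le_add (add_le_add le_rfl (add_le_add le_rfl h2)) le_rfl).trans (le_of_eq ?_)
    ring
  · have t1 := traceNormLE_reduced_sub (ω v) (ω' v) hs
    have t3 := (traceNormLE_reduced_sub (refKet M φ) (refKet M φ') hs).neg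
    rw [refKet_mul_conjTranspose, refKet_mul_conjTranspose] at t3
    -- `Q = 1 ⊗ P` fixes the deviation `Y v`. Writing `Y v` as `Q * Y v` bounds its trace norm by
    -- Hilbert–Schmidt norms, at the price of `nsq Q ≤ D` instead of the full dimension.
    set Q : Matrix (M × X) (M × X) ℂ := Matrix.of fun p q => if p.1 = q.1 then P p.2 q.2 else 0
      with hQ
    have hQn : nsq Q ≤ D := by
      refine le_trans (le_of_eq ?_) hPD
      simp only [nsq, hQ, of_apply, Fintype.sum_prod_type]
      have : ∀ m x, ∑ m' : M, ∑ x' : X, ‖(if m = m' then P x x' else 0 : ℂ)‖ ^ 2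
          = ∑ x', ‖P x x'‖ ^ 2 := fun m x => by
        rw [Finset.sum_eq_single m]
        · simp
        · intro m' _ hm; simp [Ne.symm hm]
        · simp
      simp only [this, Finset.sum_const, Finset.card_univ, nsmul_eq_mul]
    have hQω : Q * ω' v = ω' v := by
      ext ⟨m, x⟩ ⟨j, z⟩
      simp only [mul_apply, hQ, hω', codedKet, of_apply, Fintype.sum_prod_type]
      rw [Finset.sum_eq_single m]
      · simp only [if_true, Finset.mul_sum]
        rw [Finset.sum_comm]
        refine Finset.sum_congr rfl fun a _ => ?_
        rw [← hP a x z, Finset.mul_sum]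
        exact Finset.sum_congr rfl fun x' _ => by ring
      · intro m' _ hm; simp [Ne.symm hm]
      · simp
    have hQr : Q * refKet M φ' = refKet M φ' := by
      ext ⟨m, x⟩ ⟨m1, a, z⟩
      simp only [mul_apply, hQ, refKet, of_apply, Fintype.sum_prod_type]
      rw [Finset.sum_eq_single m]
      · by_cases hm : m = m1
        · simp only [hm, if_true]
          rw [← hP a x z, Finset.mul_sum]
          exact Finset.sum_congr rfl fun x' _ => by ring
        · simp [hm]
      · intro m' _ hm; simp [Ne.symm hm]
      · simp
    have hQY : Q * (Y v)ᴴᴴ = Y v := by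
      rw [conjTranspose_conjTranspose, hY]
      simp only
      rw [Matrix.mul_sub, ← Matrix.mul_assoc, hQω, ← refKet_mul_conjTranspose, ← Matrix.mul_assoc,
        hQr]
    have t2 := traceNormLE_mul_conjTranspose Q (Y v)ᴴ (div_pos hs hD)
    rw [hQY, nsq_conjTranspose] at t2
    have t := (t1.add t2).add t3
    have e0 : ω v * (ω v)ᴴ - ω' v * (ω' v)ᴴ + Y v + -(refState M φ - refState M φ')
        = ω v * (ω v)ᴴ - refState M φ := by
      have : Y v = ω' v * (ω' v)ᴴ - refState M φ' := rfl
      rw [this, neg_sub, sub_add_sub_cancel, sub_add_sub_cancel]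
    rw [e0] at t
    refine t.mono ?_
    rw [hω, hω']
    simp only
    rw [codedKet_sub]
    have h1 : s / D * nsq Q ≤ s := by
      rw [div_mul_eq_mul_div, div_le_iff₀ hD]; gcongr
    refine add_le_add (add_le_add (le_of_eq (by ring)) ?_) le_rfl
    calc (s / D * nsq Q + nsq (Y v) / (s / D)) / 2 ≤ (s + nsq (Y v) / (s / D)) / 2 := by gcongr
      _ = s / 2 + D / s / 2 * nsq (Y v) := by field_simp

end Decoupling

/-! ### Typical sequences. -/

section Chebyshev

variable {X : Type*} [Fintype X] [DecidableEq X]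

/-- The second moment of a sum of i.i.d. centred random variables. -/
theorem sum_prod_mul_sq_sum (p g : X → ℝ) (hp : ∑ x, p x = 1) (hg : ∑ x, p x * g x = 0) (n : ℕ) :
    ∑ x : Fin n → X, (∏ i, p (x i)) * (∑ i, g (x i)) ^ 2 = n * ∑ x, p x * g x ^ 2 := by
  have hterm : ∀ i j : Fin n, ∑ x : Fin n → X, (∏ k, p (x k)) * (g (x i) * g (x j))
      = if i = j then ∑ x, p x * g x ^ 2 else 0 := fun i j => by
    have h1 : ∀ x : Fin n → X, (∏ k, p (x k)) * (g (x i) * g (x j))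
        = ∏ k, (p (x k) * ((if k = i then g (x k) else 1) * (if k = j then g (x k) else 1))) :=
      fun x => by
        simp only [Finset.prod_mul_distrib, Finset.prod_ite_eq', Finset.mem_univ, if_true]
    simp only [h1]
    rw [← Fintype.piFinset_univ, ← Finset.prod_univ_sum (fun _ => Finset.univ)
      (fun k y => p y * ((if k = i then g y else 1) * (if k = j then g y else 1)))]
    split_ifs with h
    · subst h
      rw [Finset.prod_eq_single i]
      · simp only [if_true]
        exact Finset.sum_congr rfl fun x _ => by ring
      · intro k _ hk
        simp [hk, hp]
      · simp
    · refine Finset.prod_eq_zero (Finset.mem_univ i) ?_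
      simp [h, hg]
  have h2 : ∀ x : Fin n → X, (∏ i, p (x i)) * (∑ i, g (x i)) ^ 2
      = ∑ i, ∑ j, (∏ k, p (x k)) * (g (x i) * g (x j)) := fun x => by
    rw [sq, Finset.sum_mul_sum, Finset.mul_sum]
    exact Finset.sum_congr rfl fun i _ => by rw [Finset.mul_sum]
  simp only [h2]
  rw [Finset.sum_comm]
  simp only [Finset.sum_comm (s := (Finset.univ : Finset (Fin n → X))), hterm]
  simp

/-- Asymptotic equipartition: Chebyshev's inequality for the i.i.d. sum of the centred surprisals
`-log₂ p - H`. -/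
theorem exists_typical_set (p : X → ℝ) (hp0 : ∀ x, 0 ≤ p x) (hp : ∑ x, p x = 1)
    {δ ε : ℝ} (hδ : 0 < δ) (hε : 0 < ε) :
    ∀ᶠ n : ℕ in atTop, ∃ T : Finset (Fin n → X),
      (T.card : ℝ) ≤ 2 ^ (n * (∑ x, Real.negMulLog (p x) / Real.log 2 + δ)) ∧
      (∀ x ∈ T, ∏ i, p (x i) ≤ 2 ^ (-(n * (∑ x, Real.negMulLog (p x) / Real.log 2 - δ)))) ∧
      ∑ x ∈ Tᶜ, ∏ i, p (x i) ≤ ε := by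
  set H := ∑ x, Real.negMulLog (p x) / Real.log 2 with hH
  set f : X → ℝ := fun x => -(Real.log (p x) / Real.log 2) with hf
  have hlog2 : 0 < Real.log 2 := Real.log_pos one_lt_two
  have hpf : ∑ x, p x * f x = H := by
    rw [hH]
    refine Finset.sum_congr rfl fun x _ => ?_
    rw [hf, Real.negMulLog]
    ring
  set g : X → ℝ := fun x => f x - H with hgdef
  have hpg : ∑ x, p x * g x = 0 := by
    simp only [hgdef, mul_sub, Finset.sum_sub_distrib, ← Finset.sum_mul, hpf, hp]
    ring
  set v := ∑ x, p x * g x ^ 2 with hv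
  have hv0 : 0 ≤ v := Finset.sum_nonneg fun x _ => mul_nonneg (hp0 x) (sq_nonneg _)
  obtain ⟨N, hN⟩ := exists_nat_gt (v / (δ ^ 2 * ε))
  filter_upwards [eventually_ge_atTop (max N 1)] with n hn
  have hn1 : (1 : ℝ) ≤ n := by exact_mod_cast (le_max_right N 1).trans hn
  have hnN : v / (δ ^ 2 * ε) ≤ n := hN.le.trans (by exact_mod_cast (le_max_left N 1).trans hn)
  have hn0 : (0 : ℝ) < n := by linarith
  have hexp : ∀ x : Fin n → X, (∀ i, p (x i) ≠ 0) →
      ∏ i, p (x i) = 2 ^ (-(∑ i, g (x i)) - n * H) := fun x hx => by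
    have h1 : ∀ i, p (x i) = (2 : ℝ) ^ (-f (x i)) := fun i => by
      have hpos : 0 < p (x i) := lt_of_le_of_ne (hp0 _) (Ne.symm (hx i))
      rw [hf, Real.rpow_def_of_pos two_pos]
      simp only [neg_neg]
      rw [mul_div_cancel₀ _ hlog2.ne', Real.exp_log hpos]
    rw [Finset.prod_congr rfl fun i _ => h1 i, ← Real.rpow_sum_of_pos two_pos]
    congr 1
    simp only [hgdef, Finset.sum_neg_distrib, Finset.sum_sub_distrib, Finset.sum_const,
      Finset.card_univ, Fintype.card_fin, nsmul_eq_mul]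
    ring
  have hsum1 : ∑ x : Fin n → X, ∏ i, p (x i) = 1 := by
    rw [← Fintype.piFinset_univ, ← Finset.prod_univ_sum (fun _ => Finset.univ) (fun _ y => p y)]
    simp [hp]
  have hpr0 : ∀ x : Fin n → X, 0 ≤ ∏ i, p (x i) := fun x => Finset.prod_nonneg fun i _ => hp0 _
  classical
  -- Strings containing a letter of probability zero are excluded by hand: with `Real.log 0 = 0`
  -- their surprisal is meaningless. They carry no mass.
  refine ⟨Finset.univ.filter fun x => (∀ i, p (x i) ≠ 0) ∧ |∑ i, g (x i)| ≤ n * δ, ?_, ?_, ?_⟩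
  · set T := Finset.univ.filter fun x : Fin n → X => (∀ i, p (x i) ≠ 0) ∧
      |∑ i, g (x i)| ≤ n * δ with hT
    have h1 : ∑ x ∈ T, (2 : ℝ) ^ (-(n * (H + δ))) ≤ 1 := by
      rw [← hsum1]
      refine (Finset.sum_le_sum fun x hx => ?_).trans
        (Finset.sum_le_univ_sum_of_nonneg hpr0)
      rw [hT, Finset.mem_filter] at hx
      rw [hexp x hx.2.1]
      refine Real.rpow_le_rpow_of_exponent_le one_le_two ?_
      have := (abs_le.1 hx.2.2).2
      linarith
    rw [Finset.sum_const, nsmul_eq_mul, Real.rpow_neg two_pos.le,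
      mul_inv_le_iff₀ (Real.rpow_pos_of_pos two_pos _), one_mul] at h1
    exact h1
  · intro x hx
    rw [Finset.mem_filter] at hx
    rw [hexp x hx.2.1]
    refine Real.rpow_le_rpow_of_exponent_le one_le_two ?_
    have := (abs_le.1 hx.2.2).1
    linarith
  · have h1 : ∀ x ∈ (Finset.univ.filter fun x : Fin n → X => (∀ i, p (x i) ≠ 0) ∧
        |∑ i, g (x i)| ≤ n * δ)ᶜ,
        ∏ i, p (x i) ≤ (∏ i, p (x i)) * (∑ i, g (x i)) ^ 2 / (n * δ) ^ 2 := fun x hx => by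
      by_cases h0 : ∀ i, p (x i) ≠ 0
      · simp only [Finset.compl_filter, Finset.mem_filter, Finset.mem_univ, true_and, not_and,
          not_le] at hx
        have h2 := hx h0
        have h3 : (n * δ) ^ 2 ≤ (∑ i, g (x i)) ^ 2 := by
          rw [← sq_abs (∑ i, g (x i))]
          exact pow_le_pow_left₀ (by positivity) h2.le 2
        rw [le_div_iff₀ (by positivity)]
        exact mul_le_mul_of_nonneg_left h3 (hpr0 x)
      · push Not at h0
        obtain ⟨i, hi⟩ := h0
        rw [Finset.prod_eq_zero (Finset.mem_univ i) hi]
        simp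
    refine (Finset.sum_le_sum h1).trans ?_
    refine (Finset.sum_le_univ_sum_of_nonneg fun x => ?_).trans ?_
    · have := hpr0 x
      positivity
    · rw [← Finset.sum_div, sum_prod_mul_sq_sum p g hp hpg n, ← hv]
      rw [div_le_iff₀ (by positivity)] at hnN ⊢
      nlinarith

end Chebyshev

/-! ### Tensor powers and typical projections. -/

section TensorPower

variable {X Y Z : Type*} [Fintype X] [Fintype Y] [Fintype Z]
  [DecidableEq X] [DecidableEq Y] [DecidableEq Z]

/-- The tensor power of a matrix. -/
def tpow (M : Matrix X Y ℂ) (n : ℕ) : Matrix (Fin n → X) (Fin n → Y) ℂ :=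
  Matrix.of fun f g => ∏ i, M (f i) (g i)

theorem sum_prod_pi {n : ℕ} {R : Type*} [CommSemiring R] (f : Fin n → X → R) :
    ∑ x : Fin n → X, ∏ i, f i (x i) = ∏ i, ∑ x, f i x := by
  rw [← Fintype.piFinset_univ, ← Finset.prod_univ_sum (fun _ => Finset.univ) f]

theorem tpow_mul (M : Matrix X Y ℂ) (N : Matrix Y Z ℂ) (n : ℕ) :
    tpow (M * N) n = tpow M n * tpow N n := by
  ext f g
  simp only [tpow, of_apply, mul_apply, ← Finset.prod_mul_distrib]
  rw [sum_prod_pi (fun i y => M (f i) y * N y (g i))]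

theorem tpow_conjTranspose (M : Matrix X Y ℂ) (n : ℕ) : tpow Mᴴ n = (tpow M n)ᴴ := by
  ext f g
  simp [tpow]

theorem tpow_diagonal (d : X → ℂ) (n : ℕ) :
    tpow (diagonal d) n = diagonal (fun x : Fin n → X => ∏ i, d (x i)) := by
  ext f g
  rw [tpow, of_apply]
  by_cases h : f = g
  · subst h
    simp
  · rw [diagonal_apply_ne _ h]
    obtain ⟨i, hi⟩ := Function.ne_iff.1 h
    exact Finset.prod_eq_zero (Finset.mem_univ i) (diagonal_apply_ne _ hi)

theorem tpow_one (n : ℕ) : tpow (1 : Matrix X X ℂ) n = 1 := by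
  rw [← diagonal_one, tpow_diagonal]
  simp

theorem nsq_tpow (M : Matrix X Y ℂ) (n : ℕ) : nsq (tpow M n) = nsq M ^ n := by
  have h : ∀ f : Fin n → X, ∑ g : Fin n → Y, ‖tpow M n f g‖ ^ 2 = ∏ i, ∑ y, ‖M (f i) y‖ ^ 2 :=
    fun f => by
      rw [← sum_prod_pi (fun i y => ‖M (f i) y‖ ^ 2)]
      simp [tpow, Finset.prod_pow]
  simp only [nsq, h]
  rw [sum_prod_pi (fun _ x => ∑ y, ‖M x y‖ ^ 2)]
  simp

/-- `P` projects onto the product eigenvectors of the i.i.d. reduced state labelled by typical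
strings. As `P` is a projection, `nsq P` is its rank. The purity of the truncated state is at most
its largest eigenvalue, as its trace is at most one. -/
theorem exists_typical_projection (w : Matrix X Y ℂ) (hw : nsq w = 1) {δ ε : ℝ} (hδ : 0 < δ)
    (hε : 0 < ε) :
    ∀ᶠ n : ℕ in atTop, ∃ P : Matrix (Fin n → X) (Fin n → X) ℂ, Pᴴ = P ∧ P * P = P ∧
      nsq P ≤ 2 ^ (n * (entropy (w * wᴴ) + δ)) ∧
      nsq (tpow w n - P * tpow w n) ≤ ε ∧
      nsq ((P * tpow w n) * (P * tpow w n)ᴴ) ≤ 2 ^ (-(n * (entropy (w * wᴴ) - δ))) := by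
  have hρ := isHermitian_mul_conjTranspose_self w
  obtain ⟨F, hF1, hF2, hF⟩ := exists_diagonalization hρ
  have hp0 := (posSemidef_self_mul_conjTranspose w).eigenvalues_nonneg
  set p := hρ.eigenvalues with hpdef
  have hp1 : ∑ x, p x = 1 := by
    have h1 := hρ.trace_eq_sum_eigenvalues
    rw [trace_mul_conjTranspose_self, hw] at h1
    apply Complex.ofReal_injective
    rw [Complex.ofReal_sum]
    exact h1.symm
  have hent : entropy (w * wᴴ) = ∑ x, Real.negMulLog (p x) / Real.log 2 := by
    rw [entropy, dif_pos hρ]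
  rw [hent]
  filter_upwards [exists_typical_set p hp0 hp1 hδ hε] with n hn
  obtain ⟨T, hT1, hT2, hT3⟩ := hn
  set Fn := tpow F n with hFn
  have hFn2 : Fnᴴ * Fn = 1 := by rw [hFn, ← tpow_conjTranspose, ← tpow_mul, hF2, tpow_one]
  have hFn1 : Fn * Fnᴴ = 1 := by rw [hFn, ← tpow_conjTranspose, ← tpow_mul, hF1, tpow_one]
  set q : (Fin n → X) → ℝ := fun x => ∏ i, p (x i) with hq
  have hq0 : ∀ x, 0 ≤ q x := fun x => Finset.prod_nonneg fun i _ => hp0 _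
  have hρn : tpow w n * (tpow w n)ᴴ = Fn * diagonal (fun x => (q x : ℂ)) * Fnᴴ := by
    rw [← tpow_conjTranspose, ← tpow_mul]
    conv_lhs => rw [hF]
    rw [tpow_mul, tpow_mul, tpow_diagonal, tpow_conjTranspose, ← hFn]
    simp [hq]
  set c : (Fin n → X) → ℝ := fun x => if x ∈ T then 1 else 0 with hc
  set P := Fn * diagonal (fun x => (c x : ℂ)) * Fnᴴ with hP
  have hPH : Pᴴ = P := conj_diagonal_conjTranspose Fn c
  have hcc : ∀ x, c x * c x = c x := fun x => by simp only [hc]; split_ifs <;> norm_num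
  have hPP : P * P = P := by
    rw [hP, conj_diagonal_mul hFn2]
    congr 3
    ext x
    rw [← Complex.ofReal_mul, hcc]
  have hsumT : ∀ h : (Fin n → X) → ℝ, ∑ x, c x * h x = ∑ x ∈ T, h x := fun h => by
    simp [hc]
  refine ⟨P, hPH, hPP, ?_, ?_, ?_⟩
  · rw [nsq_eq_re_trace, hPH, hPP, hP, trace_conj_diagonal hFn2]
    have := hsumT fun _ => 1
    simp only [mul_one, Finset.sum_const, nsmul_eq_mul] at this
    rw [← Complex.ofReal_sum, Complex.ofReal_re, this]
    exact hT1
  · set c' : (Fin n → X) → ℝ := fun x => if x ∈ T then 0 else 1 with hc'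
    have h1 : 1 - P = Fn * diagonal (fun x => (c' x : ℂ)) * Fnᴴ := by
      rw [hP, sub_eq_iff_eq_add, ← Matrix.add_mul, ← Matrix.mul_add, diagonal_add]
      have : (fun x => (c' x : ℂ) + (c x : ℂ)) = fun _ => 1 := by
        ext x
        simp only [hc, hc']
        split_ifs <;> simp
      rw [this, diagonal_one, Matrix.mul_one, hFn1]
    have h2 : tpow w n - P * tpow w n = (1 - P) * tpow w n := by
      rw [Matrix.sub_mul, Matrix.one_mul]
    have hc'' : ∀ x, c' x * q x * c' x = c' x * q x := fun x => by
      simp only [hc']; split_ifs <;> ring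
    rw [h2, nsq_eq_re_trace, conjTranspose_mul, Matrix.mul_assoc, ← Matrix.mul_assoc (tpow w n),
      hρn, h1, conj_diagonal_conjTranspose, ← Matrix.mul_assoc, conj_diagonal_mul hFn2,
      conj_diagonal_mul hFn2, trace_conj_diagonal hFn2]
    have h3 : ∑ x, (c' x : ℂ) * (q x : ℂ) * (c' x : ℂ) = ((∑ x ∈ Tᶜ, q x : ℝ) : ℂ) := by
      have : ∑ x ∈ Tᶜ, q x = ∑ x, c' x * q x := by
        rw [← Finset.sum_subset (Finset.subset_univ Tᶜ)]
        · refine Finset.sum_congr rfl fun x hx => ?_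
          simp [hc', Finset.mem_compl.1 hx]
        · intro x _ hx
          rw [Finset.mem_compl, not_not] at hx
          simp [hc', hx]
      rw [this, Complex.ofReal_sum]
      refine Finset.sum_congr rfl fun x _ => ?_
      rw [← hc'']
      push_cast; rfl
    rw [h3, Complex.ofReal_re]
    exact hT3
  · have h1 : (P * tpow w n) * (P * tpow w n)ᴴ
        = Fn * diagonal (fun x => ((c x * q x : ℝ) : ℂ)) * Fnᴴ := by
      rw [conjTranspose_mul, Matrix.mul_assoc, ← Matrix.mul_assoc (tpow w n), hρn, hPH,
        ← Matrix.mul_assoc, hP, conj_diagonal_mul hFn2, conj_diagonal_mul hFn2]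
      congr 3
      ext x
      rw [← Complex.ofReal_mul, ← Complex.ofReal_mul, mul_right_comm, hcc]
    rw [h1, nsq_eq_re_trace, conj_diagonal_conjTranspose, conj_diagonal_mul hFn2,
      trace_conj_diagonal hFn2]
    have h2 : ∑ x, ((c x * q x : ℝ) : ℂ) * ((c x * q x : ℝ) : ℂ)
        = ((∑ x ∈ T, q x * q x : ℝ) : ℂ) := by
      rw [← hsumT, Complex.ofReal_sum]
      refine Finset.sum_congr rfl fun x _ => ?_
      rw [← Complex.ofReal_mul]
      congr 1
      linear_combination q x * q x * hcc x
    rw [h2, Complex.ofReal_re]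
    have hsum1 : ∑ x, q x = 1 := by
      rw [hq, sum_prod_pi (fun _ => p)]; simp [hp1]
    set L : ℝ := 2 ^ (-(n * (∑ x, Real.negMulLog (p x) / Real.log 2 - δ))) with hL
    have hL0 : 0 ≤ L := (Real.rpow_pos_of_pos two_pos _).le
    calc ∑ x ∈ T, q x * q x ≤ ∑ x ∈ T, L * q x :=
          Finset.sum_le_sum fun x hx => mul_le_mul_of_nonneg_right (hT2 x hx) (hq0 x)
      _ = L * ∑ x ∈ T, q x := by rw [Finset.mul_sum]
      _ ≤ L * 1 := by
          refine mul_le_mul_of_nonneg_left ?_ hL0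
          rw [← hsum1]
          exact Finset.sum_le_univ_sum_of_nonneg hq0
      _ = L := mul_one L

end TensorPower

/-! ### Entropies of the two marginals of a pure state. -/

section Entropy

variable {X Y : Type*} [Fintype X] [Fintype Y] [DecidableEq X] [DecidableEq Y]

theorem entropy_eq_sum_roots {ρ : Matrix X X ℂ} (hρ : ρ.IsHermitian) :
    entropy ρ = (ρ.charpoly.roots.map fun z => Real.negMulLog z.re / Real.log 2).sum := by
  rw [entropy, dif_pos hρ, hρ.roots_charpoly_eq_eigenvalues, Multiset.map_map]
  rfl

theorem entropy_transpose {ρ : Matrix X X ℂ} (hρ : ρ.IsHermitian) :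
    entropy ρᵀ = entropy ρ := by
  rw [entropy_eq_sum_roots hρ, entropy_eq_sum_roots hρ.transpose, charpoly_transpose]

/-- The two characteristic polynomials agree up to powers of the variable, and zero eigenvalues
contribute nothing to the entropy. -/
theorem entropy_mul_conjTranspose_comm (w : Matrix X Y ℂ) :
    entropy (w * wᴴ) = entropy (wᴴ * w) := by
  rw [entropy_eq_sum_roots (isHermitian_mul_conjTranspose_self w),
    entropy_eq_sum_roots (isHermitian_conjTranspose_mul_self w)]
  have h := congrArg (fun q : Polynomial ℂ =>
    (q.roots.map fun z => Real.negMulLog z.re / Real.log 2).sum) (charpoly_mul_comm' w wᴴ)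
  rw [Polynomial.roots_mul, Polynomial.roots_mul] at h
  · simpa [Multiset.map_nsmul, Multiset.sum_nsmul] using h
  · exact mul_ne_zero (pow_ne_zero _ Polynomial.X_ne_zero) (charpoly_monic _).ne_zero
  · exact mul_ne_zero (pow_ne_zero _ Polynomial.X_ne_zero) (charpoly_monic _).ne_zero

/-- The two reduced states of a bipartite ket have the same entropy. -/
theorem entropy_reduced_transpose (w : Matrix X Y ℂ) :
    entropy (wᵀ * wᵀᴴ) = entropy (w * wᴴ) := by
  rw [entropy_mul_conjTranspose_comm w,
    ← entropy_transpose (isHermitian_conjTranspose_mul_self w), transpose_mul]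
  rfl

end Entropy

/-! ### Nonnegativity of mutual information, needed for the entanglement rates to be nonnegative. -/

section Subadditivity

open Kronecker

variable {a b : Type*} [Fintype a] [Fintype b] [DecidableEq a] [DecidableEq b]

theorem trace_mul_kronecker_one (ρ : Matrix (a × b) (a × b) ℂ) (Q : Matrix a a ℂ) :
    (ρ * (Q ⊗ₖ (1 : Matrix b b ℂ))).trace = (traceSnd ρ * Q).trace := by
  simp only [trace, diag_apply, mul_apply, traceSnd, of_apply, Fintype.sum_prod_type,
    kroneckerMap_apply, Finset.sum_mul, one_apply, mul_ite, mul_one, mul_zero,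
    Finset.sum_ite_eq', Finset.mem_univ, if_true]
  exact Finset.sum_congr rfl fun i _ => Finset.sum_comm

theorem trace_mul_one_kronecker (ρ : Matrix (a × b) (a × b) ℂ) (Q : Matrix b b ℂ) :
    (ρ * ((1 : Matrix a a ℂ) ⊗ₖ Q)).trace = (traceFst ρ * Q).trace := by
  simp only [trace, diag_apply, mul_apply, traceFst, of_apply, Fintype.sum_prod_type,
    kroneckerMap_apply, Finset.sum_mul, one_apply, ite_mul, one_mul, zero_mul, mul_ite, mul_zero]
  rw [Finset.sum_comm]
  refine Finset.sum_congr rfl fun j _ => ?_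
  rw [Finset.sum_comm]
  refine (Finset.sum_congr rfl fun i _ => ?_).trans Finset.sum_comm
  rw [Finset.sum_comm]
  simp

theorem traceSnd_isHermitian {ρ : Matrix (a × b) (a × b) ℂ} (hρ : ρ.IsHermitian) :
    (traceSnd ρ).IsHermitian := by
  ext i j
  simp only [traceSnd, conjTranspose_apply, of_apply, star_sum]
  exact Finset.sum_congr rfl fun k _ => hρ.apply _ _

theorem traceFst_isHermitian {ρ : Matrix (a × b) (a × b) ℂ} (hρ : ρ.IsHermitian) :
    (traceFst ρ).IsHermitian := by
  ext i j
  simp only [traceFst, conjTranspose_apply, of_apply, star_sum]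
  exact Finset.sum_congr rfl fun k _ => hρ.apply _ _

theorem trace_conj_diagonal_mul_single {V : Matrix a a ℂ} (hV : Vᴴ * V = 1) (t : a → ℝ) (i : a) :
    ((V * diagonal (fun i => (t i : ℂ)) * Vᴴ) * (V * single i i 1 * Vᴴ)).trace = (t i : ℂ) := by
  have h1 : single i i (1 : ℂ) = diagonal (Pi.single i 1) := by rw [diagonal_single]
  rw [h1, conj_diagonal_mul hV, trace_conj_diagonal hV, Finset.sum_eq_single i]
  · simp
  · intro j _ hj; simp [hj]
  · simp

/-- Subadditivity of the von Neumann entropy. -/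
theorem mutualInfo_nonneg {ρ : Matrix (a × b) (a × b) ℂ} (hρ : IsState ρ) :
    0 ≤ mutualInfo ρ := by
  have hH := hρ.1.1
  obtain ⟨R, hR1, hR2, hR⟩ := exists_diagonalization hH
  obtain ⟨F, hF1, hF2, hF⟩ := exists_diagonalization (traceSnd_isHermitian hH)
  obtain ⟨G, hG1, hG2, hG⟩ := exists_diagonalization (traceFst_isHermitian hH)
  have hl0 := hρ.1.eigenvalues_nonneg
  set l := hH.eigenvalues
  set p := (traceSnd_isHermitian hH).eigenvalues
  set q := (traceFst_isHermitian hH).eigenvalues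
  set K := F ⊗ₖ G with hK
  have hK1 : K * Kᴴ = 1 := by
    rw [hK, conjTranspose_kronecker, ← mul_kronecker_mul, hF1, hG1, one_kronecker_one]
  have hK2 : Kᴴ * K = 1 := by
    rw [hK, conjTranspose_kronecker, ← mul_kronecker_mul, hF2, hG2, one_kronecker_one]
  set O := Kᴴ * R with hO
  have hO1 : O * Oᴴ = 1 := by
    rw [hO, conjTranspose_mul, conjTranspose_conjTranspose, Matrix.mul_assoc,
      ← Matrix.mul_assoc R, hR1, Matrix.one_mul, hK2]
  have hO2 : Oᴴ * O = 1 := by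
    rw [hO, conjTranspose_mul, conjTranspose_conjTranspose, Matrix.mul_assoc,
      ← Matrix.mul_assoc K, hK1, Matrix.one_mul, hR2]
  -- `d` is the doubly stochastic matrix of overlaps between the eigenbasis of `ρ` and the product
  -- of the eigenbases of its marginals. The diagonal `m` of `ρ` in that product basis is a joint
  -- distribution with marginals `p` and `q`.
  set d : a × b → a × b → ℝ := fun x k => ‖O x k‖ ^ 2 with hd
  have hd0 : ∀ x k, 0 ≤ d x k := fun x k => by positivity
  have hdrow : ∀ x, ∑ k, d x k = 1 := fun x => by
    have h := congrFun (congrFun hO1 x) x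
    simp only [mul_apply, conjTranspose_apply, one_apply_eq] at h
    apply Complex.ofReal_injective
    rw [Complex.ofReal_sum, Complex.ofReal_one, ← h]
    refine Finset.sum_congr rfl fun k _ => ?_
    rw [← starRingEnd_apply, Complex.mul_conj', hd]
    push_cast; rfl
  have hdcol : ∀ k, ∑ x, d x k = 1 := fun k => by
    have h := congrFun (congrFun hO2 k) k
    simp only [mul_apply, conjTranspose_apply, one_apply_eq] at h
    apply Complex.ofReal_injective
    rw [Complex.ofReal_sum, Complex.ofReal_one, ← h]
    refine Finset.sum_congr rfl fun k _ => ?_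
    rw [← starRingEnd_apply, Complex.conj_mul', hd]
    push_cast; rfl
  set m : a × b → ℝ := fun x => ∑ k, l k * d x k with hm
  have hm0 : ∀ x, 0 ≤ m x := fun x => Finset.sum_nonneg fun k _ => mul_nonneg (hl0 k) (hd0 x k)
  have hmρ : ∀ x, (Kᴴ * ρ * K) x x = (m x : ℂ) := fun x => by
    have h : Kᴴ * ρ * K = O * diagonal (fun i => (l i : ℂ)) * Oᴴ := by
      conv_lhs => rw [hR]
      rw [hO, conjTranspose_mul, conjTranspose_conjTranspose]
      simp only [Matrix.mul_assoc]
    rw [h, mul_apply, hm]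
    simp only [mul_diagonal, conjTranspose_apply, Complex.ofReal_sum]
    refine Finset.sum_congr rfl fun k _ => ?_
    rw [mul_right_comm, ← starRingEnd_apply, Complex.mul_conj', hd]
    push_cast
    ring
  have hp : ∀ i, p i = ∑ j, m (i, j) := fun i => by
    apply Complex.ofReal_injective
    rw [← trace_conj_diagonal_mul_single hF2 p i, ← hF, ← trace_mul_kronecker_one]
    have e1 : (F * single i i 1 * Fᴴ) ⊗ₖ (1 : Matrix b b ℂ)
        = K * (single i i 1 ⊗ₖ 1) * Kᴴ := by
      rw [hK, conjTranspose_kronecker, ← mul_kronecker_mul, ← mul_kronecker_mul, Matrix.mul_one,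
        hG1]
    rw [e1, ← Matrix.mul_assoc, trace_mul_comm, ← Matrix.mul_assoc, ← Matrix.mul_assoc,
      trace_mul_kronecker_one, trace_mul_single]
    simp [traceSnd, hmρ]
  have hq : ∀ j, q j = ∑ i, m (i, j) := fun j => by
    apply Complex.ofReal_injective
    rw [← trace_conj_diagonal_mul_single hG2 q j, ← hG, ← trace_mul_one_kronecker]
    have e1 : (1 : Matrix a a ℂ) ⊗ₖ (G * single j j 1 * Gᴴ)
        = K * (1 ⊗ₖ single j j 1) * Kᴴ := by
      rw [hK, conjTranspose_kronecker, ← mul_kronecker_mul, ← mul_kronecker_mul, Matrix.mul_one,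
        hF1]
    rw [e1, ← Matrix.mul_assoc, trace_mul_comm, ← Matrix.mul_assoc, ← Matrix.mul_assoc,
      trace_mul_one_kronecker, trace_mul_single]
    simp [traceFst, hmρ]
  have hlsum : ∑ k, l k = 1 := by
    have h1 := hH.trace_eq_sum_eigenvalues
    rw [hρ.2] at h1
    apply Complex.ofReal_injective
    rw [Complex.ofReal_sum, Complex.ofReal_one]
    exact h1.symm
  have hmsum : ∑ i, ∑ j, m (i, j) = 1 := by
    rw [← Fintype.sum_prod_type, hm, Finset.sum_comm]
    simp only [← Finset.mul_sum, hdcol, mul_one, hlsum]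
  have hp0 : ∀ i, 0 ≤ p i := fun i => by rw [hp]; exact Finset.sum_nonneg fun j _ => hm0 _
  have hq0 : ∀ i, 0 ≤ q i := fun i => by rw [hq]; exact Finset.sum_nonneg fun j _ => hm0 _
  have hpsum : ∑ i, p i = 1 := by simp only [hp]; exact hmsum
  have hqsum : ∑ i, q i = 1 := by simp only [hq]; rw [Finset.sum_comm]; exact hmsum
  -- Klein's inequality, term by term from `log x ≤ x - 1`. When `d` and `l k` are positive, so are
  -- `p i` and `q j`, hence no logarithm of zero is used. The left sides sum to zero.
  have hterm : ∀ (i : a) (j : b) (k : a × b), d (i, j) k * (l k - p i * q j)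
      ≤ l k * d (i, j) k * (Real.log (l k) - Real.log (p i) - Real.log (q j)) := fun i j k => by
    rcases (hd0 (i, j) k).eq_or_lt with h0 | h0
    · rw [← h0]; simp
    rcases (hl0 k).eq_or_lt with h1 | h1
    · rw [← h1]
      have := mul_nonneg (hd0 (i, j) k) (mul_nonneg (hp0 i) (hq0 j))
      simp only [zero_sub, zero_mul]
      linarith
    have hmp : 0 < m (i, j) := lt_of_lt_of_le (mul_pos h1 h0)
      (Finset.single_le_sum (f := fun k => l k * d (i, j) k)
        (fun k _ => mul_nonneg (hl0 k) (hd0 _ k)) (Finset.mem_univ k))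
    have hpi : 0 < p i := by
      rw [hp]
      exact lt_of_lt_of_le hmp (Finset.single_le_sum (f := fun j => m (i, j))
        (fun j _ => hm0 _) (Finset.mem_univ j))
    have hqj : 0 < q j := by
      rw [hq]
      exact lt_of_lt_of_le hmp (Finset.single_le_sum (f := fun i => m (i, j))
        (fun j _ => hm0 _) (Finset.mem_univ i))
    have h2 := Real.log_le_sub_one_of_pos (div_pos (mul_pos hpi hqj) h1)
    rw [Real.log_div (mul_pos hpi hqj).ne' h1.ne', Real.log_mul hpi.ne' hqj.ne'] at h2
    have h3 : l k * (p i * q j / l k) = p i * q j := by field_simp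
    have h4 : l k * (Real.log (p i) + Real.log (q j) - Real.log (l k))
        ≤ l k * (p i * q j / l k - 1) := mul_le_mul_of_nonneg_left h2 h1.le
    nlinarith
  have hsum := Finset.sum_le_sum fun i (_ : i ∈ (Finset.univ : Finset a)) =>
    Finset.sum_le_sum fun j (_ : j ∈ (Finset.univ : Finset b)) =>
    Finset.sum_le_sum fun k (_ : k ∈ (Finset.univ : Finset (a × b))) => hterm i j k
  have hleft : ∑ i, ∑ j, ∑ k, d (i, j) k * (l k - p i * q j) = 0 := by
    have e1 : ∀ i j, ∑ k, d (i, j) k * (l k - p i * q j) = m (i, j) - p i * q j := fun i j => by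
      simp only [mul_sub, Finset.sum_sub_distrib, ← Finset.sum_mul, hdrow, one_mul, hm]
      congr 1
      exact Finset.sum_congr rfl fun k _ => mul_comm _ _
    simp only [e1, Finset.sum_sub_distrib, hmsum, ← Finset.mul_sum, hqsum, mul_one, hpsum, sub_self]
  have hright : ∑ i, ∑ j, ∑ k, l k * d (i, j) k *
      (Real.log (l k) - Real.log (p i) - Real.log (q j))
      = -∑ k, Real.negMulLog (l k) + ∑ i, Real.negMulLog (p i) + ∑ j, Real.negMulLog (q j) := by
    have e1 : ∀ i j, ∑ k, l k * d (i, j) k * (Real.log (l k) - Real.log (p i) - Real.log (q j))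
        = ∑ k, l k * d (i, j) k * Real.log (l k) - m (i, j) * Real.log (p i)
          - m (i, j) * Real.log (q j) := fun i j => by
      simp only [mul_sub, Finset.sum_sub_distrib, ← Finset.sum_mul, hm]
    simp only [e1, Finset.sum_sub_distrib]
    have e2 : ∑ i, ∑ j, ∑ k, l k * d (i, j) k * Real.log (l k) = -∑ k, Real.negMulLog (l k) := by
      rw [← Fintype.sum_prod_type' (f := fun i j => ∑ k, l k * d (i, j) k * Real.log (l k)),
        Finset.sum_comm, ← Finset.sum_neg_distrib]
      refine Finset.sum_congr rfl fun k _ => ?_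
      rw [← Finset.sum_mul, ← Finset.mul_sum, hdcol, Real.negMulLog]
      ring
    have e3 : ∑ i, ∑ j, m (i, j) * Real.log (p i) = -∑ i, Real.negMulLog (p i) := by
      rw [← Finset.sum_neg_distrib]
      refine Finset.sum_congr rfl fun i _ => ?_
      rw [← Finset.sum_mul, ← hp, Real.negMulLog]
      ring
    have e4 : ∑ i, ∑ j, m (i, j) * Real.log (q j) = -∑ j, Real.negMulLog (q j) := by
      rw [Finset.sum_comm, ← Finset.sum_neg_distrib]
      refine Finset.sum_congr rfl fun i _ => ?_
      rw [← Finset.sum_mul, ← hq, Real.negMulLog]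
      ring
    rw [e2, e3, e4]
    ring
  rw [hleft, hright] at hsum
  rw [mutualInfo, entropy, entropy, entropy, dif_pos hH, dif_pos (traceSnd_isHermitian hH),
    dif_pos (traceFst_isHermitian hH), ← Finset.sum_div, ← Finset.sum_div, ← Finset.sum_div,
    ← add_div, ← sub_div]
  refine div_nonneg ?_ (Real.log_nonneg one_le_two)
  linarith

end Subadditivity

/-! ### Invariance of the Hilbert–Schmidt norm under relabelling and isometries. -/

section Reindex

variable {X Y X' Y' Z : Type*} [Fintype X] [Fintype Y] [Fintype X'] [Fintype Y'] [Fintype Z]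

theorem nsq_submatrix_equiv (M : Matrix X Y ℂ) (e : X' ≃ X) (f : Y' ≃ Y) :
    nsq (M.submatrix e f) = nsq M := by
  simp only [nsq, submatrix_apply]
  rw [← e.sum_comp]
  exact Finset.sum_congr rfl fun x _ => f.sum_comp fun y => ‖M (e x) y‖ ^ 2

theorem nsq_mul_of_isometry [DecidableEq Y] {U : Matrix X Y ℂ} (hU : Uᴴ * U = 1)
    (P : Matrix Y Z ℂ) : nsq (U * P) = nsq P := by
  rw [← nsq_conjTranspose (U * P), ← nsq_conjTranspose P, nsq_eq_re_trace, nsq_eq_re_trace,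
    conjTranspose_conjTranspose, conjTranspose_conjTranspose, conjTranspose_mul,
    Matrix.mul_assoc, ← Matrix.mul_assoc Uᴴ, hU, Matrix.one_mul]

theorem Contr.nsq_conj_le [DecidableEq X] {R : Matrix X X ℂ} (hR : Contr R) (M : Matrix X X ℂ) :
    nsq (R * M * Rᴴ) ≤ nsq M := by
  rw [← nsq_conjTranspose, conjTranspose_mul, conjTranspose_conjTranspose]
  refine (hR.nsq_mul_le _).trans ?_
  rw [nsq_conjTranspose]
  exact hR.nsq_mul_le M

end Reindex

/-! ### Smoothing and asymptotic decoupling of i.i.d. kets. -/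

section Iid

variable {A X Z : Type*} [Fintype A] [Fintype X] [Fintype Z]
  [DecidableEq A] [DecidableEq X] [DecidableEq Z]

/-- The tripartite ket `w` split as `X ⊗ (A Z)`. -/
def sideKet (w : A → X → Z → ℂ) : Matrix X (A × Z) ℂ := Matrix.of fun x p => w p.1 x p.2

/-- The i.i.d. tripartite ket. -/
def ketPow (w : A → X → Z → ℂ) (n : ℕ) : (Fin n → A) → (Fin n → X) → (Fin n → Z) → ℂ :=
  fun a x z => ∏ i, w (a i) (x i) (z i)

theorem nsq_sideKet (w : A → X → Z → ℂ) : nsq (sideKet w) = nsq (splitKet w) := by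
  simp only [nsq, sideKet, splitKet, of_apply, Fintype.sum_prod_type]
  exact Finset.sum_comm

theorem splitKet_ketPow (w : A → X → Z → ℂ) (n : ℕ) :
    splitKet (ketPow w n) = (tpow (splitKet w) n).submatrix
      (Equiv.arrowProdEquivProdArrow (Fin n) (fun _ => A) (fun _ => X)).symm (Equiv.refl _) := rfl

theorem sideKet_ketPow (w : A → X → Z → ℂ) (n : ℕ) :
    sideKet (ketPow w n) = (tpow (sideKet w) n).submatrix (Equiv.refl _)
      (Equiv.arrowProdEquivProdArrow (Fin n) (fun _ => A) (fun _ => Z)).symm := rfl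

theorem nsq_ketPow (w : A → X → Z → ℂ) (hw : nsq (splitKet w) = 1) (n : ℕ) :
    nsq (splitKet (ketPow w n)) = 1 := by
  rw [splitKet_ketPow, nsq_submatrix_equiv, nsq_tpow, hw, one_pow]

/-- The operator `1 ⊗ P`. -/
def idKron (A : Type*) [DecidableEq A] (P : Matrix X X ℂ) : Matrix (A × X) (A × X) ℂ :=
  Matrix.of fun p q => if p.1 = q.1 then P p.2 q.2 else 0

theorem idKron_mul_apply {Y : Type*} (P : Matrix X X ℂ) (M : Matrix (A × X) Y ℂ) (a : A) (x : X)
    (y : Y) : (idKron A P * M) (a, x) y = ∑ x', P x x' * M (a, x') y := by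
  simp only [mul_apply, idKron, of_apply, Fintype.sum_prod_type]
  rw [Finset.sum_eq_single a]
  · simp
  · intro b _ hb; simp [Ne.symm hb]
  · simp

/-- An i.i.d. ket is close to one with typical support on `X` and typical spectrum on `A X`. -/
theorem exists_smoothed_ket (w : A → X → Z → ℂ) (hw : nsq (splitKet w) = 1) {δ ε : ℝ}
    (hδ : 0 < δ) (hε : 0 < ε) :
    ∀ᶠ n : ℕ in atTop, ∃ (φ' : (Fin n → A) → (Fin n → X) → (Fin n → Z) → ℂ)
      (P : Matrix (Fin n → X) (Fin n → X) ℂ),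
      (∀ a x z, ∑ x', P x x' * φ' a x' z = φ' a x z) ∧
      nsq P ≤ 2 ^ (n * (entropy (sideKet w * (sideKet w)ᴴ) + δ)) ∧
      nsq (splitKet φ' * (splitKet φ')ᴴ)
        ≤ 2 ^ (-(n * (entropy (splitKet w * (splitKet w)ᴴ) - δ))) ∧
      nsq (splitKet (ketPow w n) - splitKet φ') ≤ ε ∧ nsq (splitKet φ') ≤ 1 := by
  have hw' : nsq (sideKet w) = 1 := by rw [nsq_sideKet, hw]
  filter_upwards [exists_typical_projection (sideKet w) hw' hδ (by positivity : 0 < ε / 4),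
    exists_typical_projection (splitKet w) hw hδ (by positivity : 0 < ε / 4)] with n h1 h2
  obtain ⟨P, hPH, hPP, hP1, hP2, -⟩ := h1
  obtain ⟨Q0, hQH0, hQQ0, -, hQ2, hQ3⟩ := h2
  set e := (Equiv.arrowProdEquivProdArrow (Fin n) (fun _ => A) (fun _ => X)).symm with he
  set Q := Q0.submatrix e e with hQ
  set Ψ := splitKet (ketPow w n) with hΨ
  have hΨe : Ψ = (tpow (splitKet w) n).submatrix e (Equiv.refl _) := splitKet_ketPow w n
  have hQΨ : Q * Ψ = (Q0 * tpow (splitKet w) n).submatrix e (Equiv.refl _) := by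
    rw [hQ, hΨe, submatrix_mul_equiv]
  have hQH : Qᴴ = Q := by rw [hQ, conjTranspose_submatrix, hQH0]
  have hQQ : Q * Q = Q := by rw [hQ, submatrix_mul_equiv, hQQ0]
  set R := idKron (Fin n → A) P with hR
  have hRH : Rᴴ = R := by
    ext p q
    simp only [hR, idKron, conjTranspose_apply, of_apply]
    by_cases h : p.1 = q.1
    · rw [if_pos h, if_pos h.symm, ← conjTranspose_apply, hPH]
    · rw [if_neg h, if_neg (Ne.symm h), star_zero]
  have hRR : R * R = R := by
    ext ⟨a, x⟩ ⟨b, y⟩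
    rw [hR, idKron_mul_apply]
    simp only [idKron, of_apply]
    by_cases h : a = b
    · simp only [h, if_true]
      rw [← mul_apply, hPP]
    · simp [h]
  have hRc := contr_of_projection hRH hRR
  have hQc := contr_of_projection hQH hQQ
  -- The order matters: with `R` outermost the support on `X` is exactly typical, while conjugation
  -- by the contraction `R` cannot increase the purity already bounded by `Q`.
  set Ψ' := R * (Q * Ψ) with hΨ'
  have hsplit : splitKet (fun a x z => Ψ' (a, x) z) = Ψ' := rfl
  have hRΨ' : R * Ψ' = Ψ' := by rw [hΨ', ← Matrix.mul_assoc, hRR]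
  refine ⟨fun a x z => Ψ' (a, x) z, P, fun a x z => ?_, hP1, ?_, ?_, ?_⟩
  · have h3 := congrFun (congrFun hRΨ' (a, x)) z
    rwa [hR, idKron_mul_apply] at h3
  · rw [hsplit]
    have h3 : Ψ' * Ψ'ᴴ = R * ((Q * Ψ) * (Q * Ψ)ᴴ) * Rᴴ := by
      rw [hΨ', conjTranspose_mul]; simp only [Matrix.mul_assoc]
    rw [h3]
    refine (hRc.nsq_conj_le _).trans ?_
    rw [hQΨ, conjTranspose_submatrix, submatrix_mul_equiv, nsq_submatrix_equiv]
    exact hQ3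
  · rw [hsplit]
    have h3 : Ψ - Ψ' = (Ψ - R * Ψ) + R * (Ψ - Q * Ψ) := by
      rw [hΨ', Matrix.mul_sub]; abel
    have h4 : nsq (Ψ - R * Ψ) ≤ ε / 4 := by
      refine le_trans (le_of_eq ?_) hP2
      have h5 : tpow (sideKet w) n - P * tpow (sideKet w) n
          = (sideKet (fun a x z => (Ψ - R * Ψ) (a, x) z)).submatrix (Equiv.refl _)
            (Equiv.arrowProdEquivProdArrow (Fin n) (fun _ => A) (fun _ => Z)) := by
        ext x az
        simp only [Matrix.sub_apply, submatrix_apply, sideKet, of_apply, hR, idKron_mul_apply]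
        rfl
      rw [h5, nsq_submatrix_equiv, nsq_sideKet]
      rfl
    have h6 : nsq (R * (Ψ - Q * Ψ)) ≤ ε / 4 := by
      refine (hRc.nsq_mul_le _).trans (le_trans (le_of_eq ?_) hQ2)
      have : Ψ - Q * Ψ = (tpow (splitKet w) n - Q0 * tpow (splitKet w) n).submatrix e
          (Equiv.refl _) := by
        rw [hQΨ, hΨe]; rfl
      rw [this, nsq_submatrix_equiv]
    rw [h3]
    refine (nsq_add_le _ _).trans ?_
    linarith
  · rw [hsplit]
    refine (hRc.nsq_mul_le _).trans ((hQc.nsq_mul_le _).trans ?_)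
    rw [hΨ, nsq_ketPow w hw]

/-- Asymptotic decoupling: if `|M| / |J|` is below `2^{n (H(A|X) - δ)}`, random coding
decouples `M` from `X`. -/
theorem eventually_exists_decoupling_bound (w : A → X → Z → ℂ) (hw : nsq (splitKet w) = 1)
    {X' Z' : ℕ → Type*} [∀ n, Fintype (X' n)] [∀ n, Fintype (Z' n)] [∀ n, DecidableEq (X' n)]
    [∀ n, DecidableEq (Z' n)] (ξ : ∀ n, X' n ≃ (Fin n → X)) (ζ : ∀ n, Z' n ≃ (Fin n → Z))
    {δ s : ℝ} (hδ : 0 < δ) (hs : 0 < s) :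
    ∀ᶠ n : ℕ in atTop, ∀ (K M J : Type) [Fintype K] [Fintype M] [Fintype J] [DecidableEq K]
      [DecidableEq M] [DecidableEq J] [Nonempty K] [Nonempty M] [Nonempty J] (e : K ≃ M × J),
      (Fintype.card M : ℝ) ≤ Fintype.card J * 2 ^ (n *
        (entropy (splitKet w * (splitKet w)ᴴ) - entropy (sideKet w * (sideKet w)ᴴ) - δ)) →
      ∃ F : (K × (Fin n → A) → ZMod 3) → ℝ, avg F ≤ 5 * s ∧
        ∀ v, TraceNormLE
          (codedKet e (phaseMatrix v) (fun a x z => ketPow w n a (ξ n x) (ζ n z)) *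
            (codedKet e (phaseMatrix v) (fun a x z => ketPow w n a (ξ n x) (ζ n z)))ᴴ
          - refState M (fun a x z => ketPow w n a (ξ n x) (ζ n z))) (F v) := by
  set H := entropy (splitKet w * (splitKet w)ᴴ)
  set H' := entropy (sideKet w * (sideKet w)ᴴ)
  have hlim : ∀ᶠ n : ℕ in atTop, (2 : ℝ) ^ (-(n * (δ / 2))) ≤ s ^ 2 := by
    have h1 : Tendsto (fun n : ℕ => ((2 : ℝ) ^ (-(δ / 2))) ^ n) atTop (𝓝 0) :=
      tendsto_pow_atTop_nhds_zero_of_lt_one (Real.rpow_pos_of_pos two_pos _).le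
        (Real.rpow_lt_one_of_one_lt_of_neg one_lt_two (by linarith))
    filter_upwards [h1.eventually_le_const (by positivity : (0 : ℝ) < s ^ 2)] with n hn
    refine le_trans (le_of_eq ?_) hn
    rw [← Real.rpow_natCast, ← Real.rpow_mul two_pos.le]
    congr 1
    ring
  filter_upwards [exists_smoothed_ket w hw (by positivity : 0 < δ / 4)
    (by positivity : 0 < s ^ 2), hlim] with n hn hl K M J _ _ _ _ _ _ _ _ _ e hMJ
  obtain ⟨φ', P, h1, h2, h3, h4, h5⟩ := hn
  set φ := fun a x z => ketPow w n a (ξ n x) (ζ n z) with hφ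
  set φ'' := fun a x z => φ' a (ξ n x) (ζ n z) with hφ''
  have e1 : splitKet φ = (splitKet (ketPow w n)).submatrix
      (Equiv.prodCongr (Equiv.refl _) (ξ n)) (ζ n) := rfl
  have e2 : splitKet φ'' = (splitKet φ').submatrix
      (Equiv.prodCongr (Equiv.refl _) (ξ n)) (ζ n) := rfl
  set D : ℝ := Fintype.card M * 2 ^ (n * (H' + δ / 4)) with hD
  have hM : (0 : ℝ) < Fintype.card M := by exact_mod_cast Fintype.card_pos
  have hJ : (0 : ℝ) < Fintype.card J := by exact_mod_cast Fintype.card_pos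
  have hpow : ∀ x : ℝ, (0 : ℝ) < 2 ^ x := fun x => Real.rpow_pos_of_pos two_pos x
  have hDpos : 0 < D := mul_pos hM (hpow _)
  obtain ⟨F, hF, hFv⟩ := exists_decoupling_bound e φ φ'' (P.submatrix (ξ n) (ξ n))
    (fun a x z => by
      rw [hφ'']
      simp only [submatrix_apply]
      rw [← h1 a (ξ n x) (ζ n z)]
      exact (ξ n).sum_comp fun x' => P (ξ n x) x' * φ' a x' (ζ n z)) hDpos
    (by rw [nsq_submatrix_equiv, hD]; exact mul_le_mul_of_nonneg_left h2 hM.le) hs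
  refine ⟨F, hF.trans ?_, hFv⟩
  have e3 : splitKet φ'' * (splitKet φ'')ᴴ = (splitKet φ' * (splitKet φ')ᴴ).submatrix
      (Equiv.prodCongr (Equiv.refl _) (ξ n)) (Equiv.prodCongr (Equiv.refl _) (ξ n)) := by
    rw [e2, conjTranspose_submatrix, submatrix_mul_equiv]
  have e4 : splitKet φ - splitKet φ'' = (splitKet (ketPow w n) - splitKet φ').submatrix
      (Equiv.prodCongr (Equiv.refl _) (ξ n)) (ζ n) := rfl
  rw [e3, e4, nsq_submatrix_equiv, nsq_submatrix_equiv, e1, e2, nsq_submatrix_equiv,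
    nsq_submatrix_equiv, nsq_ketPow w hw]
  have hDκ : D * (nsq (splitKet φ' * (splitKet φ')ᴴ) / Fintype.card J) ≤ s ^ 2 := by
    refine le_trans ?_ hl
    calc D * (nsq (splitKet φ' * (splitKet φ')ᴴ) / Fintype.card J)
        ≤ D * (2 ^ (-(n * (H - δ / 4))) / Fintype.card J) := by gcongr
      _ = Fintype.card M / Fintype.card J * (2 ^ (n * (H' + δ / 4)) * 2 ^ (-(n * (H - δ / 4)))) := by
          rw [hD]; ring
      _ ≤ 2 ^ (n * (H - H' - δ)) * (2 ^ (n * (H' + δ / 4)) * 2 ^ (-(n * (H - δ / 4)))) := by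
          refine mul_le_mul_of_nonneg_right ?_ (mul_pos (hpow _) (hpow _)).le
          rw [div_le_iff₀ hJ, mul_comm]
          exact hMJ
      -- The two typicality losses of `δ / 4` use up half of the rate slack `δ`.
      _ = 2 ^ (-(n * (δ / 2))) := by
          rw [← Real.rpow_add two_pos, ← Real.rpow_add two_pos]
          congr 1
          ring
  -- The budget is `(s + s) / 2 + 2 * (s + s) = 5 * s`.
  have g1 : D * (nsq (splitKet φ' * (splitKet φ')ᴴ) / Fintype.card J) / s ≤ s := by
    rw [div_le_iff₀ hs]; linarith
  have g2 : nsq (splitKet (ketPow w n) - splitKet φ') / s ≤ s := by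
    rw [div_le_iff₀ hs]; linarith
  have g3 : s * (1 + nsq (splitKet φ')) / 2 ≤ s := by nlinarith
  linarith

end Iid

/-! ### Stinespring dilations acting on kets. -/

section Dilation

variable {a b e r f : Type*} [Fintype a] [Fintype b] [Fintype e] [Fintype r] [Fintype f]
  [DecidableEq a]

/-- The map `X ↦ tr_e (V X Vᴴ)`. -/
def dilatedChannel (V : Matrix (b × e) a ℂ) : Matrix a a ℂ →ₗ[ℂ] Matrix b b ℂ where
  toFun X := traceSnd (V * X * Vᴴ)
  map_add' X Y := by
    ext i j
    simp [traceSnd, Matrix.mul_add, Matrix.add_mul, Finset.sum_add_distrib]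
  map_smul' c X := by
    ext i j
    simp [traceSnd, Finset.mul_sum]

theorem traceSnd_dilation_eq_sum (V : Matrix (b × e) a ℂ) (X : Matrix a a ℂ) :
    traceSnd (V * X * Vᴴ) = ∑ k, (Matrix.of fun i j => V (i, k) j : Matrix b a ℂ) * X *
      (Matrix.of fun i j => V (i, k) j : Matrix b a ℂ)ᴴ := by
  ext i j
  simp only [traceSnd, of_apply, Matrix.sum_apply, mul_apply, conjTranspose_apply]

theorem isChannel_dilatedChannel {V : Matrix (b × e) a ℂ} (hV : Vᴴ * V = 1) :
    IsChannel (dilatedChannel V) := by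
  set K : e → Matrix b a ℂ := fun k => Matrix.of fun i j => V (i, k) j with hK
  refine ⟨Fintype.card e, fun k => K ((Fintype.equivFin e).symm k), ?_, fun X => ?_⟩
  · rw [(Fintype.equivFin e).symm.sum_comp fun k => (K k)ᴴ * K k, ← hV]
    ext i j
    simp only [Matrix.sum_apply, mul_apply, conjTranspose_apply, hK, of_apply,
      Fintype.sum_prod_type]
    exact Finset.sum_comm
  · rw [(Fintype.equivFin e).symm.sum_comp fun k => K k * X * (K k)ᴴ]
    exact traceSnd_dilation_eq_sum V X

/-- The effect of `V : a → b e` on a ket on `(r a) ⊗ f`. -/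
def pushKet (V : Matrix (b × e) a ℂ) (κ : Matrix (r × a) f ℂ) : Matrix (r × b) (e × f) ℂ :=
  Matrix.of fun p q => ∑ x, V (p.2, q.1) x * κ (p.1, x) q.2

theorem applySnd_reduced {Φ : Matrix a a ℂ →ₗ[ℂ] Matrix b b ℂ} {V : Matrix (b × e) a ℂ}
    (hΦ : ∀ X, Φ X = traceSnd (V * X * Vᴴ)) (κ : Matrix (r × a) f ℂ) :
    applySnd Φ (κ * κᴴ) = pushKet V κ * (pushKet V κ)ᴴ := by
  ext p q
  simp only [applySnd, of_apply, hΦ, traceSnd, mul_apply, conjTranspose_apply, pushKet,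
    Fintype.sum_prod_type, star_sum, Finset.mul_sum, Finset.sum_mul]
  refine Finset.sum_congr rfl fun k _ => ?_
  rw [Finset.sum_congr rfl fun y _ => Finset.sum_comm, Finset.sum_comm]
  refine Finset.sum_congr rfl fun g _ => ?_
  refine Finset.sum_congr rfl fun y _ => Finset.sum_congr rfl fun x _ => ?_
  rw [star_mul']
  ring

theorem pushKet_sub (V : Matrix (b × e) a ℂ) (κ κ' : Matrix (r × a) f ℂ) :
    pushKet V κ - pushKet V κ' = pushKet V (κ - κ') := by
  ext p q
  simp [pushKet, mul_sub]

theorem nsq_pushKet {V : Matrix (b × e) a ℂ} (hV : Vᴴ * V = 1) (κ : Matrix (r × a) f ℂ) :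
    nsq (pushKet V κ) = nsq κ := by
  have h1 : ∀ p : r, ∑ y : b, ∑ q : e × f, ‖pushKet V κ (p, y) q‖ ^ 2
      = nsq (V * (Matrix.of fun x g => κ (p, x) g)) := fun p => by
    simp only [nsq, Fintype.sum_prod_type, pushKet, mul_apply, of_apply]
  simp only [nsq, Fintype.sum_prod_type (γ := ℝ) (α₁ := r)] at h1 ⊢
  simp only [h1]
  refine Finset.sum_congr rfl fun p _ => ?_
  exact nsq_mul_of_isometry hV (Matrix.of fun x g => κ (p, x) g)

/-- The tensor power of a dilation `U : a → b e`. -/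
def dilationPow (U : Matrix (b × e) a ℂ) (n : ℕ) :
    Matrix ((Fin n → b) × (Fin n → e)) (Fin n → a) ℂ :=
  Matrix.of fun p x => ∏ i, U (p.1 i, p.2 i) (x i)

theorem tensorPower_dilation {Φ : Matrix a a ℂ →ₗ[ℂ] Matrix b b ℂ} {U : Matrix (b × e) a ℂ}
    (hΦ : ∀ X, Φ X = traceSnd (U * X * Uᴴ)) (n : ℕ) (X : Matrix (Fin n → a) (Fin n → a) ℂ) :
    tensorPower Φ n X = traceSnd (dilationPow U n * X * (dilationPow U n)ᴴ) := by
  classical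
  have h0 : ∀ x y p q, Φ (single x y 1) p q = ∑ k, U (p, k) x * star (U (q, k) y) :=
    fun x y p q => by
      rw [hΦ]
      simp only [traceSnd, of_apply]
      refine Finset.sum_congr rfl fun k _ => ?_
      rw [mul_apply, Finset.sum_eq_single y]
      · simp
      · intro z _ hz
        rw [mul_single_apply_of_ne _ _ _ _ _ hz, zero_mul]
      · simp
  ext p q
  simp only [tensorPower, LinearMap.coe_mk, AddHom.coe_mk, of_apply, h0, traceSnd, mul_apply,
    conjTranspose_apply, dilationPow, Finset.sum_mul]
  have h1 : ∀ x y : Fin n → a, ∏ i, ∑ k, U (p i, k) (x i) * star (U (q i, k) (y i))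
      = ∑ k : Fin n → e, ∏ i, (U (p i, k i) (x i) * star (U (q i, k i) (y i))) := fun x y => by
    rw [sum_prod_pi (fun i k => U (p i, k) (x i) * star (U (q i, k) (y i)))]
  simp only [h1, Finset.sum_mul]
  rw [Finset.sum_comm, Finset.sum_congr rfl fun y _ => Finset.sum_congr rfl fun x _ => rfl]
  rw [Finset.sum_congr rfl fun y _ => Finset.sum_comm, Finset.sum_comm]
  refine Finset.sum_congr rfl fun k _ => Finset.sum_congr rfl fun y _ =>
    Finset.sum_congr rfl fun x _ => ?_
  rw [Finset.prod_mul_distrib, ← star_prod]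
  ring

theorem dilationPow_isometry {U : Matrix (b × e) a ℂ} (hU : Uᴴ * U = 1) (n : ℕ) :
    (dilationPow U n)ᴴ * dilationPow U n = 1 := by
  classical
  have h : dilationPow U n = (tpow U n).submatrix
      (Equiv.arrowProdEquivProdArrow (Fin n) (fun _ => b) (fun _ => e)).symm (Equiv.refl _) := rfl
  rw [h, conjTranspose_submatrix, submatrix_mul_equiv, ← tpow_conjTranspose, ← tpow_mul, hU,
    tpow_one]
  exact submatrix_one_equiv _

end Dilation

/-! ### Maximally entangled amplitudes. -/

section MaxEnt

theorem maxEnt_mul_maxEnt (r t : ℕ) (i i' : Fin r) (j j' : Fin t) :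
    maxEnt r i i' * maxEnt t j j' = if (i, j) = (i', j') then
      ((1 / Real.sqrt (Fintype.card (Fin r × Fin t)) : ℝ) : ℂ) else 0 := by
  simp only [maxEnt, Prod.mk.injEq, Fintype.card_prod, Fintype.card_fin]
  by_cases h1 : i = i' <;> by_cases h2 : j = j' <;> simp [h1, h2]
  ring

theorem star_maxEnt (r : ℕ) (i i' : Fin r) : star (maxEnt r i i') = maxEnt r i i' := by
  simp only [maxEnt]
  split_ifs
  · rw [Complex.star_def, Complex.conj_ofReal]
  · simp

end MaxEnt

/-! ### One-shot codes from decoupling. -/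

section OneShot

variable {A' S S' B E L D : Type*}
  [Fintype A'] [DecidableEq A'] [Fintype S] [DecidableEq S]
  [Fintype S'] [DecidableEq S'] [Fintype B] [DecidableEq B] [Fintype E] [DecidableEq E]
  [Fintype L] [DecidableEq L] [Fintype D] [DecidableEq D]

/-- The ket on `(R B̃ Sⁿ) ⊗ (R' Ã S'ⁿ)` before encoding, as a column. -/
def inputKet (ψ : S × S' → ℂ) (n r t : ℕ) :
    Matrix ((Fin r × Fin t × (Fin n → S)) × (Fin r × Fin t × (Fin n → S'))) Unit ℂ :=
  Matrix.of fun p _ => maxEnt r p.1.1 p.2.1 * maxEnt t p.1.2.1 p.2.2.1 *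
    ∏ i, ψ (p.1.2.2 i, p.2.2.2 i)

theorem inputKet_reduced (ψ : S × S' → ℂ) (n r t : ℕ) :
    inputState ψ n r t = inputKet ψ n r t * (inputKet ψ n r t)ᴴ := by
  ext p q
  simp [inputState, inputKet, proj, mul_apply]

/-- The rearrangement of the systems after encoding. -/
def encEquiv (A' S : Type*) (n r t h : ℕ) : (Fin r × Fin h × Fin t) × (Fin n → A' × S) ≃
    (Fin r × Fin t × (Fin n → S)) × ((Fin n → A') × Fin h) where
  toFun p := ((p.1.1, p.1.2.2, fun i => (p.2 i).2), (fun i => (p.2 i).1, p.1.2.1))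
  invFun p := ((p.1.1, p.2.2, p.1.2.1), fun i => (p.2.1 i, p.1.2.2 i))
  left_inv _ := rfl
  right_inv _ := rfl

/-- The rearrangement of the systems after transmission. -/
def recEquiv (B : Type*) (n r t h : ℕ) : (Fin r × Fin h) × ((Fin n → B) × Fin t) ≃
    (Fin r × Fin h × Fin t) × (Fin n → B) where
  toFun p := ((p.1.1, p.1.2, p.2.2), p.2.1)
  invFun p := ((p.1.1, p.1.2.1), (p.2, p.1.2.2))
  left_inv _ := rfl
  right_inv _ := rfl

/-- Transmission and decoding of a ket that has been encoded. -/
def receiveKet {e₁ e₂ : Type*} [Fintype e₁] [Fintype e₂] {n r t h : ℕ}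
    (U : Matrix (B × E) (A' × S) ℂ)
    (Vd : Matrix ((Fin r × Fin h) × e₂) ((Fin n → B) × Fin t) ℂ)
    (κ : Matrix ((Fin r × Fin t × (Fin n → S)) × ((Fin n → A') × Fin h)) e₁ ℂ) :
    Matrix ((Fin r × Fin h) × (Fin r × Fin h)) (e₂ × ((Fin n → E) × e₁)) ℂ :=
  pushKet Vd ((pushKet (dilationPow U n) (κ.submatrix (encEquiv A' S n r t h)
    (Equiv.refl _))).submatrix (recEquiv B n r t h) (Equiv.refl _))

theorem receiveKet_sub {e₁ e₂ : Type*} [Fintype e₁] [Fintype e₂] {n r t h : ℕ}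
    (U : Matrix (B × E) (A' × S) ℂ)
    (Vd : Matrix ((Fin r × Fin h) × e₂) ((Fin n → B) × Fin t) ℂ)
    (κ κ' : Matrix ((Fin r × Fin t × (Fin n → S)) × ((Fin n → A') × Fin h)) e₁ ℂ) :
    receiveKet U Vd κ - receiveKet U Vd κ' = receiveKet U Vd (κ - κ') := by
  rw [receiveKet, receiveKet, pushKet_sub]
  refine congrArg (pushKet Vd) ?_
  ext p q
  have := congrFun (congrFun (pushKet_sub (dilationPow U n)
    (κ.submatrix (encEquiv A' S n r t h) (Equiv.refl _))
    (κ'.submatrix (encEquiv A' S n r t h) (Equiv.refl _))) (recEquiv B n r t h p)) q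
  exact this

theorem nsq_receiveKet {e₁ e₂ : Type*} [Fintype e₁] [Fintype e₂] {n r t h : ℕ}
    {U : Matrix (B × E) (A' × S) ℂ} (hU : Uᴴ * U = 1)
    {Vd : Matrix ((Fin r × Fin h) × e₂) ((Fin n → B) × Fin t) ℂ} (hVd : Vdᴴ * Vd = 1)
    (κ : Matrix ((Fin r × Fin t × (Fin n → S)) × ((Fin n → A') × Fin h)) e₁ ℂ) :
    nsq (receiveKet U Vd κ) = nsq κ := by
  classical
  rw [receiveKet, nsq_pushKet hVd, nsq_submatrix_equiv, nsq_pushKet (dilationPow_isometry hU n),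
    nsq_submatrix_equiv]

/-- With every channel dilated, the decoded state has an explicit purification, so the error of a
code can be estimated at the level of kets. -/
theorem decoded_reduced {e₁ e₂ : Type*} [Fintype e₁] [Fintype e₂]
    {N : Matrix (A' × S) (A' × S) ℂ →ₗ[ℂ] Matrix B B ℂ} {n r t h : ℕ}
    {U : Matrix (B × E) (A' × S) ℂ} (hN : ∀ X, N X = traceSnd (U * X * Uᴴ)) (ψ : S × S' → ℂ)
    (Ve : Matrix (((Fin n → A') × Fin h) × e₁) (Fin r × Fin t × (Fin n → S')) ℂ)
    (Vd : Matrix ((Fin r × Fin h) × e₂) ((Fin n → B) × Fin t) ℂ) :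
    applySnd (dilatedChannel Vd) (receivedState N ψ n r t h (dilatedChannel Ve))
      = receiveKet U Vd (pushKet Ve (inputKet ψ n r t)) *
        (receiveKet U Vd (pushKet Ve (inputKet ψ n r t)))ᴴ := by
  classical
  have h1 : encodedState (A' := A') ψ n r t h (dilatedChannel Ve)
      = ((pushKet Ve (inputKet ψ n r t)).submatrix (encEquiv A' S n r t h) (Equiv.refl _)) *
        ((pushKet Ve (inputKet ψ n r t)).submatrix (encEquiv A' S n r t h) (Equiv.refl _))ᴴ := by
    rw [conjTranspose_submatrix, submatrix_mul_equiv, ← applySnd_reduced (Φ := dilatedChannel Ve)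
      (fun _ => rfl), ← inputKet_reduced]
    rfl
  have h2 : receivedState N ψ n r t h (dilatedChannel Ve) =
      (applySnd (tensorPower N n) (encodedState ψ n r t h (dilatedChannel Ve))).submatrix
        (recEquiv B n r t h) (recEquiv B n r t h) := rfl
  rw [h2, h1, applySnd_reduced (fun X => tensorPower_dilation hN n X),
    ← submatrix_mul_equiv _ _ _ (Equiv.refl _), ← conjTranspose_submatrix,
    applySnd_reduced (Φ := dilatedChannel Vd) (fun _ => rfl)]
  rfl

/-- `χ` is the state in which all discarded systems are left. Any normalized `χ` will do, since in a
product with the target ket it disappears under the partial trace. -/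
theorem hasCode_of_ket_close {e₁ e₂ : Type*} [Fintype e₁] [Fintype e₂]
    {N : Matrix (A' × S) (A' × S) ℂ →ₗ[ℂ] Matrix B B ℂ} {n r t h : ℕ}
    (hr : 0 < r) (ht : 0 < t) (hh : 0 < h)
    {U : Matrix (B × E) (A' × S) ℂ} (hU : IsIsometricExtension N U) (ψ : S × S' → ℂ)
    {Ve : Matrix (((Fin n → A') × Fin h) × e₁) (Fin r × Fin t × (Fin n → S')) ℂ}
    (hVe : Veᴴ * Ve = 1)
    {Vd : Matrix ((Fin r × Fin h) × e₂) ((Fin n → B) × Fin t) ℂ} (hVd : Vdᴴ * Vd = 1)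
    (χ : e₂ × ((Fin n → E) × (e₁ × Unit)) → ℂ) (hχ : ∑ x, ‖χ x‖ ^ 2 = 1) {s : ℝ} (hs : 0 < s)
    (hs1 : s ≤ 1)
    (hclose : nsq (receiveKet U Vd (pushKet Ve (inputKet ψ n r t)) -
      Matrix.of fun p x => maxEnt r p.1.1 p.2.1 * maxEnt h p.1.2 p.2.2 * χ x) ≤ s ^ 2) :
    HasCode N ψ n r t h (4 * s) := by
  classical
  refine ⟨hr, ht, hh, dilatedChannel Ve, dilatedChannel Vd, isChannel_dilatedChannel hVe,
    isChannel_dilatedChannel hVd, ?_⟩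
  apply traceNorm_le_of_traceNormLE
  rw [decoded_reduced hU.2]
  set Ω := receiveKet U Vd (pushKet Ve (inputKet ψ n r t))
  set τ : Matrix ((Fin r × Fin h) × (Fin r × Fin h)) (e₂ × ((Fin n → E) × (e₁ × Unit))) ℂ :=
    Matrix.of fun p x => maxEnt r p.1.1 p.2.1 * maxEnt h p.1.2 p.2.2 * χ x with hτ
  have hχc : ∑ x, χ x * star (χ x) = 1 := by
    rw [← Complex.ofReal_one, ← hχ, Complex.ofReal_sum]
    refine Finset.sum_congr rfl fun x _ => ?_
    rw [← starRingEnd_apply, Complex.mul_conj']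
    push_cast; rfl
  have h1 : targetState r h = τ * τᴴ := by
    ext p q
    simp only [targetState, proj, of_apply, mul_apply, conjTranspose_apply, hτ]
    have : ∀ x, maxEnt r p.1.1 p.2.1 * maxEnt h p.1.2 p.2.2 * χ x *
        star (maxEnt r q.1.1 q.2.1 * maxEnt h q.1.2 q.2.2 * χ x)
        = maxEnt r p.1.1 p.2.1 * maxEnt h p.1.2 p.2.2 *
          star (maxEnt r q.1.1 q.2.1 * maxEnt h q.1.2 q.2.2) * (χ x * star (χ x)) := fun x => by
      rw [star_mul' _ (χ x)]; ring
    simp only [this, ← Finset.mul_sum, hχc, mul_one]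
  have hτn : nsq τ = 1 := by
    have : ∀ p, ∑ x, ‖τ p x‖ ^ 2 = ‖maxEnt r p.1.1 p.2.1 * maxEnt h p.1.2 p.2.2‖ ^ 2 := fun p => by
      simp only [hτ, of_apply, norm_mul _ (χ _), mul_pow, ← Finset.mul_sum, hχ, mul_one]
    simp only [nsq, this]
    have h2 : ∀ p : (Fin r × Fin h) × (Fin r × Fin h),
        ‖maxEnt r p.1.1 p.2.1 * maxEnt h p.1.2 p.2.2‖ ^ 2
        = if p.1 = p.2 then (1 / (r * h) : ℝ) else 0 := fun p => by
      rw [maxEnt_mul_maxEnt]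
      split_ifs
      · rw [Complex.norm_real, Real.norm_of_nonneg (by positivity), div_pow, one_pow,
          Real.sq_sqrt (Nat.cast_nonneg _)]
        simp
      · simp
    simp only [h2]
    rw [Fintype.sum_prod_type]
    have hr' : (r : ℝ) ≠ 0 := by positivity
    have hh' : (h : ℝ) ≠ 0 := by positivity
    simp
    field_simp
  rw [h1]
  refine (traceNormLE_reduced_sub Ω τ hs).mono ?_
  have h3 : nsq Ω ≤ 2 * nsq (Ω - τ) + 2 * nsq τ := by
    have := nsq_add_le (Ω - τ) τ
    rwa [sub_add_cancel] at this
  -- With `nsq Ω ≤ 2 * s ^ 2 + 2 ≤ 4` the error is at most `s + s * (4 + 1) / 2`, which is below `4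
  -- * s`.
  have h4 : nsq (Ω - τ) / s ≤ s := by rw [div_le_iff₀ hs]; nlinarith
  have h5 : s ^ 2 ≤ 1 := by nlinarith
  rw [hτn] at h3 ⊢
  nlinarith

theorem nsq_eq_of_equiv {X Y X' Y' : Type*} [Fintype X] [Fintype Y] [Fintype X'] [Fintype Y']
    {M : Matrix X Y ℂ} {M' : Matrix X' Y' ℂ} (e : X × Y ≃ X' × Y')
    (h : ∀ p, M p.1 p.2 = M' (e p).1 (e p).2) : nsq M = nsq M' := by
  rw [nsq, nsq, ← Fintype.sum_prod_type' (f := fun x y => ‖M x y‖ ^ 2),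
    ← Fintype.sum_prod_type' (f := fun x y => ‖M' x y‖ ^ 2), ← e.sum_comp]
  exact Finset.sum_congr rfl fun p _ => by rw [h]

theorem submatrix_isometry {Y Q Q' : Type*} [Fintype Y] [Fintype Q] [Fintype Q'] [DecidableEq Y]
    {V : Matrix Q Y ℂ} (hV : Vᴴ * V = 1) (e : Q' ≃ Q) :
    (V.submatrix e (Equiv.refl _))ᴴ * V.submatrix e (Equiv.refl _) = 1 := by
  rw [conjTranspose_submatrix, submatrix_mul_equiv, hV]
  exact submatrix_one_equiv _

/-- The grouping that moves the factor `h` to the environment. -/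
def discardEquiv (a h e : Type*) : (a × Fin 1) × (h × e) ≃ (a × h) × e where
  toFun p := ((p.1.1, p.2.1), p.2.2)
  invFun p := ((p.1.1, 0), (p.1.2, p.2))
  left_inv p := by
    obtain ⟨⟨i, j⟩, x⟩ := p
    rw [Subsingleton.elim j 0]
  right_inv _ := rfl

/-- The returned entanglement may be discarded. -/
theorem hasCode_one_of_ket_close {e₁ e₂ : Type*} [Fintype e₁] [Fintype e₂]
    {N : Matrix (A' × S) (A' × S) ℂ →ₗ[ℂ] Matrix B B ℂ} {n r t h : ℕ}
    (hr : 0 < r) (ht : 0 < t) (hh : 0 < h)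
    {U : Matrix (B × E) (A' × S) ℂ} (hU : IsIsometricExtension N U) (ψ : S × S' → ℂ)
    {Ve : Matrix (((Fin n → A') × Fin h) × e₁) (Fin r × Fin t × (Fin n → S')) ℂ}
    (hVe : Veᴴ * Ve = 1)
    {Vd : Matrix ((Fin r × Fin h) × e₂) ((Fin n → B) × Fin t) ℂ} (hVd : Vdᴴ * Vd = 1)
    (χ : e₂ × ((Fin n → E) × (e₁ × Unit)) → ℂ) (hχ : ∑ x, ‖χ x‖ ^ 2 = 1) {s : ℝ} (hs : 0 < s)
    (hs1 : s ≤ 1)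
    (hclose : nsq (receiveKet U Vd (pushKet Ve (inputKet ψ n r t)) -
      Matrix.of fun p x => maxEnt r p.1.1 p.2.1 * maxEnt h p.1.2 p.2.2 * χ x) ≤ s ^ 2) :
    HasCode N ψ n r t 1 (4 * s) := by
  set Ve' := Ve.submatrix (discardEquiv (Fin n → A') (Fin h) e₁) (Equiv.refl _) with hVe'
  set Vd' := Vd.submatrix (discardEquiv (Fin r) (Fin h) e₂) (Equiv.refl _) with hVd'
  -- Both halves of the returned pair are assigned to the environments of encoder and decoder, so
  -- the pair becomes part of the discarded ket. The amplitudes are the same up to regrouping, and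
  -- the distance is unchanged.
  set χ' : (Fin h × e₂) × ((Fin n → E) × ((Fin h × e₁) × Unit)) → ℂ := fun x =>
    maxEnt h x.2.2.1.1 x.1.1 * χ (x.1.2, (x.2.1, (x.2.2.1.2, ()))) with hχ'
  have hm : ∀ i j : Fin 1, maxEnt 1 i j = 1 := fun i j => by
    simp [maxEnt, Subsingleton.elim i j]
  have hχ'n : ∑ x, ‖χ' x‖ ^ 2 = 1 := by
    have e1 : ∀ (j j' : Fin h), ‖maxEnt h j' j‖ ^ 2 = if j' = j then (1 / h : ℝ) else 0 :=
      fun j j' => by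
        simp only [maxEnt]
        split_ifs
        · rw [Complex.norm_real, Real.norm_of_nonneg (by positivity), div_pow, one_pow,
            Real.sq_sqrt (Nat.cast_nonneg _)]
        · simp
    have hh' : (h : ℝ) ≠ 0 := by positivity
    calc ∑ x, ‖χ' x‖ ^ 2 = ∑ p : (Fin h × Fin h) × (e₂ × ((Fin n → E) × (e₁ × Unit))),
          (if p.1.1 = p.1.2 then (1 / h : ℝ) else 0) * ‖χ p.2‖ ^ 2 := by
          refine Fintype.sum_equiv
            { toFun := fun x => ((x.2.2.1.1, x.1.1), (x.1.2, (x.2.1, (x.2.2.1.2, ()))))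
              invFun := fun p => ((p.1.2, p.2.1), (p.2.2.1, ((p.1.1, p.2.2.2.1), ())))
              left_inv := fun _ => rfl
              right_inv := fun _ => rfl } _ _ fun x => ?_
          simp only [hχ', norm_mul, mul_pow, e1, Equiv.coe_fn_mk]
      _ = ∑ p : Fin h × Fin h, (if p.1 = p.2 then (1 / h : ℝ) else 0) := by
          rw [Fintype.sum_prod_type]
          refine Finset.sum_congr rfl fun p _ => ?_
          by_cases hp : p.1 = p.2
          · simp only [hp, if_true, ← Finset.mul_sum, hχ, mul_one]
          · simp [hp]
      _ = 1 := by
          rw [Fintype.sum_prod_type]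
          simp
          field_simp
  refine hasCode_of_ket_close hr ht one_pos hU ψ (Ve := Ve') (submatrix_isometry hVe _) (Vd := Vd') (submatrix_isometry hVd _)
    χ' hχ'n hs hs1 ?_
  refine le_trans (le_of_eq ?_) hclose
  refine nsq_eq_of_equiv
    { toFun := fun p => (((p.1.1.1, p.2.2.2.1.1), (p.1.2.1, p.2.1.1)),
        (p.2.1.2, (p.2.2.1, (p.2.2.2.1.2, ()))))
      invFun := fun q => (((q.1.1.1, 0), (q.1.2.1, 0)),
        ((q.1.2.2, q.2.1), (q.2.2.1, ((q.1.1.2, q.2.2.2.1), ()))))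
      left_inv := fun p => by
        obtain ⟨⟨⟨i, j⟩, ⟨i', j'⟩⟩, x⟩ := p
        rw [Subsingleton.elim j 0, Subsingleton.elim j' 0]
      right_inv := fun _ => rfl } ?_
  rintro ⟨⟨⟨i, j⟩, ⟨i', j'⟩⟩, ⟨⟨k, x₂⟩, ⟨e, ⟨⟨k', x₁⟩, ⟨⟩⟩⟩⟩⟩
  simp only [Matrix.sub_apply, of_apply, Equiv.coe_fn_mk, hm, mul_one, hχ', mul_assoc]
  congr 1

/-- The grouping `R B̃ Â = (R B̃) Â`. -/
def groupEnc (r t h : ℕ) : Fin r × Fin t × Fin h ≃ (Fin r × Fin t) × Fin h where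
  toFun k := ((k.1, k.2.1), k.2.2)
  invFun p := (p.1.1, p.1.2, p.2)
  left_inv _ := rfl
  right_inv _ := rfl

/-- The grouping `R B̃ Â = (R Â) B̃`. -/
def groupDec (r t h : ℕ) : Fin r × Fin t × Fin h ≃ (Fin r × Fin h) × Fin t where
  toFun k := ((k.1, k.2.2), k.2.1)
  invFun p := (p.1.1, p.2, p.1.2)
  left_inv _ := rfl
  right_inv _ := rfl

/-- The ket `U^{⊗ n} φ` as a tripartite ket on `L (Eⁿ D) Bⁿ`. -/
def channelOutput {n : ℕ} (U : Matrix (B × E) (A' × S) ℂ)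
    (φ : L → (Fin n → S) → (Fin n → A') × D → ℂ) : L → (Fin n → E) × D → (Fin n → B) → ℂ :=
  fun l x b => ∑ y : Fin n → A' × S,
    dilationPow U n (b, x.1) y * φ l (fun i => (y i).2) (fun i => (y i).1, x.2)

theorem transpose_submatrix_isometry {Y Q Y' Q' : Type*} [Fintype Y] [Fintype Q] [Fintype Y']
    [Fintype Q'] [DecidableEq Y] [DecidableEq Y'] {T : Matrix Y Q ℂ} (hT : T * Tᴴ = 1)
    (e : Q' ≃ Q) (f : Y' ≃ Y) : (Tᵀ.submatrix e f)ᴴ * Tᵀ.submatrix e f = 1 := by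
  have h : Tᵀᴴ * Tᵀ = (T * Tᴴ)ᵀ := by rw [transpose_mul]; rfl
  rw [conjTranspose_submatrix, submatrix_mul_equiv, h, hT, transpose_one, submatrix_one_equiv]

theorem nsq_padNone {X Z P : Type*} [Fintype X] [Fintype Z] [Fintype P] [DecidableEq X]
    [DecidableEq Z] (M : Matrix X Z ℂ) : nsq (padNone M : Matrix X (Z × Option P) ℂ) = nsq M := by
  simp [nsq, padNone, Fintype.sum_prod_type, Fintype.sum_option]

/-- The grouping of the output systems of the encoder. -/
def encOutEquiv (a h d o : Type*) : (a × h) × (d × o) ≃ (h × (a × d)) × o where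
  toFun p := ((p.1.2, (p.1.1, p.2.1)), p.2.2)
  invFun p := ((p.1.2.1, p.1.1), (p.1.2.2, p.2))
  left_inv _ := rfl
  right_inv _ := rfl

/-- The regrouping of the systems after the encoder. -/
def encRegroup (r t s a h d o : Type*) :
    ((r × t × s) × (a × h)) × ((d × o) × Unit) ≃ ((r × t) × s) × ((h × (a × d)) × o) where
  toFun p := (((p.1.1.1, p.1.1.2.1), p.1.1.2.2), ((p.1.2.2, (p.1.2.1, p.2.1.1)), p.2.1.2))
  invFun p := (((p.1.1.1, p.1.1.2, p.1.2), (p.2.1.2.1, p.2.1.1)), ((p.2.1.2.2, p.2.2), ()))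
  left_inv _ := rfl
  right_inv _ := rfl

/-- The regrouping of the systems after the decoder. -/
def decRegroup (m f o₂ e d o₁ : Type*) :
    (m × m) × ((f × o₂) × (e × ((d × o₁) × Unit))) ≃ (m × (e × d)) × (((m × f) × o₂) × o₁) where
  toFun p := ((p.1.1, (p.2.2.1, p.2.2.2.1.1)), (((p.1.2, p.2.1.1), p.2.1.2), p.2.2.2.1.2))
  invFun p := ((p.1.1, p.2.1.1.1), ((p.2.1.1.2, p.2.1.2), (p.1.2.1, ((p.1.2.2, p.2.2), ()))))
  left_inv _ := rfl
  right_inv _ := rfl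

/-- One-shot coding: if `V` decouples `R B̃` from `Sⁿ` and `R Â` from the environment, then an
encoder and a decoder exist by Uhlmann's theorem. -/
theorem hasCode_of_decoupling [Nonempty L] [Nonempty D] [Nonempty A'] [Nonempty B]
    {N : Matrix (A' × S) (A' × S) ℂ →ₗ[ℂ] Matrix B B ℂ} {n r t h : ℕ}
    (hr : 0 < r) (ht : 0 < t) (hh : 0 < h)
    {U : Matrix (B × E) (A' × S) ℂ} (hU : IsIsometricExtension N U) (ψ : S × S' → ℂ)
    (φ : L → (Fin n → S) → (Fin n → A') × D → ℂ) (V : Matrix (Fin r × Fin t × Fin h) L ℂ)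
    (hψφ : ∀ x x', ∑ y : Fin n → S', (∏ i, ψ (x i, y i)) * star (∏ i, ψ (x' i, y i))
      = ∑ l, ∑ z, φ l x z * star (φ l x' z))
    (hnorm : nsq (splitKet (channelOutput U φ)) = 1)
    {δ₁ δ₂ s : ℝ} (hs : 0 < s) (hs1 : s ≤ 1) (hδ : 2 * δ₁ + 2 * δ₂ ≤ s ^ 2)
    (h₁ : TraceNormLE (codedKet (groupEnc r t h) V φ * (codedKet (groupEnc r t h) V φ)ᴴ
      - refState (Fin r × Fin t) φ) δ₁)
    (h₂ : TraceNormLE (codedKet (groupDec r t h) V (channelOutput U φ) *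
      (codedKet (groupDec r t h) V (channelOutput U φ))ᴴ
      - refState (Fin r × Fin h) (channelOutput U φ)) δ₂) :
    HasCode N ψ n r t h (4 * s) ∧ HasCode N ψ n r t 1 (4 * s) := by
  have : Nonempty (Fin r) := ⟨⟨0, hr⟩⟩
  have : Nonempty (Fin t) := ⟨⟨0, ht⟩⟩
  have : Nonempty (Fin h) := ⟨⟨0, hh⟩⟩
  set θ := channelOutput U φ with hθ
  set κ := codedKet (groupEnc r t h) V φ with hκ
  set ω := codedKet (groupDec r t h) V θ with hω
  -- The initial ket split as `(R B̃ Sⁿ) ⊗ (R' Ã S'ⁿ)`: its second factor is what the encoder holds,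
  -- and its first marginal is exactly the decoupled state.
  set ι : Matrix ((Fin r × Fin t) × (Fin n → S)) (Fin r × Fin t × (Fin n → S')) ℂ :=
    Matrix.of fun p y => inputKet ψ n r t ((p.1.1, p.1.2, p.2), y) () with hι
  have hιι : ι * ιᴴ = refState (Fin r × Fin t) φ := by
    ext ⟨⟨i, j⟩, x⟩ ⟨⟨i', j'⟩, x'⟩
    simp only [mul_apply, conjTranspose_apply, hι, of_apply, inputKet, refState,
      Fintype.sum_prod_type (α₁ := Fin r), Fintype.sum_prod_type (α₁ := Fin t), star_mul',
      star_maxEnt]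
    have e1 : ∀ (k : Fin r) (m : Fin t), ∑ y : Fin n → S',
        maxEnt r i k * maxEnt t j m * (∏ l, ψ (x l, y l)) *
          (maxEnt r i' k * maxEnt t j' m * star (∏ l, ψ (x' l, y l)))
        = (maxEnt r i k * maxEnt t j m) * (maxEnt r i' k * maxEnt t j' m) *
          ∑ l, ∑ z, φ l x z * star (φ l x' z) := fun k m => by
      rw [← hψφ, Finset.mul_sum]
      exact Finset.sum_congr rfl fun y _ => by ring
    simp only [e1]
    simp only [← Finset.sum_mul, maxEnt_mul_maxEnt]
    rw [← Fintype.sum_prod_type' (f := fun k m => (if (i, j) = (k, m) then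
      ((1 / Real.sqrt (Fintype.card (Fin r × Fin t)) : ℝ) : ℂ) else 0) *
      (if (i', j') = (k, m) then
      ((1 / Real.sqrt (Fintype.card (Fin r × Fin t)) : ℝ) : ℂ) else 0))]
    rw [Finset.sum_eq_single (i, j)]
    · by_cases hij : (i, j) = (i', j')
      · rw [if_pos rfl, if_pos hij.symm, if_pos hij, inv_sqrt_mul_self]
      · rw [if_pos rfl, if_neg (Ne.symm hij), if_neg hij, mul_zero, zero_mul]
    · intro q _ hq
      rw [if_neg (Ne.symm hq), zero_mul]
    · simp
  have h₁' : TraceNormLE (ι * ιᴴ - κ * κᴴ) δ₁ := by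
    rw [hιι, ← neg_sub]; exact h₁.neg
  -- `T` becomes the encoder and `T'` the decoder. Uhlmann isometries act on the right, hence the
  -- transposes in `Ve` and `Vd`.
  obtain ⟨T, hT, hTn⟩ := exists_isometry_of_traceNormLE ι κ h₁'
  rw [← refKet_mul_conjTranspose] at h₂
  obtain ⟨T', hT', hTn'⟩ := exists_isometry_of_traceNormLE ω (refKet (Fin r × Fin h) θ) h₂
  set Ve := Tᵀ.submatrix (encOutEquiv (Fin n → A') (Fin h) D
    (Option (Fin r × Fin t × (Fin n → S')))) (Equiv.refl _) with hVe
  set Vd := T'ᵀ.submatrix (Equiv.prodAssoc (Fin r × Fin h) (L × (Fin n → B))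
    (Option (Fin t × (Fin n → B)))).symm (Equiv.prodComm (Fin n → B) (Fin t)) with hVd
  have hVe1 : Veᴴ * Ve = 1 := transpose_submatrix_isometry hT _ _
  have hVd1 : Vdᴴ * Vd = 1 := transpose_submatrix_isometry hT' _ _
  -- In the ideal case both Uhlmann flags are `none` and the leftover systems hold the channel
  -- output `θ`.
  set χ : ((L × (Fin n → B)) × Option (Fin t × (Fin n → B))) ×
      ((Fin n → E) × ((D × Option (Fin r × Fin t × (Fin n → S'))) × Unit)) → ℂ := fun x =>
    if x.1.2 = none ∧ x.2.2.1.2 = none then θ x.1.1.1 (x.2.1, x.2.2.1.1) x.1.1.2 else 0 with hχ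
  have hχn : ∑ x, ‖χ x‖ ^ 2 = 1 := by
    rw [← hnorm]
    simp only [hχ, nsq, splitKet, of_apply, Fintype.sum_prod_type, Fintype.sum_option,
      Finset.univ_unique, Finset.sum_singleton]
    simp only [reduceCtorEq, and_false, and_true, if_true, if_false, norm_zero,
      ne_eq, OfNat.ofNat_ne_zero, not_false_eq_true, zero_pow, Finset.sum_const_zero, add_zero]
    refine Finset.sum_congr rfl fun l _ => ?_
    rw [Finset.sum_comm]
    exact Finset.sum_congr rfl fun e _ => Finset.sum_comm
  suffices hclose : nsq (receiveKet U Vd (pushKet Ve (inputKet ψ n r t)) - Matrix.of fun p x =>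
      maxEnt r p.1.1 p.2.1 * maxEnt h p.1.2 p.2.2 * χ x) ≤ s ^ 2 from
    ⟨hasCode_of_ket_close hr ht hh hU ψ hVe1 hVd1 χ hχn hs hs1 hclose,
      hasCode_one_of_ket_close hr ht hh hU ψ hVe1 hVd1 χ hχn hs hs1 hclose⟩
  -- The ideal encoder output, used as an intermediate point between the actual ket and the target:
  -- one Uhlmann error on each side.
  set κ' : Matrix ((Fin r × Fin t × (Fin n → S)) × ((Fin n → A') × Fin h))
      ((D × Option (Fin r × Fin t × (Fin n → S'))) × Unit) ℂ := Matrix.of fun p q =>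
    if q.1.2 = none then κ ((p.1.1, p.1.2.1), p.1.2.2) (p.2.2, (p.2.1, q.1.1)) else 0 with hκ'
  have g1 : nsq (pushKet Ve (inputKet ψ n r t) - κ') ≤ δ₁ := by
    refine le_trans (le_of_eq ?_) hTn
    refine nsq_eq_of_equiv (encRegroup (Fin r) (Fin t) (Fin n → S) (Fin n → A') (Fin h) D
      (Option (Fin r × Fin t × (Fin n → S')))) ?_
    rintro ⟨⟨⟨i, j, x⟩, ⟨y, k⟩⟩, ⟨⟨d, o⟩, ⟨⟩⟩⟩
    simp only [encRegroup, Equiv.coe_fn_mk, Matrix.sub_apply, pushKet, of_apply, mul_apply, hκ',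
      padNone, hι, hVe, submatrix_apply, transpose_apply, encOutEquiv, Equiv.refl_apply]
    congr 1
    exact Finset.sum_congr rfl fun z _ => mul_comm _ _
  have g2 : nsq (receiveKet U Vd κ' - Matrix.of fun p x =>
      maxEnt r p.1.1 p.2.1 * maxEnt h p.1.2 p.2.2 * χ x) ≤ δ₂ := by
    set G := ω * T' - padNone (refKet (Fin r × Fin h) θ) with hG
    refine le_trans (le_of_eq ?_) hTn'
    rw [← nsq_padNone (P := Fin r × Fin t × (Fin n → S')) G]
    refine nsq_eq_of_equiv (decRegroup (Fin r × Fin h) (L × (Fin n → B))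
      (Option (Fin t × (Fin n → B))) (Fin n → E) D
      (Option (Fin r × Fin t × (Fin n → S')))) ?_
    rintro ⟨⟨⟨i, j⟩, ⟨i', j'⟩⟩, ⟨⟨⟨l, b⟩, o₂⟩, ⟨e, ⟨⟨d, o₁⟩, ⟨⟩⟩⟩⟩⟩
    -- The coding map acts on `L` and the channel on `A' S`, so they commute: transmitting the coded
    -- ket is the same as coding the channel output.
    have hωb : ∀ (k : Fin t) (b' : Fin n → B), ω ((i, j), (e, d)) (k, b')
        = ∑ y : Fin n → A' × S, dilationPow U n (b', e) y *
          κ ((i, k), fun m => (y m).2) (j, (fun m => (y m).1, d)) := fun k b' => by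
      simp only [hω, hκ, codedKet, of_apply, hθ, channelOutput, Finset.mul_sum]
      rw [Finset.sum_comm]
      refine Finset.sum_congr rfl fun y _ => Finset.sum_congr rfl fun l _ => ?_
      rw [mul_left_comm]
      rfl
    simp only [decRegroup, Equiv.coe_fn_mk, padNone, of_apply]
    by_cases ho : o₁ = none
    · rw [if_pos ho, hG, Matrix.sub_apply, Matrix.sub_apply]
      congr 1
      · rw [mul_apply, ← (Equiv.prodComm (Fin n → B) (Fin t)).sum_comp]
        rw [receiveKet, pushKet, of_apply]
        refine Finset.sum_congr rfl fun ⟨b', k⟩ _ => ?_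
        rw [mul_comm]
        refine congrArg₂ (· * ·) ?_ rfl
        rw [Equiv.prodComm_apply, Prod.swap_prod_mk, hωb]
        simp only [submatrix_apply, recEquiv, Equiv.coe_fn_mk, pushKet, of_apply, encEquiv,
          Equiv.refl_apply, hκ', if_pos ho]
      · simp only [of_apply, padNone, refKet, hχ, ho, and_true, maxEnt_mul_maxEnt]
        by_cases ho₂ : o₂ = none <;> simp [ho₂]
    · rw [if_neg ho, Matrix.sub_apply, receiveKet, pushKet, of_apply, of_apply]
      simp [hχ, ho, recEquiv, encEquiv, pushKet, hκ']
  -- Transmission and decoding are isometric, so the encoder error passes through unchanged and the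
  -- total is `2 * δ₁ + 2 * δ₂`.
  have g3 := nsq_add_le (receiveKet U Vd (pushKet Ve (inputKet ψ n r t)) - receiveKet U Vd κ')
    (receiveKet U Vd κ' - Matrix.of fun p x =>
      maxEnt r p.1.1 p.2.1 * maxEnt h p.1.2 p.2.2 * χ x)
  rw [sub_add_sub_cancel, receiveKet_sub, nsq_receiveKet hU.1 hVd1] at g3
  linarith

end OneShot

/-! ### Existence of codes for large block length. -/

section Coding

variable {A A' S S' B E D : Type*} [Fintype A] [DecidableEq A]
  [Fintype A'] [DecidableEq A'] [Fintype S] [DecidableEq S]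
  [Fintype S'] [DecidableEq S'] [Fintype B] [DecidableEq B] [Fintype E] [DecidableEq E]
  [Fintype D] [DecidableEq D]

/-- The purification of `σ` as a tripartite ket on `A S (A' D)`. -/
def senderKet (v : (A × A' × S) × D → ℂ) : A → S → A' × D → ℂ := fun a s z => v ((a, z.1, s), z.2)

/-- The channel output as a tripartite ket on `A (E D) B`. -/
def receiverKet (U : Matrix (B × E) (A' × S) ℂ) (v : (A × A' × S) × D → ℂ) :
    A → E × D → B → ℂ := fun a x b => outputKet U v (b, (a, x))

theorem nonempty_of_nsq_eq_one {X Y : Type*} [Fintype X] [Fintype Y] {M : Matrix X Y ℂ}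
    (h : nsq M = 1) : Nonempty X ∧ Nonempty Y := by
  constructor
  · by_contra h0
    rw [not_nonempty_iff] at h0
    simp [nsq] at h
  · by_contra h0
    rw [not_nonempty_iff] at h0
    simp [nsq] at h

theorem nsq_receiverKet {U : Matrix (B × E) (A' × S) ℂ} (hU : Uᴴ * U = 1)
    (v : (A × A' × S) × D → ℂ) :
    nsq (splitKet (receiverKet U v)) = nsq (splitKet (senderKet v)) := by
  set κ : Matrix (A × (A' × S)) D ℂ := Matrix.of fun p d => v (p, d) with hκ
  have h1 : nsq (splitKet (receiverKet U v)) = nsq (pushKet U κ) := by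
    refine nsq_eq_of_equiv
      { toFun := fun p => ((p.1.1, p.2), p.1.2)
        invFun := fun p => ((p.1.1, p.2), p.1.2)
        left_inv := fun _ => rfl
        right_inv := fun _ => rfl } fun p => rfl
  have h2 : nsq (splitKet (senderKet v)) = nsq κ := by
    refine nsq_eq_of_equiv
      { toFun := fun p => ((p.1.1, p.2.1, p.1.2), p.2.2)
        invFun := fun p => ((p.1.1, p.1.2.2), (p.1.2.1, p.2))
        left_inv := fun _ => rfl
        right_inv := fun _ => rfl } fun p => rfl
  rw [h1, h2, nsq_pushKet hU]

theorem channelOutput_ketPow (U : Matrix (B × E) (A' × S) ℂ) (v : (A × A' × S) × D → ℂ) (n : ℕ) :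
    channelOutput U (fun a x z => ketPow (senderKet v) n a (Equiv.refl (Fin n → S) x)
      ((Equiv.arrowProdEquivProdArrow (Fin n) (fun _ => A') (fun _ => D)).symm z))
    = fun a x b => ketPow (receiverKet U v) n a
      ((Equiv.arrowProdEquivProdArrow (Fin n) (fun _ => E) (fun _ => D)).symm x)
      (Equiv.refl (Fin n → B) b) := by
  funext a x b
  simp only [channelOutput, ketPow, dilationPow, of_apply, ← Finset.prod_mul_distrib]
  have h := sum_prod_pi (n := n) (fun i y => U (b i, x.1 i) y * v ((a i, y), x.2 i))
  exact h

theorem HasCode.mono {N : Matrix (A' × S) (A' × S) ℂ →ₗ[ℂ] Matrix B B ℂ} {ψ : S × S' → ℂ}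
    {n r t h : ℕ} {ε ε' : ℝ} (hc : HasCode N ψ n r t h ε) (hε : ε ≤ ε') :
    HasCode N ψ n r t h ε' := by
  obtain ⟨g1, g2, g3, enc, dec, g4, g5, g6⟩ := hc
  exact ⟨g1, g2, g3, enc, dec, g4, g5, g6.trans hε⟩

/-- Codes exist at all rates strictly inside the region `q + τ - η < H(A|S)`,
`q + η - τ < H(A|ED)`. -/
theorem eventually_hasCode {N : Matrix (A' × S) (A' × S) ℂ →ₗ[ℂ] Matrix B B ℂ}
    {U : Matrix (B × E) (A' × S) ℂ} (hU : IsIsometricExtension N U) (ψ : S × S' → ℂ)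
    (v : (A × A' × S) × D → ℂ) (hv : nsq (splitKet (senderKet v)) = 1)
    (hS : sideKet (senderKet v) * (sideKet (senderKet v))ᴴ = traceSnd (proj ψ))
    {δ ε : ℝ} (hδ : 0 < δ) (hε : 0 < ε) :
    ∀ᶠ n : ℕ in atTop, ∀ r t h : ℕ, 0 < r → 0 < t → 0 < h →
      ((r * t : ℕ) : ℝ) ≤ h * 2 ^ (n *
        (entropy (splitKet (senderKet v) * (splitKet (senderKet v))ᴴ) -
          entropy (sideKet (senderKet v) * (sideKet (senderKet v))ᴴ) - δ)) →
      ((r * h : ℕ) : ℝ) ≤ t * 2 ^ (n *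
        (entropy (splitKet (receiverKet U v) * (splitKet (receiverKet U v))ᴴ) -
          entropy (sideKet (receiverKet U v) * (sideKet (receiverKet U v))ᴴ) - δ)) →
      HasCode N ψ n r t h ε ∧ HasCode N ψ n r t 1 ε := by
  have hv' : nsq (splitKet (receiverKet U v)) = 1 := by rw [nsq_receiverKet hU.1, hv]
  obtain ⟨⟨a0, s0⟩, ⟨a0', d0⟩⟩ :=
    (⟨Classical.choice (nonempty_of_nsq_eq_one hv).1, Classical.choice
      (nonempty_of_nsq_eq_one hv).2⟩ : (A × S) × (A' × D))
  have : Nonempty A := ⟨a0⟩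
  have : Nonempty A' := ⟨a0'⟩
  have : Nonempty D := ⟨d0⟩
  have : Nonempty B := (nonempty_of_nsq_eq_one hv').2
  -- The code error is `4 * u`. Each decoupling error averages at most `5 * s`, so `s = u ^ 2 / 20`
  -- makes twice their sum equal to `u ^ 2`.
  set u := min (ε / 4) 1 with hu
  have hu0 : 0 < u := lt_min (by positivity) one_pos
  set s := u ^ 2 / 20 with hs
  have hs0 : 0 < s := by positivity
  filter_upwards [eventually_exists_decoupling_bound (senderKet v) hv
      (fun n => Equiv.refl (Fin n → S))
      (fun n => (Equiv.arrowProdEquivProdArrow (Fin n) (fun _ => A') (fun _ => D)).symm) hδ hs0,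
    eventually_exists_decoupling_bound (receiverKet U v) hv'
      (fun n => (Equiv.arrowProdEquivProdArrow (Fin n) (fun _ => E) (fun _ => D)).symm)
      (fun n => Equiv.refl (Fin n → B)) hδ hs0] with n h1 h2 r t h hr ht hh c1 c2
  have : Nonempty (Fin r) := ⟨⟨0, hr⟩⟩
  have : Nonempty (Fin t) := ⟨⟨0, ht⟩⟩
  have : Nonempty (Fin h) := ⟨⟨0, hh⟩⟩
  obtain ⟨F₁, hF₁, hF₁'⟩ := h1 _ _ _ (groupEnc r t h) (by simpa using c1)
  obtain ⟨F₂, hF₂, hF₂'⟩ := h2 _ _ _ (groupDec r t h) (by simpa using c2)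
  -- One and the same coding map must serve both decoupling conditions, so the sum of the two errors
  -- is averaged.
  obtain ⟨x, hx⟩ := exists_le_avg (fun x => F₁ x + F₂ x)
  rw [avg_add] at hx
  have hcode := hasCode_of_decoupling hr ht hh hU ψ
    (fun a x z => ketPow (senderKet v) n a (Equiv.refl (Fin n → S) x)
      ((Equiv.arrowProdEquivProdArrow (Fin n) (fun _ => A') (fun _ => D)).symm z))
    (phaseMatrix x) ?_ ?_ hu0 (min_le_right _ _) (δ₁ := F₁ x) (δ₂ := F₂ x) ?_ (hF₁' x) ?_
  · have huε : 4 * u ≤ ε := by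
      have := min_le_left (ε / 4) 1
      linarith
    exact ⟨hcode.1.mono huε, hcode.2.mono huε⟩
  · intro y y'
    have e1 : ∑ l, ∑ z, (fun a x z => ketPow (senderKet v) n a (Equiv.refl (Fin n → S) x)
        ((Equiv.arrowProdEquivProdArrow (Fin n) (fun _ => A') (fun _ => D)).symm z)) l y z *
        star ((fun a x z => ketPow (senderKet v) n a (Equiv.refl (Fin n → S) x)
        ((Equiv.arrowProdEquivProdArrow (Fin n) (fun _ => A') (fun _ => D)).symm z)) l y' z)
        = (sideKet (ketPow (senderKet v) n) * (sideKet (ketPow (senderKet v) n))ᴴ) y y' := by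
      rw [mul_apply, Fintype.sum_prod_type]
      refine Finset.sum_congr rfl fun l _ => ?_
      exact (Equiv.arrowProdEquivProdArrow (Fin n) (fun _ => A') (fun _ => D)).symm.sum_comp
        fun z => ketPow (senderKet v) n l y z * star (ketPow (senderKet v) n l y' z)
    rw [e1, sideKet_ketPow, conjTranspose_submatrix, submatrix_mul_equiv, ← tpow_conjTranspose,
      ← tpow_mul, hS]
    simp only [submatrix_apply, Equiv.refl_apply, tpow, of_apply, traceSnd, proj]
    rw [← sum_prod_pi (fun i k => ψ (y i, k) * star (ψ (y' i, k)))]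
    refine Finset.sum_congr rfl fun k _ => ?_
    rw [Finset.prod_mul_distrib, star_prod]
  · rw [channelOutput_ketPow]
    have e1 : splitKet (fun a x b => ketPow (receiverKet U v) n a
        ((Equiv.arrowProdEquivProdArrow (Fin n) (fun _ => E) (fun _ => D)).symm x)
        (Equiv.refl (Fin n → B) b)) = (splitKet (ketPow (receiverKet U v) n)).submatrix
        (Equiv.prodCongr (Equiv.refl _)
          (Equiv.arrowProdEquivProdArrow (Fin n) (fun _ => E) (fun _ => D)).symm)
        (Equiv.refl _) := rfl
    rw [e1, nsq_submatrix_equiv, nsq_ketPow _ hv']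
  · rw [hs] at hF₁ hF₂
    linarith
  · rw [channelOutput_ketPow]
    exact hF₂' x

end Coding

/-! ### Rounding of dimensions and diagonal choice of codes. -/

section Rates

theorem floor_rpow_bounds {x : ℝ} (hx : 0 ≤ x) (n : ℕ) :
    0 < ⌊(2 : ℝ) ^ (n * x)⌋₊ ∧ (⌊(2 : ℝ) ^ (n * x)⌋₊ : ℝ) ≤ 2 ^ (n * x) ∧
      (2 : ℝ) ^ (n * x) ≤ 2 * ⌊(2 : ℝ) ^ (n * x)⌋₊ := by
  have h1 : (1 : ℝ) ≤ 2 ^ (n * x) := Real.one_le_rpow one_le_two (by positivity)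
  have h2 : 0 < ⌊(2 : ℝ) ^ (n * x)⌋₊ := Nat.floor_pos.2 h1
  refine ⟨h2, Nat.floor_le (by positivity), ?_⟩
  have h3 := Nat.lt_floor_add_one ((2 : ℝ) ^ (n * x))
  have h4 : (1 : ℝ) ≤ ⌊(2 : ℝ) ^ (n * x)⌋₊ := by exact_mod_cast h2
  linarith

theorem abs_logb_floor_sub_le {x : ℝ} (hx : 0 ≤ x) {n : ℕ} (hn : 0 < n) :
    |Real.logb 2 ⌊(2 : ℝ) ^ (n * x)⌋₊ / n - x| ≤ 1 / n := by
  obtain ⟨h1, h2, h3⟩ := floor_rpow_bounds hx n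
  have h1' : (0 : ℝ) < ⌊(2 : ℝ) ^ (n * x)⌋₊ := by exact_mod_cast h1
  have hn' : (0 : ℝ) < n := by exact_mod_cast hn
  have h4 : Real.logb 2 ⌊(2 : ℝ) ^ (n * x)⌋₊ ≤ n * x := by
    rw [Real.logb_le_iff_le_rpow one_lt_two h1']
    exact h2
  have h5 : n * x - 1 ≤ Real.logb 2 ⌊(2 : ℝ) ^ (n * x)⌋₊ := by
    rw [Real.le_logb_iff_rpow_le one_lt_two h1', Real.rpow_sub two_pos, Real.rpow_one]
    linarith
  have h6 : Real.logb 2 ⌊(2 : ℝ) ^ (n * x)⌋₊ / n - x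
      = (Real.logb 2 ⌊(2 : ℝ) ^ (n * x)⌋₊ - n * x) / n := by field_simp
  rw [h6, abs_div, abs_of_pos hn']
  gcongr
  rw [abs_le]
  constructor <;> linarith

/-- Rounding down on the right loses at most a factor 2, which one of the two units of slack `δ`
absorbs once `n * δ ≥ 1`; the other is left for the decoupling bound. -/
theorem floor_mul_floor_le {x y z c δ : ℝ} (hx : 0 ≤ x) (hy : 0 ≤ y) (hz : 0 ≤ z) {n : ℕ}
    (hn : 1 ≤ n * δ) (h : x + y - z + 2 * δ ≤ c) :
    ((⌊(2 : ℝ) ^ (n * x)⌋₊ * ⌊(2 : ℝ) ^ (n * y)⌋₊ : ℕ) : ℝ)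
      ≤ ⌊(2 : ℝ) ^ (n * z)⌋₊ * 2 ^ (n * (c - δ)) := by
  obtain ⟨-, hx2, -⟩ := floor_rpow_bounds hx n
  obtain ⟨-, hy2, -⟩ := floor_rpow_bounds hy n
  obtain ⟨-, -, hz3⟩ := floor_rpow_bounds hz n
  have hn0 : (0 : ℝ) ≤ n := Nat.cast_nonneg n
  push_cast
  calc (⌊(2 : ℝ) ^ (n * x)⌋₊ : ℝ) * ⌊(2 : ℝ) ^ (n * y)⌋₊
      ≤ 2 ^ (n * x) * 2 ^ (n * y) := by gcongr
    _ = 2 ^ (n * (x + y)) := by rw [← Real.rpow_add two_pos]; congr 1; ring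
    _ ≤ 2 ^ (n * z - 1 + n * (c - δ)) := by
        refine Real.rpow_le_rpow_of_exponent_le one_le_two ?_
        nlinarith
    _ = 2 ^ (n * z) / 2 * 2 ^ (n * (c - δ)) := by
        rw [Real.rpow_add two_pos, Real.rpow_sub two_pos, Real.rpow_one]
    _ ≤ ⌊(2 : ℝ) ^ (n * z)⌋₊ * 2 ^ (n * (c - δ)) := by
        refine mul_le_mul_of_nonneg_right ?_ (by positivity)
        linarith

/-- Codes that approximate a rate triple arbitrarily well for large block lengths can be combined
into one sequence. -/
theorem exists_code_sequence (code : ℕ → ℕ → ℕ → ℕ → ℝ → Prop) (hcode : ∀ n, code n 1 1 1 4)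
    (q x y : ℝ)
    (h : ∀ m : ℕ, ∀ᶠ n : ℕ in atTop, ∃ r t h : ℕ, code n r t h (1 / (m + 1)) ∧
      |Real.logb 2 r / n - q| ≤ 1 / (m + 1) ∧ |Real.logb 2 t / n - x| ≤ 1 / (m + 1) ∧
      |Real.logb 2 h / n - y| ≤ 1 / (m + 1)) :
    ∃ (r t h : ℕ → ℕ) (ε : ℕ → ℝ), (∀ n, code n (r n) (t n) (h n) (ε n)) ∧
      Tendsto ε atTop (𝓝 0) ∧
      Tendsto (fun n => Real.logb 2 (r n) / n) atTop (𝓝 q) ∧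
      Tendsto (fun n => Real.logb 2 (t n) / n) atTop (𝓝 x) ∧
      Tendsto (fun n => Real.logb 2 (h n) / n) atTop (𝓝 y) := by
  set P : ℕ → ℕ → Prop := fun m n => ∃ r t h : ℕ, code n r t h (1 / (m + 1)) ∧
      |Real.logb 2 r / n - q| ≤ 1 / (m + 1) ∧ |Real.logb 2 t / n - x| ≤ 1 / (m + 1) ∧
      |Real.logb 2 h / n - y| ≤ 1 / (m + 1) with hP
  have hex : ∀ n, ∃ (r t h : ℕ) (ε : ℝ), code n r t h ε ∧ ∀ m, m ≤ n → P m n →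
      |ε - 0| ≤ 1 / (m + 1) ∧
      |Real.logb 2 r / n - q| ≤ 1 / (m + 1) ∧ |Real.logb 2 t / n - x| ≤ 1 / (m + 1) ∧
      |Real.logb 2 h / n - y| ≤ 1 / (m + 1) := fun n => by
    classical
    by_cases hm : ∃ m, m ≤ n ∧ P m n
    · obtain ⟨m₀, hm₀, hPm₀⟩ := hm
      -- At block length `n` the most accurate available code with `m ≤ n` is taken; the fallback
      -- code of error 4 serves only when there is none.
      obtain ⟨r, t, h, h1, h2, h3, h4⟩ := Nat.findGreatest_spec (P := fun m => P m n) hm₀ hPm₀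
      refine ⟨r, t, h, _, h1, fun m hmn hPm => ?_⟩
      have hle : m ≤ Nat.findGreatest (fun m => P m n) n := Nat.le_findGreatest hmn hPm
      have hle' : (1 : ℝ) / ((Nat.findGreatest (fun m => P m n) n : ℕ) + 1) ≤ 1 / (m + 1) := by
        gcongr
      refine ⟨?_, h2.trans hle', h3.trans hle', h4.trans hle'⟩
      rw [sub_zero, abs_of_pos (by positivity)]
      exact hle'
    · exact ⟨1, 1, 1, 4, hcode n, fun m hmn hPm => absurd ⟨m, hmn, hPm⟩ hm⟩
  choose r t h' ε hc hb using hex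
  have htend : ∀ (f : ℕ → ℝ) (l : ℝ), (∀ n m, m ≤ n → P m n → |f n - l| ≤ 1 / (m + 1)) →
      Tendsto f atTop (𝓝 l) := fun f l hf => by
    rw [Metric.tendsto_nhds]
    intro e he
    obtain ⟨m, hm⟩ := exists_nat_one_div_lt he
    filter_upwards [h m, eventually_ge_atTop m] with n hn hmn
    rw [Real.dist_eq]
    exact (hf n m hmn hn).trans_lt hm
  exact ⟨r, t, h', ε, hc, htend _ _ fun n m h1 h2 => (hb n m h1 h2).1,
    htend _ _ fun n m h1 h2 => (hb n m h1 h2).2.1,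
    htend _ _ fun n m h1 h2 => (hb n m h1 h2).2.2.1,
    htend _ _ fun n m h1 h2 => (hb n m h1 h2).2.2.2⟩

end Rates

/-! ### Achievability on the closed rate region. -/

section Achievability

variable {A A' S S' B E D : Type*} [Fintype A] [DecidableEq A]
  [Fintype A'] [DecidableEq A'] [Fintype S] [DecidableEq S]
  [Fintype S'] [DecidableEq S'] [Fintype B] [DecidableEq B] [Fintype E] [DecidableEq E]
  [Fintype D] [DecidableEq D]

/-- An isometry into any nonempty system together with a copy of the input. -/
theorem exists_isometry_pair (a b : Type*) [Fintype a] [DecidableEq a] [Fintype b] [DecidableEq b]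
    [Nonempty b] : ∃ V : Matrix (b × a) a ℂ, Vᴴ * V = 1 := by
  obtain ⟨y⟩ := ‹Nonempty b›
  refine ⟨Matrix.of fun p x => if p = (y, x) then 1 else 0, ?_⟩
  ext x x'
  simp only [mul_apply, conjTranspose_apply, of_apply]
  rw [Finset.sum_eq_single (y, x)]
  · by_cases h : x = x'
    · subst h
      simp
    · simp [h]
  · intro p _ hp
    simp [hp]
  · simp

/-- Nothing can be sent perfectly. -/
theorem hasCode_trivial [Nonempty A'] {N : Matrix (A' × S) (A' × S) ℂ →ₗ[ℂ] Matrix B B ℂ}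
    {U : Matrix (B × E) (A' × S) ℂ} (hU : IsIsometricExtension N U) {ψ : S × S' → ℂ}
    (hψ : IsKet ψ) (n : ℕ) {s : ℝ} (hs : 0 < s) (hs1 : s ≤ 1) :
    HasCode N ψ n 1 1 1 (4 * s) := by
  obtain ⟨Ve, hVe⟩ := exists_isometry_pair (Fin 1 × Fin 1 × (Fin n → S')) ((Fin n → A') × Fin 1)
  obtain ⟨Vd, hVd⟩ := exists_isometry_pair ((Fin n → B) × Fin 1) (Fin 1 × Fin 1)
  have hm : ∀ i j : Fin 1, maxEnt 1 i j = 1 := fun i j => by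
    simp [maxEnt, Subsingleton.elim i j]
  set Ω := receiveKet U Vd (pushKet Ve (inputKet ψ n 1 1)) with hΩ
  have hι : nsq (inputKet ψ n 1 1) = 1 := by
    have h1 : nsq (inputKet ψ n 1 1) = nsq (tpow (Matrix.of fun x y => ψ (x, y)) n) := by
      refine nsq_eq_of_equiv
        { toFun := fun p => (p.1.1.2.2, p.1.2.2.2)
          invFun := fun p => (((0, 0, p.1), (0, 0, p.2)), ())
          left_inv := fun p => by
            obtain ⟨⟨⟨i, j, x⟩, ⟨i', j', x'⟩⟩, ⟨⟩⟩ := p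
            rw [Subsingleton.elim i 0, Subsingleton.elim j 0, Subsingleton.elim i' 0,
              Subsingleton.elim j' 0]
          right_inv := fun _ => rfl } fun p => ?_
      simp [inputKet, hm, tpow]
    have h2 : nsq (Matrix.of fun x y => ψ (x, y)) = 1 := by
      rw [← hψ, Fintype.sum_prod_type]
      rfl
    rw [h1, nsq_tpow, h2, one_pow]
  have hΩ1 : nsq Ω = 1 := by rw [hΩ, nsq_receiveKet hU.1 hVd, nsq_pushKet hVe, hι]
  refine hasCode_of_ket_close one_pos one_pos one_pos hU ψ hVe hVd (fun x => Ω ((0, 0), (0, 0)) x)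
    ?_ hs hs1 ?_
  · rw [← hΩ1]
    exact (Fintype.sum_eq_single (f := fun p => ∑ x, ‖Ω p x‖ ^ 2) ((0, 0), (0, 0))
      fun p hp => absurd (Subsingleton.elim _ _) hp).symm
  · have : Ω - (Matrix.of fun p x => maxEnt 1 p.1.1 p.2.1 * maxEnt 1 p.1.2 p.2.2 *
        Ω ((0, 0), (0, 0)) x) = 0 := by
      ext p x
      rw [Subsingleton.elim p ((0, 0), (0, 0))]
      simp [hm]
    rw [this]
    simp [nsq]
    positivity

/-- Boundary points are included because `q` may be lowered slightly, which relaxes both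
inequalities at once. When `x = 0` no entanglement is consumed, and discarding the entanglement
returned at rate `y` leaves an unassisted code. -/
theorem achievable_of_region {N : Matrix (A' × S) (A' × S) ℂ →ₗ[ℂ] Matrix B B ℂ}
    {U : Matrix (B × E) (A' × S) ℂ} (hU : IsIsometricExtension N U) {ψ : S × S' → ℂ}
    (hψ : IsKet ψ)
    (v : (A × A' × S) × D → ℂ) (hv : nsq (splitKet (senderKet v)) = 1)
    (hS : sideKet (senderKet v) * (sideKet (senderKet v))ᴴ = traceSnd (proj ψ))
    {q x y : ℝ} (hq : 0 < q) (hx : 0 ≤ x) (hy : 0 ≤ y)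
    (h₁ : q + x - y ≤ entropy (splitKet (senderKet v) * (splitKet (senderKet v))ᴴ) -
          entropy (sideKet (senderKet v) * (sideKet (senderKet v))ᴴ))
    (h₂ : q + y - x ≤ entropy (splitKet (receiverKet U v) * (splitKet (receiverKet U v))ᴴ) -
          entropy (sideKet (receiverKet U v) * (sideKet (receiverKet U v))ᴴ)) :
    AchievableWithEntanglement N ψ q x y ∧ (x = 0 → UnassistedAchievable N ψ q) := by
  have : Nonempty A' := (nonempty_prod.1 (nonempty_of_nsq_eq_one hv).2).1
  have hmain : ∀ m : ℕ, ∀ᶠ n : ℕ in atTop, ∃ r : ℕ,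
      (HasCode N ψ n r ⌊(2 : ℝ) ^ (n * x)⌋₊ ⌊(2 : ℝ) ^ (n * y)⌋₊ (1 / (m + 1)) ∧
        HasCode N ψ n r ⌊(2 : ℝ) ^ (n * x)⌋₊ 1 (1 / (m + 1))) ∧
      |Real.logb 2 r / n - q| ≤ 1 / (m + 1) ∧
      |Real.logb 2 ⌊(2 : ℝ) ^ (n * x)⌋₊ / n - x| ≤ 1 / (m + 1) ∧
      |Real.logb 2 ⌊(2 : ℝ) ^ (n * y)⌋₊ / n - y| ≤ 1 / (m + 1) := fun m => by
    -- Codes are built at rate `q - d`, with slack `d / 2` for decoupling and `d / 2` for rounding.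
    -- The bound by `q` keeps the rate nonnegative; the shift and the rounding error `1 / n ≤ d`
    -- together stay within `1 / (m + 1)`.
    set d := min (1 / ((m : ℝ) + 1)) q / 2 with hd
    have hm0 : (0 : ℝ) < 1 / (m + 1) := by positivity
    have hd0 : 0 < d := by
      have := lt_min hm0 hq
      positivity
    have hd1 : 2 * d ≤ 1 / (m + 1) := by
      have := min_le_left (1 / ((m : ℝ) + 1)) q
      linarith
    have hd2 : 2 * d ≤ q := by
      have := min_le_right (1 / ((m : ℝ) + 1)) q
      linarith
    obtain ⟨n₀, hn₀⟩ := exists_nat_gt (2 / d)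
    filter_upwards [eventually_hasCode hU ψ v hv hS (by positivity : 0 < d / 2) hm0,
      eventually_ge_atTop (max n₀ 1)] with n hn hnn
    have hn1 : 0 < n := (le_max_right n₀ 1).trans hnn
    have hn' : (0 : ℝ) < n := by exact_mod_cast hn1
    have hnd : 2 / d ≤ n := hn₀.le.trans (by exact_mod_cast (le_max_left n₀ 1).trans hnn)
    have hnd' : 2 ≤ n * d := by rwa [div_le_iff₀ hd0] at hnd
    have hninv : 1 / (n : ℝ) ≤ d := by rw [div_le_iff₀ hn']; linarith
    have hqd : 0 ≤ q - d := by linarith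
    refine ⟨⌊(2 : ℝ) ^ (n * (q - d))⌋₊, ?_, ?_, ?_, ?_⟩
    · refine hn _ _ _ (floor_rpow_bounds hqd n).1 (floor_rpow_bounds hx n).1
        (floor_rpow_bounds hy n).1 ?_ ?_
      · exact floor_mul_floor_le hqd hx hy (by linarith) (by linarith)
      · exact floor_mul_floor_le hqd hy hx (by linarith) (by linarith)
    · have h1 := abs_logb_floor_sub_le hqd hn1
      rw [abs_le] at h1 ⊢
      constructor <;> linarith
    · exact (abs_logb_floor_sub_le hx hn1).trans (by linarith)
    · exact (abs_logb_floor_sub_le hy hn1).trans (by linarith)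
  have htriv : ∀ n, HasCode N ψ n 1 1 1 4 := fun n => by
    simpa using hasCode_trivial hU hψ n one_pos le_rfl
  refine ⟨?_, fun hx0 => ?_⟩
  · refine exists_code_sequence (fun n r t h ε => HasCode N ψ n r t h ε) htriv q x y fun m => ?_
    filter_upwards [hmain m] with n hn
    obtain ⟨r, hr, h3⟩ := hn
    exact ⟨r, _, _, hr.1, h3⟩
  · obtain ⟨r, t, h, ε, hc, hε, hrq, -, -⟩ := exists_code_sequence
      (fun n r t h ε => HasCode N ψ n r t h ε ∧ t = 1 ∧ h = 1) (fun n => ⟨htriv n, rfl, rfl⟩) q 0 0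
      fun m => by
        filter_upwards [hmain m] with n hn
        obtain ⟨r, hr, h3, -, -⟩ := hn
        refine ⟨r, 1, 1, ⟨?_, rfl, rfl⟩, h3, ?_, ?_⟩
        · have := hr.2
          rw [hx0] at this
          simpa using this
        · simp; positivity
        · simp; positivity
    refine ⟨r, ε, fun n => ?_, hε, hrq⟩
    obtain ⟨h1, h2, h3⟩ := hc n
    rwa [h2, h3] at h1

theorem unassistedAchievable_zero [Nonempty A']
    {N : Matrix (A' × S) (A' × S) ℂ →ₗ[ℂ] Matrix B B ℂ}
    {U : Matrix (B × E) (A' × S) ℂ} (hU : IsIsometricExtension N U) {ψ : S × S' → ℂ}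
    (hψ : IsKet ψ) : UnassistedAchievable N ψ 0 := by
  refine ⟨fun _ => 1, fun n => 4 * (1 / ((n : ℝ) + 1)), fun n => ?_, ?_, ?_⟩
  · refine hasCode_trivial hU hψ n (by positivity) ?_
    rw [div_le_one (by positivity)]
    have : (0 : ℝ) ≤ n := Nat.cast_nonneg n
    linarith
  · simpa using tendsto_one_div_add_atTop_nhds_zero_nat.const_mul (4 : ℝ)
  · simp

end Achievability

/-! ### Purifications and entropy identities for the channel output. -/

section Identities

variable {A A' S S' B E D : Type*} [Fintype A] [DecidableEq A]
  [Fintype A'] [DecidableEq A'] [Fintype S] [DecidableEq S]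
  [Fintype S'] [DecidableEq S'] [Fintype B] [DecidableEq B] [Fintype E] [DecidableEq E]
  [Fintype D] [DecidableEq D]

theorem exists_isometricExtension {N : Matrix (A' × S) (A' × S) ℂ →ₗ[ℂ] Matrix B B ℂ}
    (hN : IsChannel N) : ∃ (k : ℕ) (U : Matrix (B × Fin k) (A' × S) ℂ),
      IsIsometricExtension N U := by
  obtain ⟨k, K, hK, hNK⟩ := hN
  refine ⟨k, Matrix.of fun p x => K p.2 p.1 x, ?_, fun X => ?_⟩
  · rw [← hK]
    ext i j
    simp only [Matrix.sum_apply, mul_apply, conjTranspose_apply, of_apply, Fintype.sum_prod_type]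
    exact Finset.sum_comm
  · rw [hNK, traceSnd_dilation_eq_sum]
    rfl

theorem exists_purification {σ : Matrix A A ℂ} (hσ : IsState σ) :
    ∃ v : A × A → ℂ, traceSnd (proj v) = σ := by
  obtain ⟨G, hG, hGG⟩ := exists_hermitian_sqrt hσ.1
  refine ⟨fun p => G p.1 p.2, ?_⟩
  rw [← hGG]
  conv_rhs => rw [← hG]
  ext i j
  simp only [traceSnd, proj, of_apply, mul_apply]
  conv_rhs => rw [hG]
  refine Finset.sum_congr rfl fun k _ => ?_
  rw [← conjTranspose_apply, hG]

theorem isState_reduced {X Y : Type*} [Fintype X] [Fintype Y] {M : Matrix X Y ℂ}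
    (hM : nsq M = 1) : IsState (M * Mᴴ) :=
  ⟨posSemidef_self_mul_conjTranspose M, by rw [trace_mul_conjTranspose_self, hM]; simp⟩

variable {σ : Matrix (A × A' × S) (A × A' × S) ℂ} {v : (A × A' × S) × D → ℂ}

theorem senderKet_split_reduced (hv : traceSnd (proj v) = σ) :
    splitKet (senderKet v) * (splitKet (senderKet v))ᴴ = traceMid σ := by
  subst hv
  ext p q
  simp only [mul_apply, conjTranspose_apply, splitKet, senderKet, of_apply, traceMid, traceSnd,
    proj, Fintype.sum_prod_type]

theorem sideKet_reduced {X Z : Type*} [Fintype X] [Fintype Z] (w : A → X → Z → ℂ) :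
    sideKet w * (sideKet w)ᴴ = traceFst (splitKet w * (splitKet w)ᴴ) := by
  ext x y
  simp only [mul_apply, conjTranspose_apply, splitKet, sideKet, of_apply, traceFst,
    Fintype.sum_prod_type]

theorem traceFst_traceMid (σ : Matrix (A × A' × S) (A × A' × S) ℂ) :
    traceFst (traceMid σ) = traceFst (traceFst σ) := by
  ext x y
  simp only [traceFst, traceMid, of_apply]
  exact Finset.sum_comm

theorem nsq_senderKet (hσ : IsState σ) (hv : traceSnd (proj v) = σ) :
    nsq (splitKet (senderKet v)) = 1 := by
  rw [nsq_eq_re_trace, senderKet_split_reduced hv]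
  have : (traceMid σ).trace = σ.trace := by
    simp only [trace, diag_apply, traceMid, of_apply, Fintype.sum_prod_type]
    exact Finset.sum_congr rfl fun a _ => Finset.sum_comm
  rw [this, hσ.2]
  simp

theorem receiverKet_split_reduced (U : Matrix (B × E) (A' × S) ℂ) :
    traceFst (proj (outputKet U v)) =
      splitKet (receiverKet U v) * (splitKet (receiverKet U v))ᴴ := by
  ext x y
  simp only [traceFst, proj, of_apply, mul_apply, conjTranspose_apply, splitKet, receiverKet]

theorem applySnd_eq_receiverKet {N : Matrix (A' × S) (A' × S) ℂ →ₗ[ℂ] Matrix B B ℂ}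
    {U : Matrix (B × E) (A' × S) ℂ} (hU : IsIsometricExtension N U)
    (hv : traceSnd (proj v) = σ) :
    applySnd N σ = (sideKet (receiverKet U v))ᵀ * (sideKet (receiverKet U v))ᵀᴴ := by
  have h1 : σ = (Matrix.of fun p d => v (p, d) : Matrix (A × (A' × S)) D ℂ) *
      (Matrix.of fun p d => v (p, d) : Matrix (A × (A' × S)) D ℂ)ᴴ := by
    rw [← hv]
    ext p q
    simp only [traceSnd, proj, of_apply, mul_apply, conjTranspose_apply]
  rw [h1, applySnd_reduced hU.2]
  rfl

/-- `H(B) = H(AED)` and `H(AB) = H(ED)` for the channel output, and the marginals on `A` agree. -/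
theorem output_entropies {N : Matrix (A' × S) (A' × S) ℂ →ₗ[ℂ] Matrix B B ℂ}
    {U : Matrix (B × E) (A' × S) ℂ} (hU : IsIsometricExtension N U)
    (hv : traceSnd (proj v) = σ) :
    entropy (applySnd N σ) = entropy (sideKet (receiverKet U v) * (sideKet (receiverKet U v))ᴴ) ∧
    entropy (traceFst (applySnd N σ)) =
      entropy (splitKet (receiverKet U v) * (splitKet (receiverKet U v))ᴴ) ∧
    traceSnd (applySnd N σ) = traceSnd (traceMid σ) ∧
    traceSnd (traceFst (proj (outputKet U v))) = traceSnd (traceMid σ) := by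
  have hA : traceSnd (applySnd N σ) = traceSnd (traceMid σ) := by
    ext i j
    have h1 : ∀ X : Matrix (A' × S) (A' × S) ℂ, (N X).trace = X.trace := fun X => by
      have h2 : ∀ Y : Matrix (B × E) (B × E) ℂ, (traceSnd Y).trace = Y.trace := fun Y => by
        simp only [trace, traceSnd, diag_apply, of_apply, Fintype.sum_prod_type]
      rw [hU.2, h2, trace_mul_comm, ← Matrix.mul_assoc, hU.1, Matrix.one_mul]
    have h3 := h1 (Matrix.of fun x y => σ (i, x) (j, y))
    simp only [traceSnd, applySnd, traceMid, of_apply]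
    simp only [trace, diag_apply, of_apply, Fintype.sum_prod_type] at h3
    rw [h3]
    exact Finset.sum_comm
  refine ⟨?_, ?_, hA, ?_⟩
  · rw [applySnd_eq_receiverKet hU hv, entropy_reduced_transpose]
  · rw [applySnd_eq_receiverKet hU hv, ← entropy_reduced_transpose (splitKet (receiverKet U v))]
    congr 1
    ext b b'
    simp only [traceFst, of_apply, mul_apply, transpose_apply, conjTranspose_apply, splitKet,
      sideKet, Fintype.sum_prod_type]
  · rw [← hA, applySnd_eq_receiverKet hU hv]
    ext i j
    simp only [traceFst, traceSnd, proj, receiverKet, of_apply, mul_apply, transpose_apply,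
      conjTranspose_apply, sideKet]
    exact Finset.sum_comm

end Identities

end QSideInfo

end

/-! ### Evaluation of the rate region. -/

theorem mainTheorem2
    {A A' S S' B : Type*}
    [Fintype A] [DecidableEq A] [Fintype A'] [DecidableEq A']
    [Fintype S] [DecidableEq S] [Fintype S'] [DecidableEq S']
    [Fintype B] [DecidableEq B]
    (N : Matrix (A' × S) (A' × S) ℂ →ₗ[ℂ] Matrix B B ℂ) (hN : QSideInfo.IsChannel N)
    (ψ : S × S' → ℂ) (hψ : QSideInfo.IsKet ψ)
    (σ : Matrix (A × A' × S) (A × A' × S) ℂ) (hσ : QSideInfo.IsState σ)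
    (hσS : QSideInfo.traceFst (QSideInfo.traceFst σ) =
      QSideInfo.traceSnd (QSideInfo.proj ψ))
    (IAB IAS Icoh : ℝ)
    (hIAB : IAB = QSideInfo.mutualInfo (QSideInfo.applySnd N σ))
    (hIAS : IAS = QSideInfo.mutualInfo (QSideInfo.traceMid σ))
    (hIcoh : Icoh = QSideInfo.coherentInfo (QSideInfo.applySnd N σ)) :
    (∀ (E D : Type*) [Fintype E] [DecidableEq E] [Fintype D] [DecidableEq D]
        (U : Matrix (B × E) (A' × S) ℂ) (v : (A × A' × S) × D → ℂ) (IAED : ℝ),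
        QSideInfo.IsIsometricExtension N U →
        QSideInfo.traceSnd (QSideInfo.proj v) = σ →
        IAED = QSideInfo.mutualInfo
          (QSideInfo.traceFst (QSideInfo.proj (QSideInfo.outputKet U v))) →
        (IAS < IAB → QSideInfo.AchievableWithEntanglement N ψ
          (1 / 2 * IAB - 1 / 2 * IAS) (1 / 2 * IAED) (1 / 2 * IAS)) ∧
        (1 / 2 * IAB - 1 / 2 * IAS) - 1 / 2 * (IAED - IAS) = Icoh ∧
        (0 ≤ 1 / 2 * (IAED - IAS) →
          (∀ Q : ℝ, 0 ≤ Q → Q ≤ Icoh → QSideInfo.UnassistedAchievable N ψ Q) ∧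
          (Icoh : EReal) ≤ QSideInfo.unassistedCapacity N ψ)) ∧
    (∀ Q : ℝ, 0 ≤ Q → Q ≤ min Icoh (1 / 2 * IAB - 1 / 2 * IAS) →
      QSideInfo.UnassistedAchievable N ψ Q) ∧
    ((min Icoh (1 / 2 * IAB - 1 / 2 * IAS) : ℝ) : EReal) ≤
      QSideInfo.unassistedCapacity N ψ := by
  open QSideInfo in
  have hA' : Nonempty A' := by
    by_contra h0
    rw [not_nonempty_iff] at h0
    have := hσ.2
    simp [trace] at this
  obtain ⟨k, U₀, hU₀⟩ := exists_isometricExtension hN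
  obtain ⟨v₀, hv₀⟩ := exists_purification hσ
  have hunassisted : ∀ Q : ℝ, 0 ≤ Q → Q ≤ min Icoh (1 / 2 * IAB - 1 / 2 * IAS) →
      UnassistedAchievable N ψ Q := fun Q hQ0 hQ => by
    rcases hQ0.eq_or_lt with h0 | h0
    · rw [← h0]; exact unassistedAchievable_zero hU₀ hψ
    have hQ1 := hQ.trans (min_le_left _ _)
    have hQ2 := hQ.trans (min_le_right _ _)
    obtain ⟨e1, e2, e3, -⟩ := output_entropies hU₀ hv₀
    have hside := sideKet_reduced (senderKet v₀)
    rw [senderKet_split_reduced hv₀] at hside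
    rw [hIAB, hIAS, mutualInfo, mutualInfo, e1, e2, e3] at hQ2
    rw [hIcoh, coherentInfo, e1, e2] at hQ1
    -- Consuming nothing and returning entanglement at rate `Icoh - Q` meets the condition for
    -- decoupling from the environment with equality; the condition for `S` becomes `2 * Q ≤ IAB -
    -- IAS`.
    refine (achievable_of_region hU₀ hψ v₀ (nsq_senderKet hσ hv₀) ?_ h0 le_rfl
      (y := Icoh - Q) (by linarith [hQ.trans (min_le_left _ _)]) ?_ ?_).2 rfl
    · rw [hside, traceFst_traceMid, hσS]
    · rw [senderKet_split_reduced hv₀, hside, hIcoh, coherentInfo, e1, e2]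
      linarith
    · rw [hIcoh, coherentInfo, e1, e2]
      linarith
  have hcap : ∀ Q : ℝ, (∀ Q' : ℝ, 0 ≤ Q' → Q' ≤ Q → UnassistedAchievable N ψ Q') →
      (Q : EReal) ≤ unassistedCapacity N ψ := fun Q hQ => by
    rcases le_or_gt 0 Q with h0 | h0
    · exact le_iSup₂ (f := fun (Q : ℝ) (_ : Q ∈ {Q : ℝ | UnassistedAchievable N ψ Q}) =>
        (Q : EReal)) Q (hQ Q h0 le_rfl)
    -- A negative bound holds because rate zero is always achievable.
    · refine le_trans (EReal.coe_le_coe_iff.2 h0.le) ?_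
      exact le_iSup₂ (f := fun (Q : ℝ) (_ : Q ∈ {Q : ℝ | UnassistedAchievable N ψ Q}) =>
        (Q : EReal)) 0 (unassistedAchievable_zero hU₀ hψ)
  refine ⟨?_, hunassisted, hcap _ hunassisted⟩
  intro E D _ _ _ _ U v IAED hU hv hIAED
  obtain ⟨e1, e2, e3, e4⟩ := output_entropies hU hv
  have hside := sideKet_reduced (senderKet v)
  rw [senderKet_split_reduced hv] at hside
  have hsend := nsq_senderKet hσ hv
  have hrec : nsq (splitKet (receiverKet U v)) = 1 := by rw [nsq_receiverKet hU.1, hsend]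
  have hIAS0 : 0 ≤ IAS := by
    rw [hIAS, ← senderKet_split_reduced hv]
    exact mutualInfo_nonneg (isState_reduced hsend)
  have hIAED0 : 0 ≤ IAED := by
    rw [hIAED, receiverKet_split_reduced]
    exact mutualInfo_nonneg (isState_reduced hrec)
  rw [mutualInfo, e4, receiverKet_split_reduced, ← sideKet_reduced] at hIAED
  have hid : (1 / 2 * IAB - 1 / 2 * IAS) - 1 / 2 * (IAED - IAS) = Icoh := by
    rw [hIAB, hIAED, hIcoh, mutualInfo, coherentInfo, e1, e2, e3]
    ring
  have hIAB' := hIAB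
  have hIAS' := hIAS
  rw [mutualInfo, e1, e2, e3] at hIAB'
  rw [mutualInfo] at hIAS'
  refine ⟨fun hlt => ?_, hid, fun hcost => ?_⟩
  -- At these rates both inequalities of the region are equalities, by `I(A;B) + I(A;ED) = 2H(A)`.
  · refine (achievable_of_region hU hψ v hsend ?_ (by linarith) (by linarith) (by linarith)
      ?_ ?_).1
    · rw [hside, traceFst_traceMid, hσS]
    · rw [senderKet_split_reduced hv, hside]
      linarith
    · linarith
  · have hall : ∀ Q : ℝ, 0 ≤ Q → Q ≤ Icoh → UnassistedAchievable N ψ Q := fun Q hQ0 hQ =>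
      -- By `hid`, a nonnegative net cost makes `Icoh` the smaller term of the minimum.
      hunassisted Q hQ0 (le_min hQ (by linarith))
    exact ⟨hall, hcap _ hall⟩
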